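/- Let $\mathcal V$ be a symmetric monoidal closed category with all small limits and all small colimits, with unit object $I$, and let $A$ be a small $\mathcal V$-category. Write $[A,\mathcal V]$ and $[A^{op},\mathcal V]$ for the $\mathcal V$-categories of $\mathcal V$-functors $A\to\mathcal V$ and $A^{op}\to\mathcal V$. For a presheaf $F:A^{op}\to\mathcal V$, let $-*F:[A,\mathcal V]\to\mathcal V$, $G\mapsto G*F=\int^{a\in A}Ga\otimes Fa$, be the left Kan extension of $F$ along the Yoneda embedding $Y:A^{op}\to[A,\mathcal V]$, $a\mapsto A(a,-)$. Call $F$ *$\mathcal P_0$-flat* if $-*F$ preserves all small weighted limits, i.e. all limits $\{P,G\}$ with $K$ a small $\mathcal V$-category, $P:K\to\mathcal V$ any $\mathcal V$-functor (index) and $G:K\to[A,\mathcal V]$ a $\mathcal V$-functor. A *$\mathcal V$-module* $M:B\nrightarrow C$ between small $\mathcal V$-categories is a $\mathcal V$-functor $C^{op}\otimes B\to\mathcal V$. Small $\mathcal V$-categories, modules and $\mathcal V$-natural transformations form a bicategory, in which the composite of $M:B\nrightarrow C$ and $N:C\nrightarrow D$ is $(N\circ M)(d,b)=\int^{c}N(d,c)\otimes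 M(c,b)$ and the identity of $B$ is $B(-,-)$. Write $I$ also for the unit $\mathcal V$-category (one object, hom-object $I$); a presheaf $F:A^{op}\to\mathcal V$ is the same thing as a module $I\nrightarrow A$. **Theorem.** A presheaf $F:A^{op}\to\mathcal V$ is $\mathcal P_0$-flat if and only if $F$, viewed as a module $I\nrightarrow A$, is a left adjoint in the bicategory of $\mathcal V$-modules. Consequently the $\mathcal P_0$-completion of $A$, that is, the full $\mathcal V$-subcategory $Flat_{\mathcal P_0}(A)$ of $[A^{op},\mathcal V]$ on the $\mathcal P_0$-flat presheaves, is the Cauchy-completion of $A$, that is, the full $\mathcal V$-subcategory of $[A^{op},\mathcal V]$ on the presheaves which are left adjoint modules: the two are isomorphic as $\mathcal V$-categories, by an isomorphism that commutes with the inclusions into $[A^{op},\mathcal V]$. -/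

import Mathlib

set_option linter.unusedSectionVars false

open CategoryTheory Limits MonoidalCategory MonoidalClosed

universe v u u₁ u₂

noncomputable section

namespace EnrichedFlat

variable {V : Type u} [Category.{v} V] [MonoidalCategory V]

section Tensor

variable [HasColimits V]
variable {B : Type v} [EnrichedCategory V B]

variable (p : B → V) (r : ∀ b b' : B, p b ⊗ (b ⟶[V] b') ⟶ p b')
  (q : B → V) (l : ∀ b b' : B, (b ⟶[V] b') ⊗ q b' ⟶ q b)

/-- The map `∐_{b,b'} p b ⊗ (B(b,b') ⊗ q b') ⟶ ∐_b p b ⊗ q b` acting on the right factor. -/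
def coendFst : (∐ fun x : B × B => p x.1 ⊗ ((x.1 ⟶[V] x.2) ⊗ q x.2)) ⟶ ∐ fun b : B => p b ⊗ q b :=
  Sigma.desc fun x => p x.1 ◁ l x.1 x.2 ≫ Sigma.ι (fun b : B => p b ⊗ q b) x.1

/-- The map `∐_{b,b'} p b ⊗ (B(b,b') ⊗ q b') ⟶ ∐_b p b ⊗ q b` acting on the left factor. -/
def coendSnd : (∐ fun x : B × B => p x.1 ⊗ ((x.1 ⟶[V] x.2) ⊗ q x.2)) ⟶ ∐ fun b : B => p b ⊗ q b :=
  Sigma.desc fun x =>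
    (α_ _ _ _).inv ≫ r x.1 x.2 ▷ q x.2 ≫ Sigma.ι (fun b : B => p b ⊗ q b) x.2

/-- The coend `∫^b p b ⊗ q b`, for a covariant action `r` of `B` on `p` and a contravariant
action `l` of `B` on `q`: the coequalizer of the two maps
`∐_{b,b'} p b ⊗ (B(b,b') ⊗ q b') ⇉ ∐_b p b ⊗ q b` given by the two actions. -/
def coend : V := coequalizer (coendFst p q l) (coendSnd p r q)

/-- The coprojections of the coend. -/
def coendι (b : B) : p b ⊗ q b ⟶ coend p r q l :=
  Sigma.ι (fun b : B => p b ⊗ q b) b ≫ coequalizer.π (coendFst p q l) (coendSnd p r q)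

theorem coend_condition (b b' : B) :
    p b ◁ l b b' ≫ coendι p r q l b =
      (α_ _ _ _).inv ≫ r b b' ▷ q b' ≫ coendι p r q l b' := by
  have h := Sigma.ι (fun x : B × B => p x.1 ⊗ ((x.1 ⟶[V] x.2) ⊗ q x.2)) (b, b') ≫=
    coequalizer.condition (coendFst p q l) (coendSnd p r q)
  simp only [coendFst, coendSnd, Sigma.ι_desc_assoc, Category.assoc] at h
  exact h

variable {p r q l}

theorem coend_hom_ext {Z : V} {f g : coend p r q l ⟶ Z}
    (h : ∀ b, coendι p r q l b ≫ f = coendι p r q l b ≫ g) : f = g := by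
  apply coequalizer.hom_ext
  apply Sigma.hom_ext
  intro b
  exact (Category.assoc _ _ _).symm.trans ((h b).trans (Category.assoc _ _ _))

/-- The map out of the coend induced by a compatible family. -/
def coendDesc {Z : V} (f : ∀ b, p b ⊗ q b ⟶ Z)
    (h : ∀ b b', p b ◁ l b b' ≫ f b = (α_ _ _ _).inv ≫ r b b' ▷ q b' ≫ f b') :
    coend p r q l ⟶ Z :=
  coequalizer.desc (Sigma.desc f) (by
    apply Sigma.hom_ext
    rintro ⟨b, b'⟩
    simpa [coendFst, coendSnd] using h b b')

@[simp]
theorem coendι_desc {Z : V} (f : ∀ b, p b ⊗ q b ⟶ Z)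
    (h : ∀ b b', p b ◁ l b b' ≫ f b = (α_ _ _ _).inv ≫ r b b' ▷ q b' ≫ f b') (b : B) :
    coendι p r q l b ≫ coendDesc f h = f b :=
  (Category.assoc _ _ _).trans
    ((congrArg (_ ≫ ·) (coequalizer.π_desc _ _)).trans (Sigma.ι_desc _ _))

@[simp]
theorem coendι_desc_assoc {Z : V} (f : ∀ b, p b ⊗ q b ⟶ Z)
    (h : ∀ b b', p b ◁ l b b' ≫ f b = (α_ _ _ _).inv ≫ r b b' ▷ q b' ≫ f b') (b : B) {U : V} (k : _ ⟶ U) :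
    coendι p r q l b ≫ coendDesc f h ≫ k =
      f b ≫ k :=
  (reassoc_of% (coendι_desc f h b)) k

variable [SymmetricCategory V] [MonoidalClosed V]

theorem coend_hom_extL (X : V) {Z : V} {f g : X ⊗ coend p r q l ⟶ Z}
    (h : ∀ b, X ◁ coendι p r q l b ≫ f = X ◁ coendι p r q l b ≫ g) : f = g := by
  apply curry_injective
  apply coend_hom_ext
  intro b
  rw [← curry_natural_left, ← curry_natural_left, h]

theorem coend_hom_extR (X : V) {Z : V} {f g : coend p r q l ⊗ X ⟶ Z}
    (h : ∀ b, coendι p r q l b ▷ X ≫ f = coendι p r q l b ▷ X ≫ g) : f = g := by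
  rw [← cancel_epi (β_ X (coend p r q l)).hom]
  apply coend_hom_extL
  intro b
  simp [h]

theorem coend_hom_extLL (X Y : V) {Z : V} {f g : X ⊗ (Y ⊗ coend p r q l) ⟶ Z}
    (h : ∀ b, X ◁ Y ◁ coendι p r q l b ≫ f = X ◁ Y ◁ coendι p r q l b ≫ g) : f = g := by
  rw [← cancel_epi (α_ X Y (coend p r q l)).hom]
  apply coend_hom_extL
  intro b
  simp [h]

theorem coend_hom_extLR (X Y : V) {Z : V} {f g : X ⊗ (coend p r q l ⊗ Y) ⟶ Z}
    (h : ∀ b, X ◁ coendι p r q l b ▷ Y ≫ f = X ◁ coendι p r q l b ▷ Y ≫ g) : f = g := by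
  rw [← cancel_epi (X ◁ (β_ Y (coend p r q l)).hom)]
  apply coend_hom_extLL
  intro b
  simp only [← MonoidalCategory.whiskerLeft_comp_assoc, BraidedCategory.braiding_naturality_right]
  simp [h]

theorem coend_hom_extLR' (X Y : V) {Z : V} {f g : (X ⊗ coend p r q l) ⊗ Y ⟶ Z}
    (h : ∀ b, (X ◁ coendι p r q l b) ▷ Y ≫ f = (X ◁ coendι p r q l b) ▷ Y ≫ g) : f = g := by
  rw [← cancel_epi (α_ X (coend p r q l) Y).inv]
  apply coend_hom_extLR
  intro b
  simp only [associator_inv_naturality_middle_assoc, h]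

/-- The map out of `X ⊗ ∫^b p b ⊗ q b` induced by a compatible family. -/
def coendDescL (X : V) {Z : V} (f : ∀ b, X ⊗ (p b ⊗ q b) ⟶ Z)
    (h : ∀ b b', X ◁ p b ◁ l b b' ≫ f b =
      X ◁ (α_ _ _ _).inv ≫ X ◁ r b b' ▷ q b' ≫ f b') :
    X ⊗ coend p r q l ⟶ Z :=
  uncurry (coendDesc (fun b => curry (f b)) fun b b' => by
    simp only [← curry_natural_left, h])

@[simp]
theorem coendι_descL (X : V) {Z : V} (f : ∀ b, X ⊗ (p b ⊗ q b) ⟶ Z)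
    (h : ∀ b b', X ◁ p b ◁ l b b' ≫ f b =
      X ◁ (α_ _ _ _).inv ≫ X ◁ r b b' ▷ q b' ≫ f b') (b : B) :
    X ◁ coendι p r q l b ≫ coendDescL X f h = f b := by
  simp [coendDescL, ← uncurry_natural_left]

@[simp]
theorem coendι_descL_assoc (X : V) {Z : V} (f : ∀ b, X ⊗ (p b ⊗ q b) ⟶ Z)
    (h : ∀ b b', X ◁ p b ◁ l b b' ≫ f b =
      X ◁ (α_ _ _ _).inv ≫ X ◁ r b b' ▷ q b' ≫ f b') (b : B) {U : V} (k : _ ⟶ U) :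
    X ◁ coendι p r q l b ≫ coendDescL X f h ≫ k =
      f b ≫ k :=
  (reassoc_of% (coendι_descL X f h b)) k

/-- The map out of `(∫^b p b ⊗ q b) ⊗ X` induced by a compatible family. -/
def coendDescR (X : V) {Z : V} (f : ∀ b, (p b ⊗ q b) ⊗ X ⟶ Z)
    (h : ∀ b b', (p b ◁ l b b') ▷ X ≫ f b =
      (α_ _ _ _).inv ▷ X ≫ r b b' ▷ q b' ▷ X ≫ f b') :
    coend p r q l ⊗ X ⟶ Z :=
  (β_ _ _).hom ≫ coendDescL X (fun b => (β_ _ _).hom ≫ f b) fun b b' => by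
    simp only [BraidedCategory.braiding_naturality_right_assoc, h]

@[simp]
theorem coendι_descR (X : V) {Z : V} (f : ∀ b, (p b ⊗ q b) ⊗ X ⟶ Z)
    (h : ∀ b b', (p b ◁ l b b') ▷ X ≫ f b =
      (α_ _ _ _).inv ▷ X ≫ r b b' ▷ q b' ▷ X ≫ f b') (b : B) :
    coendι p r q l b ▷ X ≫ coendDescR X f h = f b := by
  simp only [coendDescR, BraidedCategory.braiding_naturality_left_assoc, coendι_descL,
    SymmetricCategory.symmetry_assoc]

@[simp]
theorem coendι_descR_assoc (X : V) {Z : V} (f : ∀ b, (p b ⊗ q b) ⊗ X ⟶ Z)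
    (h : ∀ b b', (p b ◁ l b b') ▷ X ≫ f b =
      (α_ _ _ _).inv ▷ X ≫ r b b' ▷ q b' ▷ X ≫ f b') (b : B) {U : V} (k : _ ⟶ U) :
    coendι p r q l b ▷ X ≫ coendDescR X f h ≫ k =
      f b ≫ k :=
  (reassoc_of% (coendι_descR X f h b)) k

end Tensor
section Modules

variable (V) in
/-- A `V`-module `M : A ⇸ B`, that is, a `V`-functor `Bᵒᵖ ⊗ A ⟶ V`, presented by its values
`M(b,a)`, its contravariant action of `B` and its covariant action of `A`; the last axiom says
that the two actions commute. -/
structure VModule (A : Type u₁) (B : Type u₂) [EnrichedCategory V A] [EnrichedCategory V B] where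
  obj : B → A → V
  lact : ∀ (b' b : B) (a : A), (b' ⟶[V] b) ⊗ obj b a ⟶ obj b' a
  ract : ∀ (b : B) (a a' : A), obj b a ⊗ (a ⟶[V] a') ⟶ obj b a'
  id_lact : ∀ (b : B) (a : A), eId V b ▷ obj b a ≫ lact b b a = (λ_ _).hom
  comp_lact : ∀ (b₁ b₂ b₃ : B) (a : A), eComp V b₁ b₂ b₃ ▷ obj b₃ a ≫ lact b₁ b₃ a =
    (α_ _ _ _).hom ≫ (b₁ ⟶[V] b₂) ◁ lact b₂ b₃ a ≫ lact b₁ b₂ a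
  ract_id : ∀ (b : B) (a : A), obj b a ◁ eId V a ≫ ract b a a = (ρ_ _).hom
  ract_comp : ∀ (b : B) (a₁ a₂ a₃ : A), obj b a₁ ◁ eComp V a₁ a₂ a₃ ≫ ract b a₁ a₃ =
    (α_ _ _ _).inv ≫ ract b a₁ a₂ ▷ (a₂ ⟶[V] a₃) ≫ ract b a₂ a₃
  lact_ract : ∀ (b' b : B) (a a' : A), lact b' b a ▷ (a ⟶[V] a') ≫ ract b' a a' =
    (α_ _ _ _).hom ≫ (b' ⟶[V] b) ◁ ract b a a' ≫ lact b' b a'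

attribute [simp] VModule.id_lact VModule.ract_id

section Assoc

variable {A : Type u₁} {B : Type u₂} [EnrichedCategory V A] [EnrichedCategory V B]

@[simp]
theorem VModule.id_lact_assoc (M : VModule V A B) (b : B) (a : A) {U : V} (k : _ ⟶ U) :
    eId V b ▷ M.obj b a ≫ M.lact b b a ≫ k = (λ_ _).hom ≫ k :=
  (reassoc_of% (M.id_lact b a)) k

@[simp]
theorem VModule.ract_id_assoc (M : VModule V A B) (b : B) (a : A) {U : V} (k : _ ⟶ U) :
    M.obj b a ◁ eId V a ≫ M.ract b a a ≫ k = (ρ_ _).hom ≫ k :=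
  (reassoc_of% (M.ract_id b a)) k

end Assoc

section Hom

variable {A : Type u₁} {B : Type u₂} [EnrichedCategory V A] [EnrichedCategory V B]

/-- A morphism of `V`-modules `M ⟹ N : A ⇸ B`, that is, a `V`-natural transformation. -/
@[ext]
structure VModule.Hom (M N : VModule V A B) where
  app : ∀ (b : B) (a : A), M.obj b a ⟶ N.obj b a
  lact_app : ∀ (b' b : B) (a : A),
    M.lact b' b a ≫ app b' a = (b' ⟶[V] b) ◁ app b a ≫ N.lact b' b a
  ract_app : ∀ (b : B) (a a' : A),
    M.ract b a a' ≫ app b a' = app b a ▷ (a ⟶[V] a') ≫ N.ract b a a'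

theorem VModule.Hom.lact_app_assoc {M N : VModule V A B} (f : VModule.Hom M N) (b' b : B) (a : A)
    {U : V} (k : _ ⟶ U) :
    M.lact b' b a ≫ f.app b' a ≫ k = (b' ⟶[V] b) ◁ f.app b a ≫ N.lact b' b a ≫ k :=
  (reassoc_of% (f.lact_app b' b a)) k

theorem VModule.Hom.ract_app_assoc {M N : VModule V A B} (f : VModule.Hom M N) (b : B) (a a' : A)
    {U : V} (k : _ ⟶ U) :
    M.ract b a a' ≫ f.app b a' ≫ k = f.app b a ▷ (a ⟶[V] a') ≫ N.ract b a a' ≫ k :=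
  (reassoc_of% (f.ract_app b a a')) k

instance VModule.category : Category (VModule V A B) where
  Hom M N := VModule.Hom M N
  id M := ⟨fun _ _ => 𝟙 _, by simp, by simp⟩
  comp f g := ⟨fun b a => f.app b a ≫ g.app b a,
    by intros; simp [f.lact_app_assoc, g.lact_app],
    by intros; simp [f.ract_app_assoc, g.ract_app]⟩

@[ext]
theorem VModule.hom_ext {M N : VModule V A B} {f g : M ⟶ N} (h : ∀ b a, f.app b a = g.app b a) :
    f = g :=
  VModule.Hom.ext (by ext b a; exact h b a)

@[simp]
theorem VModule.id_app (M : VModule V A B) (b : B) (a : A) :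
    VModule.Hom.app (𝟙 M) b a = 𝟙 (M.obj b a) := rfl

@[simp]
theorem VModule.comp_app {M N P : VModule V A B} (f : M ⟶ N) (g : N ⟶ P) (b : B) (a : A) :
    (f ≫ g).app b a = f.app b a ≫ g.app b a := rfl

/-- A morphism of modules whose components are invertible is invertible. -/
@[simps]
def VModule.isoMk {M N : VModule V A B} (f : M ⟶ N) (g : ∀ b a, N.obj b a ⟶ M.obj b a)
    (hfg : ∀ b a, f.app b a ≫ g b a = 𝟙 _) (hgf : ∀ b a, g b a ≫ f.app b a = 𝟙 _) : M ≅ N where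
  hom := f
  inv :=
    { app := g
      lact_app := fun b' b a => by
        have h : (b' ⟶[V] b) ◁ g b a ≫ (b' ⟶[V] b) ◁ f.app b a = 𝟙 _ := by
          rw [← MonoidalCategory.whiskerLeft_comp, hgf, MonoidalCategory.whiskerLeft_id]
        rw [← Category.id_comp (N.lact b' b a), ← h, Category.assoc,
          Category.assoc, ← f.lact_app_assoc, hfg, Category.comp_id]
      ract_app := fun b a a' => by
        have h : g b a ▷ (a ⟶[V] a') ≫ f.app b a ▷ (a ⟶[V] a') = 𝟙 _ := by
          rw [← MonoidalCategory.comp_whiskerRight, hgf, MonoidalCategory.id_whiskerRight]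
        rw [← Category.id_comp (N.ract b a a'), ← h, Category.assoc,
          Category.assoc, ← f.ract_app_assoc, hfg, Category.comp_id] }
  hom_inv_id := by ext b a; exact hfg b a
  inv_hom_id := by ext b a; exact hgf b a

end Hom

/-- The identity module `A ⇸ A`, with values the hom-objects `A(a', a)`. -/
@[reducible]
def VModule.idMod (A : Type u₁) [EnrichedCategory V A] : VModule V A A where
  obj a' a := a' ⟶[V] a
  lact a₁ a₂ a := eComp V a₁ a₂ a
  ract a a₁ a₂ := eComp V a a₁ a₂
  id_lact b a := by rw [← Iso.inv_comp_eq_id, e_id_comp]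
  comp_lact b₁ b₂ b₃ a := by rw [e_assoc']
  ract_id b a := by rw [← Iso.inv_comp_eq_id, e_comp_id]
  ract_comp b a₁ a₂ a₃ := by rw [e_assoc]
  lact_ract b' b a a' := by rw [e_assoc']

section Comp

variable [HasColimits V]
variable {A : Type v} {B : Type v} {C : Type v} {D : Type v} [EnrichedCategory V A]
  [EnrichedCategory V B] [EnrichedCategory V C] [EnrichedCategory V D]

/-- The object `(N ∘ M)(c,a) = ∫^b N(c,b) ⊗ M(b,a)`. -/
abbrev VModule.compObj (M : VModule V A B) (N : VModule V B C) (c : C) (a : A) : V :=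
  coend (N.obj c) (N.ract c) (fun b => M.obj b a) (fun b b' => M.lact b b' a)

/-- The coprojection `N(c,b) ⊗ M(b,a) ⟶ (N ∘ M)(c,a)`. -/
abbrev VModule.compι' (M : VModule V A B) (N : VModule V B C) (c : C) (b : B) (a : A) :
    N.obj c b ⊗ M.obj b a ⟶ VModule.compObj M N c a :=
  coendι (N.obj c) (N.ract c) (fun b => M.obj b a) (fun b b' => M.lact b b' a) b

theorem VModule.compι'_condition (M : VModule V A B) (N : VModule V B C) (c : C) (b b' : B) (a : A) :
    N.obj c b ◁ M.lact b b' a ≫ VModule.compι' M N c b a =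
      (α_ _ _ _).inv ≫ N.ract c b b' ▷ M.obj b' a ≫ VModule.compι' M N c b' a :=
  coend_condition (N.obj c) (N.ract c) (fun b => M.obj b a) (fun b b' => M.lact b b' a) b b'

theorem VModule.compLact_aux (M : VModule V A B) (N : VModule V B C) (c' c : C) (a : A) (b b' : B) :
    (c' ⟶[V] c) ◁ N.obj c b ◁ M.lact b b' a ≫
        (α_ _ _ _).inv ≫ N.lact c' c b ▷ M.obj b a ≫ VModule.compι' M N c' b a =
      (c' ⟶[V] c) ◁ (α_ _ _ _).inv ≫ (c' ⟶[V] c) ◁ N.ract c b b' ▷ M.obj b' a ≫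
        (α_ _ _ _).inv ≫ N.lact c' c b' ▷ M.obj b' a ≫ VModule.compι' M N c' b' a := by
  have h := congrArg (· ▷ M.obj b' a) (N.lact_ract c' c b b')
  simp only [MonoidalCategory.comp_whiskerRight] at h
  simp only [associator_inv_naturality_right_assoc, whisker_exchange_assoc,
    VModule.compι'_condition, associator_inv_naturality_left_assoc, reassoc_of% h]
  simp

theorem VModule.compRact_aux (M : VModule V A B) (N : VModule V B C) (c : C) (a a' : A) (b b' : B) :
    (N.obj c b ◁ M.lact b b' a) ▷ (a ⟶[V] a') ≫
        (α_ _ _ _).hom ≫ N.obj c b ◁ M.ract b a a' ≫ VModule.compι' M N c b a' =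
      (α_ _ _ _).inv ▷ (a ⟶[V] a') ≫ N.ract c b b' ▷ M.obj b' a ▷ (a ⟶[V] a') ≫
        (α_ _ _ _).hom ≫ N.obj c b' ◁ M.ract b' a a' ≫ VModule.compι' M N c b' a' := by
  have h := congrArg (N.obj c b ◁ ·) (M.lact_ract b b' a a')
  simp only [MonoidalCategory.whiskerLeft_comp] at h
  simp only [associator_naturality_middle_assoc, reassoc_of% h, VModule.compι'_condition,
    associator_naturality_left_assoc, associator_inv_naturality_right_assoc,
    whisker_exchange_assoc]
  simp

variable [SymmetricCategory V] [MonoidalClosed V]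

/-- The composite `N ∘ M : A ⇸ C` of the modules `M : A ⇸ B` and `N : B ⇸ C`. -/
def VModule.compMod (M : VModule V A B) (N : VModule V B C) : VModule V A C where
  obj c a := VModule.compObj M N c a
  lact c' c a := coendDescL _
    (fun b => (α_ _ _ _).inv ≫ N.lact c' c b ▷ M.obj b a ≫ VModule.compι' M N c' b a)
    (VModule.compLact_aux M N c' c a)
  ract c a a' := coendDescR _
    (fun b => (α_ _ _ _).hom ≫ N.obj c b ◁ M.ract b a a' ≫ VModule.compι' M N c b a')
    (VModule.compRact_aux M N c a a')
  id_lact c a := by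
    apply coend_hom_extL
    intro b
    rw [whisker_exchange_assoc, coendι_descL]
    have h := congrArg (· ▷ M.obj b a) (N.id_lact c b)
    simp only [MonoidalCategory.comp_whiskerRight] at h
    simp only [associator_inv_naturality_left_assoc, reassoc_of% h]
    simp
  comp_lact c₁ c₂ c₃ a := by
    apply coend_hom_extL
    intro b
    have h := congrArg (· ▷ M.obj b a) (N.comp_lact c₁ c₂ c₃ b)
    simp only [MonoidalCategory.comp_whiskerRight] at h
    rw [whisker_exchange_assoc, coendι_descL, associator_naturality_right_assoc,
      ← MonoidalCategory.whiskerLeft_comp_assoc, coendι_descL]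
    simp only [associator_inv_naturality_left_assoc, reassoc_of% h,
      MonoidalCategory.whiskerLeft_comp, Category.assoc, coendι_descL]
    simp
  ract_id c a := by
    apply coend_hom_extR
    intro b
    rw [← whisker_exchange_assoc, coendι_descR]
    have h := congrArg (N.obj c b ◁ ·) (M.ract_id b a)
    simp only [MonoidalCategory.whiskerLeft_comp] at h
    simp only [associator_naturality_right_assoc, reassoc_of% h]
    simp
  ract_comp c a₁ a₂ a₃ := by
    apply coend_hom_extR
    intro b
    have h := congrArg (N.obj c b ◁ ·) (M.ract_comp b a₁ a₂ a₃)
    simp only [MonoidalCategory.whiskerLeft_comp] at h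
    rw [← whisker_exchange_assoc, coendι_descR, associator_inv_naturality_left_assoc,
      ← MonoidalCategory.comp_whiskerRight_assoc, coendι_descR]
    simp only [associator_naturality_right_assoc, reassoc_of% h,
      MonoidalCategory.comp_whiskerRight, Category.assoc, coendι_descR]
    simp
  lact_ract c' c a a' := by
    apply coend_hom_extLR'
    intro b
    rw [← MonoidalCategory.comp_whiskerRight_assoc, coendι_descL,
      associator_naturality_middle_assoc, ← MonoidalCategory.whiskerLeft_comp_assoc, coendι_descR]
    simp only [MonoidalCategory.whiskerLeft_comp, MonoidalCategory.comp_whiskerRight,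
      Category.assoc, coendι_descR, coendι_descL]
    rw [associator_naturality_left_assoc, ← whisker_exchange_assoc,
      associator_inv_naturality_right_assoc]
    simp

section CompAPI

variable {M : VModule V A B} {N : VModule V B C}

variable (M N) in
/-- The coprojection `N(c,b) ⊗ M(b,a) ⟶ (N ∘ M)(c,a)`. -/
def VModule.compι (c : C) (b : B) (a : A) :
    N.obj c b ⊗ M.obj b a ⟶ (VModule.compMod M N).obj c a :=
  VModule.compι' M N c b a

variable (M N) in
theorem VModule.compι_condition (c : C) (b b' : B) (a : A) :
    N.obj c b ◁ M.lact b b' a ≫ VModule.compι M N c b a =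
      (α_ _ _ _).inv ≫ N.ract c b b' ▷ M.obj b' a ≫ VModule.compι M N c b' a :=
  VModule.compι'_condition M N c b b' a

variable (M N) in
@[simp]
theorem VModule.compι_lact (c' c : C) (b : B) (a : A) :
    (c' ⟶[V] c) ◁ VModule.compι M N c b a ≫ (VModule.compMod M N).lact c' c a =
      (α_ _ _ _).inv ≫ N.lact c' c b ▷ M.obj b a ≫ VModule.compι M N c' b a :=
  coendι_descL (c' ⟶[V] c) _ (VModule.compLact_aux M N c' c a) b

variable (M N) in
@[simp]
theorem VModule.compι_lact_assoc (c' c : C) (b : B) (a : A) {U : V} (k : _ ⟶ U) :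
    (c' ⟶[V] c) ◁ VModule.compι M N c b a ≫ (VModule.compMod M N).lact c' c a ≫ k =
      (α_ _ _ _).inv ≫ N.lact c' c b ▷ M.obj b a ≫ VModule.compι M N c' b a ≫ k :=
  (reassoc_of% (VModule.compι_lact M N c' c b a)) k

variable (M N) in
@[simp]
theorem VModule.compι_ract (c : C) (b : B) (a a' : A) :
    VModule.compι M N c b a ▷ (a ⟶[V] a') ≫ (VModule.compMod M N).ract c a a' =
      (α_ _ _ _).hom ≫ N.obj c b ◁ M.ract b a a' ≫ VModule.compι M N c b a' :=
  coendι_descR (a ⟶[V] a') _ (VModule.compRact_aux M N c a a') b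

variable (M N) in
@[simp]
theorem VModule.compι_ract_assoc (c : C) (b : B) (a a' : A) {U : V} (k : _ ⟶ U) :
    VModule.compι M N c b a ▷ (a ⟶[V] a') ≫ (VModule.compMod M N).ract c a a' ≫ k =
      (α_ _ _ _).hom ≫ N.obj c b ◁ M.ract b a a' ≫ VModule.compι M N c b a' ≫ k :=
  (reassoc_of% (VModule.compι_ract M N c b a a')) k

variable {c : C} {a : A} {Z : V}

theorem VModule.comp_ext {f g : (VModule.compMod M N).obj c a ⟶ Z}
    (h : ∀ b, VModule.compι M N c b a ≫ f = VModule.compι M N c b a ≫ g) : f = g :=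
  coend_hom_ext h

theorem VModule.comp_extL (X : V) {f g : X ⊗ (VModule.compMod M N).obj c a ⟶ Z}
    (h : ∀ b, X ◁ VModule.compι M N c b a ≫ f = X ◁ VModule.compι M N c b a ≫ g) : f = g :=
  coend_hom_extL X h

theorem VModule.comp_extR (X : V) {f g : (VModule.compMod M N).obj c a ⊗ X ⟶ Z}
    (h : ∀ b, VModule.compι M N c b a ▷ X ≫ f = VModule.compι M N c b a ▷ X ≫ g) : f = g :=
  coend_hom_extR X h

theorem VModule.comp_extLL (X Y : V) {f g : X ⊗ (Y ⊗ (VModule.compMod M N).obj c a) ⟶ Z}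
    (h : ∀ b, X ◁ Y ◁ VModule.compι M N c b a ≫ f = X ◁ Y ◁ VModule.compι M N c b a ≫ g) :
    f = g :=
  coend_hom_extLL X Y h

theorem VModule.comp_extLR' (X Y : V) {f g : (X ⊗ (VModule.compMod M N).obj c a) ⊗ Y ⟶ Z}
    (h : ∀ b, (X ◁ VModule.compι M N c b a) ▷ Y ≫ f = (X ◁ VModule.compι M N c b a) ▷ Y ≫ g) :
    f = g :=
  coend_hom_extLR' X Y h

theorem VModule.comp_extRR (X Y : V) {f g : ((VModule.compMod M N).obj c a ⊗ X) ⊗ Y ⟶ Z}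
    (h : ∀ b, VModule.compι M N c b a ▷ X ▷ Y ≫ f = VModule.compι M N c b a ▷ X ▷ Y ≫ g) :
    f = g := by
  rw [← cancel_epi (α_ _ X Y).inv]
  apply VModule.comp_extR
  intro b
  simp only [associator_inv_naturality_left_assoc, h]

/-- The map out of `(N ∘ M)(c,a)` induced by a compatible family. -/
def VModule.compDesc (f : ∀ b, N.obj c b ⊗ M.obj b a ⟶ Z)
    (h : ∀ b b', N.obj c b ◁ M.lact b b' a ≫ f b =
      (α_ _ _ _).inv ≫ N.ract c b b' ▷ M.obj b' a ≫ f b') :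
    (VModule.compMod M N).obj c a ⟶ Z :=
  coendDesc f h

@[simp]
theorem VModule.compι_desc (f : ∀ b, N.obj c b ⊗ M.obj b a ⟶ Z)
    (h : ∀ b b', N.obj c b ◁ M.lact b b' a ≫ f b =
      (α_ _ _ _).inv ≫ N.ract c b b' ▷ M.obj b' a ≫ f b') (b : B) :
    VModule.compι M N c b a ≫ VModule.compDesc f h = f b :=
  coendι_desc _ _ _

@[simp]
theorem VModule.compι_desc_assoc (f : ∀ b, N.obj c b ⊗ M.obj b a ⟶ Z)
    (h : ∀ b b', N.obj c b ◁ M.lact b b' a ≫ f b =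
      (α_ _ _ _).inv ≫ N.ract c b b' ▷ M.obj b' a ≫ f b') (b : B) {U : V} (k : _ ⟶ U) :
    VModule.compι M N c b a ≫ VModule.compDesc f h ≫ k =
      f b ≫ k :=
  (reassoc_of% (VModule.compι_desc f h b)) k

/-- The map out of `X ⊗ (N ∘ M)(c,a)` induced by a compatible family. -/
def VModule.compDescL (X : V) (f : ∀ b, X ⊗ (N.obj c b ⊗ M.obj b a) ⟶ Z)
    (h : ∀ b b', X ◁ N.obj c b ◁ M.lact b b' a ≫ f b =
      X ◁ (α_ _ _ _).inv ≫ X ◁ N.ract c b b' ▷ M.obj b' a ≫ f b') :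
    X ⊗ (VModule.compMod M N).obj c a ⟶ Z :=
  coendDescL X f h

@[simp]
theorem VModule.compι_descL (X : V) (f : ∀ b, X ⊗ (N.obj c b ⊗ M.obj b a) ⟶ Z)
    (h : ∀ b b', X ◁ N.obj c b ◁ M.lact b b' a ≫ f b =
      X ◁ (α_ _ _ _).inv ≫ X ◁ N.ract c b b' ▷ M.obj b' a ≫ f b') (b : B) :
    X ◁ VModule.compι M N c b a ≫ VModule.compDescL X f h = f b :=
  coendι_descL X _ _ b

@[simp]
theorem VModule.compι_descL_assoc (X : V) (f : ∀ b, X ⊗ (N.obj c b ⊗ M.obj b a) ⟶ Z)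
    (h : ∀ b b', X ◁ N.obj c b ◁ M.lact b b' a ≫ f b =
      X ◁ (α_ _ _ _).inv ≫ X ◁ N.ract c b b' ▷ M.obj b' a ≫ f b') (b : B) {U : V} (k : _ ⟶ U) :
    X ◁ VModule.compι M N c b a ≫ VModule.compDescL X f h ≫ k =
      f b ≫ k :=
  (reassoc_of% (VModule.compι_descL X f h b)) k

/-- The map out of `(N ∘ M)(c,a) ⊗ X` induced by a compatible family. -/
def VModule.compDescR (X : V) (f : ∀ b, (N.obj c b ⊗ M.obj b a) ⊗ X ⟶ Z)
    (h : ∀ b b', (N.obj c b ◁ M.lact b b' a) ▷ X ≫ f b =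
      (α_ _ _ _).inv ▷ X ≫ N.ract c b b' ▷ M.obj b' a ▷ X ≫ f b') :
    (VModule.compMod M N).obj c a ⊗ X ⟶ Z :=
  coendDescR X f h

@[simp]
theorem VModule.compι_descR (X : V) (f : ∀ b, (N.obj c b ⊗ M.obj b a) ⊗ X ⟶ Z)
    (h : ∀ b b', (N.obj c b ◁ M.lact b b' a) ▷ X ≫ f b =
      (α_ _ _ _).inv ▷ X ≫ N.ract c b b' ▷ M.obj b' a ▷ X ≫ f b') (b : B) :
    VModule.compι M N c b a ▷ X ≫ VModule.compDescR X f h = f b :=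
  coendι_descR X _ _ b

@[simp]
theorem VModule.compι_descR_assoc (X : V) (f : ∀ b, (N.obj c b ⊗ M.obj b a) ⊗ X ⟶ Z)
    (h : ∀ b b', (N.obj c b ◁ M.lact b b' a) ▷ X ≫ f b =
      (α_ _ _ _).inv ▷ X ≫ N.ract c b b' ▷ M.obj b' a ▷ X ≫ f b') (b : B) {U : V} (k : _ ⟶ U) :
    VModule.compι M N c b a ▷ X ≫ VModule.compDescR X f h ≫ k =
      f b ≫ k :=
  (reassoc_of% (VModule.compι_descR X f h b)) k

end CompAPI

/-- The whiskering of `η : N ⟹ N' : B ⇸ C` with `M : A ⇸ B`. -/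
def VModule.wl (M : VModule V A B) {N N' : VModule V B C} (η : N ⟶ N') :
    VModule.compMod M N ⟶ VModule.compMod M N' where
  app c a := VModule.compDesc (fun b => η.app c b ▷ M.obj b a ≫ VModule.compι M N' c b a) (by
    intro b b'
    have h := congrArg (· ▷ M.obj b' a) (η.ract_app c b b')
    simp only [MonoidalCategory.comp_whiskerRight] at h
    rw [whisker_exchange_assoc, VModule.compι_condition, reassoc_of% h]
    simp)
  lact_app c' c a := by
    apply VModule.comp_extL
    intro b
    have h := congrArg (· ▷ M.obj b a) (η.lact_app c' c b)
    simp only [MonoidalCategory.comp_whiskerRight] at h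
    rw [VModule.compι_lact_assoc, VModule.compι_desc, ← MonoidalCategory.whiskerLeft_comp_assoc,
      VModule.compι_desc, MonoidalCategory.whiskerLeft_comp_assoc, VModule.compι_lact, reassoc_of% h]
    simp
  ract_app c a a' := by
    apply VModule.comp_extR
    intro b
    rw [VModule.compι_ract_assoc, VModule.compι_desc, ← MonoidalCategory.comp_whiskerRight_assoc,
      VModule.compι_desc, MonoidalCategory.comp_whiskerRight_assoc, VModule.compι_ract,
      associator_naturality_left_assoc, ← whisker_exchange_assoc]

@[simp]
theorem VModule.compι_wl (M : VModule V A B) {N N' : VModule V B C} (η : N ⟶ N')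
    (c : C) (b : B) (a : A) :
    VModule.compι M N c b a ≫ (VModule.wl M η).app c a =
      η.app c b ▷ M.obj b a ≫ VModule.compι M N' c b a := by
  dsimp only [VModule.wl]
  rw [VModule.compι_desc]

@[simp]
theorem VModule.compι_wl_assoc (M : VModule V A B) {N N' : VModule V B C} (η : N ⟶ N')
    (c : C) (b : B) (a : A) {U : V} (k : _ ⟶ U) :
    VModule.compι M N c b a ≫ (VModule.wl M η).app c a ≫ k =
      η.app c b ▷ M.obj b a ≫ VModule.compι M N' c b a ≫ k :=
  (reassoc_of% (VModule.compι_wl M η c b a)) k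

/-- The whiskering of `η : M ⟹ M' : A ⇸ B` with `N : B ⇸ C`. -/
def VModule.wr {M M' : VModule V A B} (η : M ⟶ M') (N : VModule V B C) :
    VModule.compMod M N ⟶ VModule.compMod M' N where
  app c a := VModule.compDesc (fun b => N.obj c b ◁ η.app b a ≫ VModule.compι M' N c b a) (by
    intro b b'
    have h := congrArg (N.obj c b ◁ ·) (η.lact_app b b' a)
    simp only [MonoidalCategory.whiskerLeft_comp] at h
    rw [reassoc_of% h, VModule.compι_condition, ← whisker_exchange_assoc]
    simp)
  lact_app c' c a := by
    apply VModule.comp_extL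
    intro b
    rw [VModule.compι_lact_assoc, VModule.compι_desc, ← MonoidalCategory.whiskerLeft_comp_assoc,
      VModule.compι_desc, MonoidalCategory.whiskerLeft_comp_assoc, VModule.compι_lact,
      associator_inv_naturality_right_assoc, whisker_exchange_assoc]
  ract_app c a a' := by
    apply VModule.comp_extR
    intro b
    have h := congrArg (N.obj c b ◁ ·) (η.ract_app b a a')
    simp only [MonoidalCategory.whiskerLeft_comp] at h
    rw [VModule.compι_ract_assoc, VModule.compι_desc, ← MonoidalCategory.comp_whiskerRight_assoc,
      VModule.compι_desc, MonoidalCategory.comp_whiskerRight_assoc, VModule.compι_ract, reassoc_of% h]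
    simp

@[simp]
theorem VModule.compι_wr {M M' : VModule V A B} (η : M ⟶ M') (N : VModule V B C)
    (c : C) (b : B) (a : A) :
    VModule.compι M N c b a ≫ (VModule.wr η N).app c a =
      N.obj c b ◁ η.app b a ≫ VModule.compι M' N c b a := by
  dsimp only [VModule.wr]
  rw [VModule.compι_desc]

@[simp]
theorem VModule.compι_wr_assoc {M M' : VModule V A B} (η : M ⟶ M') (N : VModule V B C)
    (c : C) (b : B) (a : A) {U : V} (k : _ ⟶ U) :
    VModule.compι M N c b a ≫ (VModule.wr η N).app c a ≫ k =
      N.obj c b ◁ η.app b a ≫ VModule.compι M' N c b a ≫ k :=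
  (reassoc_of% (VModule.compι_wr η N c b a)) k

/-- The unit isomorphism `M ∘ 1_A ≅ M`. -/
def VModule.lu (M : VModule V A B) : VModule.compMod (VModule.idMod A) M ≅ M :=
  VModule.isoMk
    { app := fun b a => VModule.compDesc (fun a' => M.ract b a' a) (fun a' a'' => M.ract_comp b a' a'' a)
      lact_app := fun b' b a => by
        apply VModule.comp_extL
        intro a'
        rw [VModule.compι_lact_assoc, VModule.compι_desc, ← MonoidalCategory.whiskerLeft_comp_assoc,
          VModule.compι_desc]
        rw [M.lact_ract]
        simp
      ract_app := fun b a₁ a₂ => by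
        apply VModule.comp_extR
        intro a'
        rw [VModule.compι_ract_assoc, VModule.compι_desc, ← MonoidalCategory.comp_whiskerRight_assoc,
          VModule.compι_desc]
        rw [M.ract_comp]
        simp }
    (fun b a => (ρ_ _).inv ≫ M.obj b a ◁ eId V a ≫ VModule.compι (VModule.idMod A) M b a a)
    (fun b a => by
      apply VModule.comp_ext
      intro a'
      have h := VModule.compι_condition (VModule.idMod A) M b a' a a
      have e : (a' ⟶[V] a) ◁ eId V a ≫ eComp V a' a a = (ρ_ _).hom := by
        rw [← Iso.inv_comp_eq_id, e_comp_id]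
      replace e := congrArg (M.obj b a' ◁ ·) e
      simp only [MonoidalCategory.whiskerLeft_comp] at e
      rw [Iso.eq_inv_comp] at h
      rw [VModule.compι_desc_assoc, rightUnitor_inv_naturality_assoc, ← whisker_exchange_assoc,
        ← h, associator_naturality_right_assoc, reassoc_of% e]
      simp)
    (fun b a => by
      simp)

@[simp]
theorem VModule.compι_lu (M : VModule V A B) (b : B) (a' a : A) :
    VModule.compι (VModule.idMod A) M b a' a ≫ (VModule.lu M).hom.app b a = M.ract b a' a := by
  dsimp only [VModule.lu, VModule.isoMk]
  rw [VModule.compι_desc]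

@[simp]
theorem VModule.compι_lu_assoc (M : VModule V A B) (b : B) (a' a : A) {U : V} (k : _ ⟶ U) :
    VModule.compι (VModule.idMod A) M b a' a ≫ (VModule.lu M).hom.app b a ≫ k =
      M.ract b a' a ≫ k :=
  (reassoc_of% (VModule.compι_lu M b a' a)) k

/-- The unit isomorphism `1_B ∘ M ≅ M`. -/
def VModule.ru (M : VModule V A B) : VModule.compMod M (VModule.idMod B) ≅ M :=
  VModule.isoMk
    { app := fun b a => VModule.compDesc (fun b' => M.lact b b' a) (fun b' b'' => by
        rw [M.comp_lact]
        simp)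
      lact_app := fun b' b a => by
        apply VModule.comp_extL
        intro b''
        rw [VModule.compι_lact_assoc, VModule.compι_desc, ← MonoidalCategory.whiskerLeft_comp_assoc,
          VModule.compι_desc]
        rw [M.comp_lact]
        simp
      ract_app := fun b a₁ a₂ => by
        apply VModule.comp_extR
        intro b'
        rw [VModule.compι_ract_assoc, VModule.compι_desc, ← MonoidalCategory.comp_whiskerRight_assoc,
          VModule.compι_desc]
        rw [M.lact_ract] }
    (fun b a => (λ_ _).inv ≫ eId V b ▷ M.obj b a ≫ VModule.compι M (VModule.idMod B) b b a)
    (fun b a => by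
      apply VModule.comp_ext
      intro b'
      have h := VModule.compι_condition M (VModule.idMod B) b b b' a
      have e : eId V b ▷ (b ⟶[V] b') ≫ eComp V b b b' = (λ_ _).hom := by
        rw [← Iso.inv_comp_eq_id, e_id_comp]
      replace e := congrArg (· ▷ M.obj b' a) e
      simp only [MonoidalCategory.comp_whiskerRight] at e
      rw [VModule.compι_desc_assoc, leftUnitor_inv_naturality_assoc, whisker_exchange_assoc,
        h, associator_inv_naturality_left_assoc, reassoc_of% e]
      simp)
    (fun b a => by
      simp)

@[simp]
theorem VModule.compι_ru (M : VModule V A B) (b b' : B) (a : A) :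
    VModule.compι M (VModule.idMod B) b b' a ≫ (VModule.ru M).hom.app b a = M.lact b b' a := by
  dsimp only [VModule.ru, VModule.isoMk]
  rw [VModule.compι_desc]

@[simp]
theorem VModule.compι_ru_assoc (M : VModule V A B) (b b' : B) (a : A) {U : V} (k : _ ⟶ U) :
    VModule.compι M (VModule.idMod B) b b' a ≫ (VModule.ru M).hom.app b a ≫ k =
      M.lact b b' a ≫ k :=
  (reassoc_of% (VModule.compι_ru M b b' a)) k

/-- Morphisms out of a triple composite are determined on the coprojections. -/
theorem VModule.comp_ext₃ {M : VModule V A B} {N : VModule V B C} {P : VModule V C D} {d : D}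
    {a : A} {Z : V} {f g : (VModule.compMod (VModule.compMod M N) P).obj d a ⟶ Z}
    (h : ∀ c b, P.obj d c ◁ VModule.compι M N c b a ≫
        VModule.compι (VModule.compMod M N) P d c a ≫ f =
      P.obj d c ◁ VModule.compι M N c b a ≫
        VModule.compι (VModule.compMod M N) P d c a ≫ g) : f = g :=
  VModule.comp_ext fun c => VModule.comp_extL _ fun b => h c b

/-- Morphisms out of a triple composite are determined on the coprojections. -/
theorem VModule.comp_ext₃' {M : VModule V A B} {N : VModule V B C} {P : VModule V C D} {d : D}
    {a : A} {Z : V} {f g : (VModule.compMod M (VModule.compMod N P)).obj d a ⟶ Z}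
    (h : ∀ b c, VModule.compι N P d c b ▷ M.obj b a ≫
        VModule.compι M (VModule.compMod N P) d b a ≫ f =
      VModule.compι N P d c b ▷ M.obj b a ≫
        VModule.compι M (VModule.compMod N P) d b a ≫ g) : f = g :=
  VModule.comp_ext fun b => VModule.comp_extR _ fun c => h b c

theorem VModule.assocInner_aux (M : VModule V A B) (N : VModule V B C) (P : VModule V C D)
    (d : D) (c : C) (a : A) (b b' : B) :
    P.obj d c ◁ N.obj c b ◁ M.lact b b' a ≫ (α_ _ _ _).inv ≫
        VModule.compι N P d c b ▷ M.obj b a ≫ VModule.compι M (VModule.compMod N P) d b a =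
      P.obj d c ◁ (α_ _ _ _).inv ≫ P.obj d c ◁ N.ract c b b' ▷ M.obj b' a ≫ (α_ _ _ _).inv ≫
        VModule.compι N P d c b' ▷ M.obj b' a ≫ VModule.compι M (VModule.compMod N P) d b' a := by
  have h := congrArg (· ▷ M.obj b' a) (VModule.compι_ract N P d c b b')
  simp only [MonoidalCategory.comp_whiskerRight] at h
  rw [associator_inv_naturality_right_assoc, whisker_exchange_assoc, VModule.compι_condition,
    associator_inv_naturality_left_assoc, reassoc_of% h]
  simp

/-- The component `P(d,c) ⊗ (N ∘ M)(c,a) ⟶ ((P ∘ N) ∘ M)(d,a)` of the associator. -/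
def VModule.assocInner (M : VModule V A B) (N : VModule V B C) (P : VModule V C D)
    (d : D) (c : C) (a : A) : P.obj d c ⊗ (VModule.compMod M N).obj c a ⟶
      (VModule.compMod M (VModule.compMod N P)).obj d a :=
  VModule.compDescL (P.obj d c)
    (fun b => (α_ _ _ _).inv ≫ VModule.compι N P d c b ▷ M.obj b a ≫
      VModule.compι M (VModule.compMod N P) d b a)
    (VModule.assocInner_aux M N P d c a)

@[simp]
theorem VModule.compι_assocInner (M : VModule V A B) (N : VModule V B C) (P : VModule V C D)
    (d : D) (c : C) (b : B) (a : A) :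
    P.obj d c ◁ VModule.compι M N c b a ≫ VModule.assocInner M N P d c a =
      (α_ _ _ _).inv ≫ VModule.compι N P d c b ▷ M.obj b a ≫
        VModule.compι M (VModule.compMod N P) d b a :=
  VModule.compι_descL _ _ (VModule.assocInner_aux M N P d c a) b

@[simp]
theorem VModule.compι_assocInner_assoc (M : VModule V A B) (N : VModule V B C) (P : VModule V C D)
    (d : D) (c : C) (b : B) (a : A) {U : V} (k : _ ⟶ U) :
    P.obj d c ◁ VModule.compι M N c b a ≫ VModule.assocInner M N P d c a ≫ k =
      (α_ _ _ _).inv ≫ VModule.compι N P d c b ▷ M.obj b a ≫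
        VModule.compι M (VModule.compMod N P) d b a ≫ k :=
  (reassoc_of% (VModule.compι_assocInner M N P d c b a)) k

theorem VModule.assocApp_aux (M : VModule V A B) (N : VModule V B C) (P : VModule V C D)
    (d : D) (a : A) (c c' : C) :
    P.obj d c ◁ (VModule.compMod M N).lact c c' a ≫ VModule.assocInner M N P d c a =
      (α_ _ _ _).inv ≫ P.ract d c c' ▷ (VModule.compMod M N).obj c' a ≫
        VModule.assocInner M N P d c' a := by
  apply VModule.comp_extLL
  intro b
  have h := congrArg (P.obj d c ◁ ·) (VModule.compι_lact M N c c' b a)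
  simp only [MonoidalCategory.whiskerLeft_comp] at h
  have h' := congrArg (· ▷ M.obj b a) (VModule.compι_condition N P d c c' b)
  simp only [MonoidalCategory.comp_whiskerRight] at h'
  rw [reassoc_of% h, VModule.compι_assocInner, associator_inv_naturality_right_assoc,
    whisker_exchange_assoc, VModule.compι_assocInner, associator_inv_naturality_left_assoc,
    associator_inv_naturality_middle_assoc, reassoc_of% h']
  simp

/-- The morphism underlying the associator. -/
def VModule.assocHom (M : VModule V A B) (N : VModule V B C) (P : VModule V C D) :
    VModule.compMod (VModule.compMod M N) P ⟶ VModule.compMod M (VModule.compMod N P) where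
  app d a := VModule.compDesc (fun c => VModule.assocInner M N P d c a)
    (VModule.assocApp_aux M N P d a)
  lact_app d' d a := by
    apply VModule.comp_extL
    intro c
    rw [VModule.compι_lact_assoc, VModule.compι_desc, ← MonoidalCategory.whiskerLeft_comp_assoc,
      VModule.compι_desc]
    apply VModule.comp_extLL
    intro b
    have h := congrArg (· ▷ M.obj b a) (VModule.compι_lact N P d' d c b)
    simp only [MonoidalCategory.comp_whiskerRight] at h
    rw [associator_inv_naturality_right_assoc, whisker_exchange_assoc,
      VModule.compι_assocInner, ← MonoidalCategory.whiskerLeft_comp_assoc,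
      VModule.compι_assocInner]
    simp only [MonoidalCategory.whiskerLeft_comp, Category.assoc, VModule.compι_lact,
      associator_inv_naturality_middle_assoc, reassoc_of% h, associator_inv_naturality_left_assoc]
    simp
  ract_app d a a' := by
    apply VModule.comp_extR
    intro c
    rw [VModule.compι_ract_assoc, VModule.compι_desc, ← MonoidalCategory.comp_whiskerRight_assoc,
      VModule.compι_desc]
    apply VModule.comp_extLR'
    intro b
    have h := congrArg (P.obj d c ◁ ·) (VModule.compι_ract M N c b a a')
    simp only [MonoidalCategory.whiskerLeft_comp] at h
    rw [associator_naturality_middle_assoc, reassoc_of% h,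
      VModule.compι_assocInner, ← MonoidalCategory.comp_whiskerRight_assoc,
      VModule.compι_assocInner]
    simp only [MonoidalCategory.comp_whiskerRight, Category.assoc, VModule.compι_ract,
      associator_naturality_left_assoc]
    rw [← whisker_exchange_assoc, associator_inv_naturality_right_assoc]
    simp

@[simp]
theorem VModule.compι_assocHom (M : VModule V A B) (N : VModule V B C) (P : VModule V C D)
    (d : D) (c : C) (b : B) (a : A) :
    P.obj d c ◁ VModule.compι M N c b a ≫ VModule.compι (VModule.compMod M N) P d c a ≫
        (VModule.assocHom M N P).app d a =
      (α_ _ _ _).inv ≫ VModule.compι N P d c b ▷ M.obj b a ≫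
        VModule.compι M (VModule.compMod N P) d b a := by
  dsimp only [VModule.assocHom]
  rw [VModule.compι_desc, VModule.compι_assocInner]

@[simp]
theorem VModule.compι_assocHom_assoc (M : VModule V A B) (N : VModule V B C) (P : VModule V C D)
    (d : D) (c : C) (b : B) (a : A) {U : V} (k : _ ⟶ U) :
    P.obj d c ◁ VModule.compι M N c b a ≫ VModule.compι (VModule.compMod M N) P d c a ≫
        (VModule.assocHom M N P).app d a ≫ k =
      (α_ _ _ _).inv ≫ VModule.compι N P d c b ▷ M.obj b a ≫
        VModule.compι M (VModule.compMod N P) d b a ≫ k :=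
  (reassoc_of% (VModule.compι_assocHom M N P d c b a)) k

theorem VModule.assocInvInner_aux (M : VModule V A B) (N : VModule V B C) (P : VModule V C D)
    (d : D) (b : B) (a : A) (c c' : C) :
    (P.obj d c ◁ N.lact c c' b) ▷ M.obj b a ≫ (α_ _ _ _).hom ≫
        P.obj d c ◁ VModule.compι M N c b a ≫ VModule.compι (VModule.compMod M N) P d c a =
      (α_ _ _ _).inv ▷ M.obj b a ≫ P.ract d c c' ▷ N.obj c' b ▷ M.obj b a ≫ (α_ _ _ _).hom ≫
        P.obj d c' ◁ VModule.compι M N c' b a ≫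
          VModule.compι (VModule.compMod M N) P d c' a := by
  have h := VModule.compι_lact M N c c' b a
  rw [Iso.eq_inv_comp] at h
  replace h := congrArg (P.obj d c ◁ ·) h
  simp only [MonoidalCategory.whiskerLeft_comp] at h
  have h2 := VModule.compι_condition (VModule.compMod M N) P d c c' a
  rw [associator_naturality_middle_assoc, ← reassoc_of% h, h2, associator_naturality_left_assoc,
    ← whisker_exchange_assoc, associator_inv_naturality_right_assoc]
  simp

/-- The component `(P ∘ N)(d,b) ⊗ M(b,a) ⟶ (P ∘ (N ∘ M))(d,a)` of the inverse associator. -/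
def VModule.assocInvInner (M : VModule V A B) (N : VModule V B C) (P : VModule V C D)
    (d : D) (b : B) (a : A) : (VModule.compMod N P).obj d b ⊗ M.obj b a ⟶
      (VModule.compMod (VModule.compMod M N) P).obj d a :=
  VModule.compDescR (M.obj b a)
    (fun c => (α_ _ _ _).hom ≫ P.obj d c ◁ VModule.compι M N c b a ≫
      VModule.compι (VModule.compMod M N) P d c a)
    (VModule.assocInvInner_aux M N P d b a)

@[simp]
theorem VModule.compι_assocInvInner (M : VModule V A B) (N : VModule V B C) (P : VModule V C D)
    (d : D) (c : C) (b : B) (a : A) :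
    VModule.compι N P d c b ▷ M.obj b a ≫ VModule.assocInvInner M N P d b a =
      (α_ _ _ _).hom ≫ P.obj d c ◁ VModule.compι M N c b a ≫
        VModule.compι (VModule.compMod M N) P d c a :=
  VModule.compι_descR _ _ (VModule.assocInvInner_aux M N P d b a) c

@[simp]
theorem VModule.compι_assocInvInner_assoc (M : VModule V A B) (N : VModule V B C) (P : VModule V C D)
    (d : D) (c : C) (b : B) (a : A) {U : V} (k : _ ⟶ U) :
    VModule.compι N P d c b ▷ M.obj b a ≫ VModule.assocInvInner M N P d b a ≫ k =
      (α_ _ _ _).hom ≫ P.obj d c ◁ VModule.compι M N c b a ≫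
        VModule.compι (VModule.compMod M N) P d c a ≫ k :=
  (reassoc_of% (VModule.compι_assocInvInner M N P d c b a)) k

theorem VModule.assocInvApp_aux (M : VModule V A B) (N : VModule V B C) (P : VModule V C D)
    (d : D) (a : A) (b b' : B) :
    (VModule.compMod N P).obj d b ◁ M.lact b b' a ≫ VModule.assocInvInner M N P d b a =
      (α_ _ _ _).inv ≫ (VModule.compMod N P).ract d b b' ▷ M.obj b' a ≫
        VModule.assocInvInner M N P d b' a := by
  apply VModule.comp_extR
  intro c
  have h := congrArg (P.obj d c ◁ ·) (VModule.compι_condition M N c b b' a)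
  simp only [MonoidalCategory.whiskerLeft_comp] at h
  have h' := congrArg (· ▷ M.obj b' a) (VModule.compι_ract N P d c b b')
  simp only [MonoidalCategory.comp_whiskerRight] at h'
  rw [← whisker_exchange_assoc, VModule.compι_assocInvInner, associator_naturality_right_assoc,
    reassoc_of% h, associator_inv_naturality_left_assoc, reassoc_of% h',
    VModule.compι_assocInvInner]
  simp

/-- The associator `P ∘ (N ∘ M) ≅ (P ∘ N) ∘ M`. -/
def VModule.assoc (M : VModule V A B) (N : VModule V B C) (P : VModule V C D) :
    VModule.compMod (VModule.compMod M N) P ≅ VModule.compMod M (VModule.compMod N P) :=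
  VModule.isoMk (VModule.assocHom M N P)
    (fun d a => VModule.compDesc (fun b => VModule.assocInvInner M N P d b a)
      (VModule.assocInvApp_aux M N P d a))
    (fun d a => by
      apply VModule.comp_ext₃
      intro c b
      rw [VModule.compι_assocHom_assoc, VModule.compι_desc, VModule.compι_assocInvInner]
      simp)
    (fun d a => by
      apply VModule.comp_ext₃'
      intro b c
      rw [VModule.compι_desc_assoc, VModule.compι_assocInvInner_assoc]
      simp)

@[simp]
theorem VModule.compι_assoc_hom (M : VModule V A B) (N : VModule V B C) (P : VModule V C D)
    (d : D) (c : C) (b : B) (a : A) :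
    P.obj d c ◁ VModule.compι M N c b a ≫ VModule.compι (VModule.compMod M N) P d c a ≫
        (VModule.assoc M N P).hom.app d a =
      (α_ _ _ _).inv ≫ VModule.compι N P d c b ▷ M.obj b a ≫
        VModule.compι M (VModule.compMod N P) d b a :=
  VModule.compι_assocHom M N P d c b a

@[simp]
theorem VModule.compι_assoc_hom_assoc (M : VModule V A B) (N : VModule V B C) (P : VModule V C D)
    (d : D) (c : C) (b : B) (a : A) {U : V} (k : _ ⟶ U) :
    P.obj d c ◁ VModule.compι M N c b a ≫ VModule.compι (VModule.compMod M N) P d c a ≫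
        (VModule.assoc M N P).hom.app d a ≫ k =
      (α_ _ _ _).inv ≫ VModule.compι N P d c b ▷ M.obj b a ≫
        VModule.compι M (VModule.compMod N P) d b a ≫ k :=
  (reassoc_of% (VModule.compι_assoc_hom M N P d c b a)) k

@[simp]
theorem VModule.compι_assoc_inv (M : VModule V A B) (N : VModule V B C) (P : VModule V C D)
    (d : D) (c : C) (b : B) (a : A) :
    VModule.compι N P d c b ▷ M.obj b a ≫ VModule.compι M (VModule.compMod N P) d b a ≫
        (VModule.assoc M N P).inv.app d a =
      (α_ _ _ _).hom ≫ P.obj d c ◁ VModule.compι M N c b a ≫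
        VModule.compι (VModule.compMod M N) P d c a := by
  dsimp only [VModule.assoc, VModule.isoMk]
  rw [VModule.compι_desc, VModule.compι_assocInvInner]

@[simp]
theorem VModule.compι_assoc_inv_assoc (M : VModule V A B) (N : VModule V B C) (P : VModule V C D)
    (d : D) (c : C) (b : B) (a : A) {U : V} (k : _ ⟶ U) :
    VModule.compι N P d c b ▷ M.obj b a ≫ VModule.compι M (VModule.compMod N P) d b a ≫
        (VModule.assoc M N P).inv.app d a ≫ k =
      (α_ _ _ _).hom ≫ P.obj d c ◁ VModule.compι M N c b a ≫
        VModule.compι (VModule.compMod M N) P d c a ≫ k :=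
  (reassoc_of% (VModule.compι_assoc_inv M N P d c b a)) k

end Comp

end Modules
variable (V) in
/-- A small `V`-category, as an object of the bicategory of `V`-modules. -/
structure ModCat where
  carrier : Type v
  [enriched : EnrichedCategory V carrier]

attribute [instance] ModCat.enriched

instance ModCat.categoryStruct [SymmetricCategory V] [MonoidalClosed V] [HasColimits V] :
    CategoryStruct (ModCat V) where
  Hom A B := VModule V A.carrier B.carrier
  id A := VModule.idMod A.carrier
  comp M N := VModule.compMod M N

section Laws

variable [HasColimits V] [SymmetricCategory V] [MonoidalClosed V]
variable {A B C D E : Type v} [EnrichedCategory V A] [EnrichedCategory V B]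
  [EnrichedCategory V C] [EnrichedCategory V D] [EnrichedCategory V E]

theorem VModule.wl_id (M : VModule V A B) (N : VModule V B C) :
    VModule.wl M (𝟙 N) = 𝟙 (VModule.compMod M N) := by
  ext c a
  apply VModule.comp_ext
  intro b
  simp

theorem VModule.wl_comp (M : VModule V A B) {N N' N'' : VModule V B C} (η : N ⟶ N')
    (θ : N' ⟶ N'') : VModule.wl M (η ≫ θ) = VModule.wl M η ≫ VModule.wl M θ := by
  ext c a
  apply VModule.comp_ext
  intro b
  simp

theorem VModule.wr_id (M : VModule V A B) (N : VModule V B C) :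
    VModule.wr (𝟙 M) N = 𝟙 (VModule.compMod M N) := by
  ext c a
  apply VModule.comp_ext
  intro b
  simp

theorem VModule.wr_comp {M M' M'' : VModule V A B} (η : M ⟶ M') (θ : M' ⟶ M'')
    (N : VModule V B C) : VModule.wr (η ≫ θ) N = VModule.wr η N ≫ VModule.wr θ N := by
  ext c a
  apply VModule.comp_ext
  intro b
  simp

theorem VModule.id_wl {M N : VModule V A B} (η : M ⟶ N) :
    VModule.wl (VModule.idMod A) η ≫ (VModule.lu N).hom = (VModule.lu M).hom ≫ η := by
  ext b a
  apply VModule.comp_ext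
  intro a'
  simp [η.ract_app]

theorem VModule.wr_idMod {M N : VModule V A B} (η : M ⟶ N) :
    VModule.wr η (VModule.idMod B) ≫ (VModule.ru N).hom = (VModule.ru M).hom ≫ η := by
  ext b a
  apply VModule.comp_ext
  intro b'
  simp [η.lact_app]

theorem VModule.comp_wl (M : VModule V A B) (N : VModule V B C) {P P' : VModule V C D}
    (η : P ⟶ P') : VModule.wl (VModule.compMod M N) η ≫ (VModule.assoc M N P').hom =
      (VModule.assoc M N P).hom ≫ VModule.wl M (VModule.wl N η) := by
  ext d a
  apply VModule.comp_ext₃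
  intro c b
  have h := congrArg (· ▷ M.obj b a) (VModule.compι_wl N η d c b)
  simp only [MonoidalCategory.comp_whiskerRight] at h
  rw [VModule.comp_app, VModule.comp_app, VModule.compι_wl_assoc, VModule.compι_assoc_hom_assoc,
    VModule.compι_wl, reassoc_of% h, whisker_exchange_assoc, VModule.compι_assoc_hom]
  simp

theorem VModule.wr_compMod {M M' : VModule V A B} (η : M ⟶ M') (N : VModule V B C)
    (P : VModule V C D) : (VModule.assoc M N P).hom ≫ VModule.wr η (VModule.compMod N P) =
      VModule.wr (VModule.wr η N) P ≫ (VModule.assoc M' N P).hom := by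
  ext d a
  apply VModule.comp_ext₃
  intro c b
  have h := congrArg (P.obj d c ◁ ·) (VModule.compι_wr η N c b a)
  simp only [MonoidalCategory.whiskerLeft_comp] at h
  rw [VModule.comp_app, VModule.comp_app, VModule.compι_wr_assoc, VModule.compι_assoc_hom_assoc,
    VModule.compι_wr, reassoc_of% h, VModule.compι_assoc_hom, ← whisker_exchange_assoc]
  simp

theorem VModule.wl_wr (M : VModule V A B) {N N' : VModule V B C} (η : N ⟶ N')
    (P : VModule V C D) : VModule.wr (VModule.wl M η) P ≫ (VModule.assoc M N' P).hom =
      (VModule.assoc M N P).hom ≫ VModule.wl M (VModule.wr η P) := by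
  ext d a
  apply VModule.comp_ext₃
  intro c b
  have h := congrArg (P.obj d c ◁ ·) (VModule.compι_wl M η c b a)
  simp only [MonoidalCategory.whiskerLeft_comp] at h
  have h' := congrArg (· ▷ M.obj b a) (VModule.compι_wr η P d c b)
  simp only [MonoidalCategory.comp_whiskerRight] at h'
  rw [VModule.comp_app, VModule.comp_app, VModule.compι_wr_assoc, VModule.compι_assoc_hom_assoc,
    VModule.compι_wl, reassoc_of% h, VModule.compι_assoc_hom, reassoc_of% h']
  simp

theorem VModule.exchange {M M' : VModule V A B} {N N' : VModule V B C} (η : M ⟶ M')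
    (θ : N ⟶ N') :
    VModule.wl M θ ≫ VModule.wr η N' = VModule.wr η N ≫ VModule.wl M' θ := by
  ext c a
  apply VModule.comp_ext
  intro b
  simp [whisker_exchange_assoc]

theorem VModule.triangle (M : VModule V A B) (N : VModule V B C) :
    (VModule.assoc M (VModule.idMod B) N).hom ≫ VModule.wl M (VModule.lu N).hom =
      VModule.wr (VModule.ru M).hom N := by
  ext c a
  apply VModule.comp_ext₃
  intro b b'
  have h := congrArg (N.obj c b ◁ ·) (VModule.compι_ru M b b' a)
  simp only [MonoidalCategory.whiskerLeft_comp] at h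
  have h' := congrArg (· ▷ M.obj b' a) (VModule.compι_lu N c b b')
  simp only [MonoidalCategory.comp_whiskerRight] at h'
  rw [VModule.comp_app, VModule.compι_assoc_hom_assoc, VModule.compι_wl, VModule.compι_wr,
    reassoc_of% h, reassoc_of% h', VModule.compι_condition]

theorem VModule.pentagon (M : VModule V A B) (N : VModule V B C) (P : VModule V C D)
    (Q : VModule V D E) :
    VModule.wr (VModule.assoc M N P).hom Q ≫ (VModule.assoc M (VModule.compMod N P) Q).hom ≫
        VModule.wl M (VModule.assoc N P Q).hom =
      (VModule.assoc (VModule.compMod M N) P Q).hom ≫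
        (VModule.assoc M N (VModule.compMod P Q)).hom := by
  ext e a
  apply VModule.comp_ext₃
  intro d c
  apply VModule.comp_extLL
  intro b
  have h := congrArg (Q.obj e d ◁ ·) (VModule.compι_assoc_hom M N P d c b a)
  simp only [MonoidalCategory.whiskerLeft_comp] at h
  have h' := congrArg (· ▷ M.obj b a) (VModule.compι_assoc_hom N P Q e d c b)
  simp only [MonoidalCategory.comp_whiskerRight] at h'
  simp only [VModule.comp_app]
  rw [VModule.compι_wr_assoc, reassoc_of% h, VModule.compι_assoc_hom_assoc, VModule.compι_wl,
    associator_inv_naturality_middle_assoc, reassoc_of% h',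
    VModule.compι_assoc_hom_assoc, associator_inv_naturality_right_assoc, whisker_exchange_assoc,
    VModule.compι_assoc_hom, associator_inv_naturality_left_assoc]
  simp

end Laws

/-- The bicategory of `V`-modules: small `V`-categories, modules `A ⇸ B`, and module morphisms.
The composite of `M : A ⇸ B` and `N : B ⇸ C` is `(N ∘ M)(c,a) = ∫^b N(c,b) ⊗ M(b,a)`. -/
instance ModCat.bicategory [SymmetricCategory V] [MonoidalClosed V] [HasColimits V] :
    Bicategory (ModCat V) where
  homCategory A B := VModule.category (A := A.carrier) (B := B.carrier)
  whiskerLeft M _ _ η := VModule.wl M η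
  whiskerRight η N := VModule.wr η N
  associator M N P := VModule.assoc M N P
  leftUnitor M := VModule.lu M
  rightUnitor M := VModule.ru M
  whiskerLeft_id M N := VModule.wl_id M N
  whiskerLeft_comp M _ _ _ η θ := VModule.wl_comp M η θ
  id_whiskerLeft {_ _ _ N} η :=
    ((Iso.eq_comp_inv (VModule.lu N)).2 (VModule.id_wl η)).trans (Category.assoc _ _ _)
  comp_whiskerLeft {_ _ _ _} M N {_ P'} η :=
    ((Iso.eq_comp_inv (VModule.assoc M N P')).2 (VModule.comp_wl M N η)).trans
      (Category.assoc _ _ _)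
  id_whiskerRight M N := VModule.wr_id M N
  comp_whiskerRight η θ N := VModule.wr_comp η θ N
  whiskerRight_id {_ _ _ N} η :=
    ((Iso.eq_comp_inv (VModule.ru N)).2 (VModule.wr_idMod η)).trans (Category.assoc _ _ _)
  whiskerRight_comp {_ _ _ _ M _} η N P :=
    (Iso.eq_inv_comp (VModule.assoc M N P)).2 (VModule.wr_compMod η N P)
  whisker_assoc {_ _ _ _} M {_ N'} η P :=
    ((Iso.eq_comp_inv (VModule.assoc M N' P)).2 (VModule.wl_wr M η P)).trans
      (Category.assoc _ _ _)
  whisker_exchange η θ := VModule.exchange η θ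
  pentagon M N P Q := VModule.pentagon M N P Q
  triangle M N := VModule.triangle M N

section FunctorCategory

variable [SymmetricCategory V] [MonoidalClosed V] [HasLimits V]
variable {C : Type v} [EnrichedCategory V C] {D : Type u₁} [EnrichedCategory V D]

/-- The map `∏_c D(F c, G c) ⟶ ∏_{c,c'} [C(c,c'), D(F c, G c')]` given by the action of `G`. -/
def endFst (F G : EnrichedFunctor V C D) :
    (∏ᶜ fun c : C => (F.obj c ⟶[V] G.obj c)) ⟶
      ∏ᶜ fun x : C × C => (ihom (x.1 ⟶[V] x.2)).obj (F.obj x.1 ⟶[V] G.obj x.2) :=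
  Pi.lift fun x => Pi.π (fun c : C => (F.obj c ⟶[V] G.obj c)) x.1 ≫
    curry ((β_ _ _).hom ≫ _ ◁ G.map x.1 x.2 ≫ eComp V _ _ _)

/-- The map `∏_c D(F c, G c) ⟶ ∏_{c,c'} [C(c,c'), D(F c, G c')]` given by the action of `F`. -/
def endSnd (F G : EnrichedFunctor V C D) :
    (∏ᶜ fun c : C => (F.obj c ⟶[V] G.obj c)) ⟶
      ∏ᶜ fun x : C × C => (ihom (x.1 ⟶[V] x.2)).obj (F.obj x.1 ⟶[V] G.obj x.2) :=
  Pi.lift fun x => Pi.π (fun c : C => (F.obj c ⟶[V] G.obj c)) x.2 ≫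
    curry (F.map x.1 x.2 ▷ _ ≫ eComp V _ _ _)

/-- The object `[C, D](F, G) = ∫_c D(F c, G c)` of `V`-natural transformations. -/
def natObj (F G : EnrichedFunctor V C D) : V := equalizer (endFst F G) (endSnd F G)

/-- The projections of the end `[C, D](F, G)`. -/
def natπ (F G : EnrichedFunctor V C D) (c : C) : natObj F G ⟶ (F.obj c ⟶[V] G.obj c) :=
  equalizer.ι (endFst F G) (endSnd F G) ≫ Pi.π (fun c : C => (F.obj c ⟶[V] G.obj c)) c

theorem natπ_naturality (F G : EnrichedFunctor V C D) (c c' : C) :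
    (c ⟶[V] c') ◁ natπ F G c' ≫ F.map c c' ▷ _ ≫ eComp V _ _ _ =
      (β_ _ _).hom ≫ natπ F G c ▷ _ ≫ _ ◁ G.map c c' ≫ eComp V _ _ _ := by
  have h := equalizer.condition (endFst F G) (endSnd F G) =≫
    Pi.π (fun x : C × C => (ihom (x.1 ⟶[V] x.2)).obj (F.obj x.1 ⟶[V] G.obj x.2)) (c, c')
  simp only [endFst, endSnd, Category.assoc, Pi.lift_π] at h
  apply curry_injective
  rw [curry_natural_left]
  have e := BraidedCategory.braiding_naturality_right_assoc (c ⟶[V] c') (natπ F G c)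
    (_ ◁ G.map c c' ≫ eComp V _ _ _)
  rw [← e, curry_natural_left]
  simp only [natπ]
  exact (Category.assoc _ _ _).trans (h.symm.trans (Category.assoc _ _ _).symm)

variable {F G : EnrichedFunctor V C D}

/-- The map into `[C, D](F, G)` induced by a `V`-natural family. -/
def natLift {X : V} (f : ∀ c : C, X ⟶ (F.obj c ⟶[V] G.obj c))
    (h : ∀ c c' : C, (c ⟶[V] c') ◁ f c' ≫ F.map c c' ▷ _ ≫ eComp V _ _ _ =
      (β_ _ _).hom ≫ f c ▷ _ ≫ _ ◁ G.map c c' ≫ eComp V _ _ _) : X ⟶ natObj F G :=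
  equalizer.lift (Pi.lift f) (by
    apply Pi.hom_ext
    rintro ⟨c, c'⟩
    simp only [endFst, endSnd, Category.assoc, Pi.lift_π, Pi.lift_π_assoc]
    rw [← curry_natural_left, ← curry_natural_left, h,
      BraidedCategory.braiding_naturality_right_assoc])

@[simp]
theorem natLift_π {X : V} (f : ∀ c : C, X ⟶ (F.obj c ⟶[V] G.obj c))
    (h : ∀ c c' : C, (c ⟶[V] c') ◁ f c' ≫ F.map c c' ▷ _ ≫ eComp V _ _ _ =
      (β_ _ _).hom ≫ f c ▷ _ ≫ _ ◁ G.map c c' ≫ eComp V _ _ _) (c : C) :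
    natLift f h ≫ natπ F G c = f c :=
  (Category.assoc _ _ _).symm.trans
    ((congrArg (· ≫ _) (equalizer.lift_ι _ _)).trans (Pi.lift_π _ _))

@[simp]
theorem natLift_π_assoc {X : V} (f : ∀ c : C, X ⟶ (F.obj c ⟶[V] G.obj c))
    (h : ∀ c c' : C, (c ⟶[V] c') ◁ f c' ≫ F.map c c' ▷ _ ≫ eComp V _ _ _ =
      (β_ _ _).hom ≫ f c ▷ _ ≫ _ ◁ G.map c c' ≫ eComp V _ _ _) (c : C) {U : V} (k : _ ⟶ U) :
    natLift f h ≫ natπ F G c ≫ k =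
      f c ≫ k :=
  (reassoc_of% (natLift_π f h c)) k

theorem nat_hom_ext {X : V} {f g : X ⟶ natObj F G} (h : ∀ c : C, f ≫ natπ F G c = g ≫ natπ F G c) :
    f = g := by
  apply equalizer.hom_ext
  apply Pi.hom_ext
  intro c
  exact (Category.assoc _ _ _).trans ((h c).trans (Category.assoc _ _ _).symm)

theorem natId_aux (F : EnrichedFunctor V C D) (c c' : C) :
    (c ⟶[V] c') ◁ eId V (F.obj c') ≫ F.map c c' ▷ _ ≫ eComp V _ _ _ =
      (β_ _ _).hom ≫ eId V (F.obj c) ▷ _ ≫ _ ◁ F.map c c' ≫ eComp V _ _ _ := by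
  have h1 := (Iso.inv_comp_eq _).1 (e_comp_id V (F.obj c) (F.obj c'))
  have h2 := (Iso.inv_comp_eq _).1 (e_id_comp V (F.obj c) (F.obj c'))
  rw [whisker_exchange_assoc, h1, ← whisker_exchange_assoc, h2]
  simp

theorem natComp_aux (F G H : EnrichedFunctor V C D) (c c' : C) :
    (c ⟶[V] c') ◁ ((natπ F G c' ⊗ₘ natπ G H c') ≫ eComp V _ _ _) ≫ F.map c c' ▷ _ ≫
        eComp V _ _ _ =
      (β_ _ _).hom ≫ ((natπ F G c ⊗ₘ natπ G H c) ≫ eComp V _ _ _) ▷ _ ≫ _ ◁ H.map c c' ≫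
        eComp V _ _ _ := by
  have h1 := congrArg (· ▷ natObj G H) (natπ_naturality F G c c')
  have h2 := congrArg ((F.obj c ⟶[V] G.obj c) ◁ ·) (natπ_naturality G H c c')
  simp only [MonoidalCategory.comp_whiskerRight] at h1
  simp only [MonoidalCategory.whiskerLeft_comp] at h2
  calc
    _ = (α_ _ _ _).inv ≫ ((c ⟶[V] c') ◁ natπ F G c') ▷ natObj G H ≫
          F.map c c' ▷ _ ▷ natObj G H ≫ eComp V _ _ _ ▷ natObj G H ≫ _ ◁ natπ G H c' ≫
          eComp V _ _ _ := by
      conv_rhs => simp only [← whisker_exchange_assoc, ← e_assoc']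
      rw [MonoidalCategory.tensorHom_def', MonoidalCategory.whiskerLeft_comp_assoc,
        MonoidalCategory.whiskerLeft_comp_assoc, whisker_exchange_assoc]
      simp
    _ = (α_ _ _ _).inv ≫ (β_ _ _).hom ▷ natObj G H ≫ (natπ F G c ▷ _) ▷ natObj G H ≫
          (α_ _ _ _).hom ≫ _ ◁ (c ⟶[V] c') ◁ natπ G H c' ≫ _ ◁ G.map c c' ▷ _ ≫
          _ ◁ eComp V _ _ _ ≫ eComp V _ _ _ := by
      have e := congrArg ((F.obj c ⟶[V] G.obj c) ◁ ·)
        (whisker_exchange (G.map c c') (natπ G H c'))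
      simp only [MonoidalCategory.whiskerLeft_comp] at e
      rw [reassoc_of% h1, ← whisker_exchange_assoc, ← e_assoc', reassoc_of% e]
      simp
    _ = _ := by
      rw [reassoc_of% h2, MonoidalCategory.tensorHom_def, MonoidalCategory.comp_whiskerRight_assoc,
        ← whisker_exchange_assoc, ← e_assoc']
      simp
      simp only [associator_naturality_left_assoc, whisker_exchange_assoc, Iso.inv_hom_id_assoc]

/-- The functor `V`-category `[C, D]`, for `C` small. -/
instance functorEnriched : EnrichedCategory V (EnrichedFunctor V C D) where
  Hom F G := natObj F G
  id F := natLift (fun c => eId V (F.obj c)) (natId_aux F)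
  comp F G H := natLift (fun c => (natπ F G c ⊗ₘ natπ G H c) ≫ eComp V _ _ _) (natComp_aux F G H)
  id_comp F G := by
    apply nat_hom_ext
    intro c
    rw [Category.assoc, Category.assoc, natLift_π, MonoidalCategory.tensorHom_def, Category.assoc,
      ← MonoidalCategory.comp_whiskerRight_assoc, natLift_π, ← whisker_exchange_assoc,
      ← leftUnitor_inv_naturality_assoc, e_id_comp]
    simp
  comp_id F G := by
    apply nat_hom_ext
    intro c
    rw [Category.assoc, Category.assoc, natLift_π, MonoidalCategory.tensorHom_def', Category.assoc,
      ← MonoidalCategory.whiskerLeft_comp_assoc, natLift_π, whisker_exchange_assoc,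
      ← rightUnitor_inv_naturality_assoc, e_comp_id]
    simp
  assoc F G H K := by
    apply nat_hom_ext
    intro c
    rw [Category.assoc, Category.assoc, Category.assoc, natLift_π, natLift_π,
      MonoidalCategory.tensorHom_def, Category.assoc,
      ← MonoidalCategory.comp_whiskerRight_assoc, natLift_π]
    conv_rhs => rw [MonoidalCategory.tensorHom_def', Category.assoc,
      ← MonoidalCategory.whiskerLeft_comp_assoc, natLift_π, MonoidalCategory.whiskerLeft_comp,
      Category.assoc, whisker_exchange_assoc, ← e_assoc]
    rw [MonoidalCategory.comp_whiskerRight, Category.assoc, ← whisker_exchange_assoc]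
    simp [MonoidalCategory.tensorHom_def]
    simp only [associator_naturality_left_assoc, whisker_exchange_assoc, Iso.inv_hom_id_assoc]

end FunctorCategory

section WeightedLimits

variable [SymmetricCategory V] [MonoidalClosed V]
variable {D : Type u₁} [EnrichedCategory V D] {E : Type u₂} [EnrichedCategory V E]

theorem uncurry_eId (X : V) : uncurry (eId V X) = (ρ_ X).hom :=
  uncurry_curry _

theorem uncurry_eComp (X Y Z : V) :
    uncurry (eComp V X Y Z) =
      (α_ _ _ _).inv ≫ (ihom.ev X).app Y ▷ (ihom Y).obj Z ≫ (ihom.ev Y).app Z :=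
  uncurry_curry _

theorem uncurry_tensor_eComp {X Y Z U W : V} (f : U ⟶ EnrichedCategory.Hom X Y)
    (g : W ⟶ EnrichedCategory.Hom Y Z) :
    uncurry ((f ⊗ₘ g) ≫ eComp V X Y Z) = (α_ _ _ _).inv ≫ uncurry f ▷ W ≫ uncurry g := by
  have key : ∀ (f : U ⟶ (ihom X).obj Y) (g : W ⟶ (ihom Y).obj Z),
      uncurry ((f ⊗ₘ g) ≫ curry ((α_ _ _ _).inv ≫ (ihom.ev X).app Y ▷ (ihom Y).obj Z ≫
        (ihom.ev Y).app Z)) = (α_ _ _ _).inv ≫ uncurry f ▷ W ≫ uncurry g := fun f g => by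
    have h := uncurry_eq f
    rw [uncurry_natural_left, uncurry_curry, h, uncurry_eq g,
      MonoidalCategory.tensorHom_def, MonoidalCategory.whiskerLeft_comp_assoc,
      associator_inv_naturality_right_assoc, whisker_exchange_assoc,
      associator_inv_naturality_middle_assoc, MonoidalCategory.comp_whiskerRight_assoc]
    rfl
  exact key f g

/-- The representable `V`-functor `D(X, -) : D ⟶ V`. -/
def corepr (X : D) : EnrichedFunctor V D V where
  obj Y := X ⟶[V] Y
  map Y Z := curry (eComp V X Y Z)
  map_id Y := by
    apply uncurry_injective
    rw [uncurry_natural_left, uncurry_curry, uncurry_eId, ← Iso.inv_comp_eq_id, e_comp_id]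
  map_comp Y Z W := by
    apply uncurry_injective
    rw [uncurry_tensor_eComp, uncurry_natural_left, uncurry_curry, uncurry_curry, uncurry_curry,
      e_assoc]

variable {K : Type v} [EnrichedCategory V K]

/-- A cone over `G : K ⟶ D` weighted by `P : K ⟶ V`: an object `L` of `D` with a `V`-natural
transformation `P ⟹ D(L, G -)`. -/
structure WeightedCone (P : EnrichedFunctor V K V) (G : EnrichedFunctor V K D) where
  pt : D
  app : ∀ k : K, P.obj k ⟶ (pt ⟶[V] G.obj k)
  naturality : ∀ k k' : K, uncurry (P.map k k') ≫ app k' =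
    (app k ⊗ₘ G.map k k') ≫ eComp V pt (G.obj k) (G.obj k')

variable {P : EnrichedFunctor V K V} {G : EnrichedFunctor V K D}

/-- The image of a weighted cone under a `V`-functor. -/
def WeightedCone.map (c : WeightedCone P G) (T : EnrichedFunctor V D E) :
    WeightedCone P (G.comp V T) where
  pt := T.obj c.pt
  app k := c.app k ≫ T.map c.pt (G.obj k)
  naturality k k' := by
    have h := c.naturality k k' =≫ T.map c.pt (G.obj k')
    rw [Category.assoc, Category.assoc, T.map_comp, tensorHom_comp_tensorHom_assoc] at h
    exact h

variable [HasLimits V]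

theorem WeightedCone.comparison_aux (c : WeightedCone P G) (X : D) (k k' : K) :
    (α_ (P.obj k) (k ⟶[V] k') (X ⟶[V] c.pt)).inv ≫ uncurry (P.map k k') ▷ _ ≫
        (β_ _ _).hom ≫ _ ◁ c.app k' ≫ eComp V X c.pt (G.obj k') =
      P.obj k ◁ (β_ _ _).hom ≫ (α_ _ _ _).inv ≫
        ((β_ _ _).hom ≫ _ ◁ c.app k ≫ eComp V X c.pt (G.obj k)) ▷ (k ⟶[V] k') ≫
          (X ⟶[V] G.obj k) ◁ G.map k k' ≫ eComp V X (G.obj k) (G.obj k') := by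
  have h := congrArg ((X ⟶[V] c.pt) ◁ ·) (c.naturality k k')
  simp only [MonoidalCategory.whiskerLeft_comp] at h
  rw [BraidedCategory.braiding_naturality_left_assoc, reassoc_of% h,
    MonoidalCategory.tensorHom_def, MonoidalCategory.whiskerLeft_comp_assoc,
    ← e_assoc, BraidedCategory.braiding_tensor_left_hom]
  simp only [MonoidalCategory.comp_whiskerRight, Category.assoc]
  rw [← whisker_exchange_assoc]
  simp

/-- The comparison `D(X, L) ⟶ [K, V](P, D(X, G -))` induced by a weighted cone with vertex `L`. -/
def WeightedCone.comparison (c : WeightedCone P G) (X : D) :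
    (X ⟶[V] c.pt) ⟶ natObj P (G.comp V (corepr X)) :=
  natLift (fun k => curry ((β_ _ _).hom ≫ _ ◁ c.app k ≫ eComp V X c.pt (G.obj k))) (by
    intro k k'
    have hG : uncurry ((G.comp V (corepr X)).map k k') =
        (X ⟶[V] G.obj k) ◁ G.map k k' ≫ eComp V X (G.obj k) (G.obj k') :=
      (uncurry_natural_left (A := (X ⟶[V] G.obj k)) (G.map k k')
        (curry (eComp V X (G.obj k) (G.obj k')))).trans (congrArg (_ ≫ ·) (uncurry_curry _))
    apply uncurry_injective
    rw [← MonoidalCategory.tensorHom_def'_assoc, ← MonoidalCategory.tensorHom_def_assoc,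
      uncurry_tensor_eComp, uncurry_natural_left, uncurry_tensor_eComp, hG]
    have h1 := uncurry_curry ((β_ (P.obj k) (X ⟶[V] c.pt)).hom ≫
      (X ⟶[V] c.pt) ◁ c.app k ≫ eComp V X c.pt (G.obj k))
    have h2 := uncurry_curry ((β_ (P.obj k') (X ⟶[V] c.pt)).hom ≫
      (X ⟶[V] c.pt) ◁ c.app k' ≫ eComp V X c.pt (G.obj k'))
    refine Eq.trans ?_ ((WeightedCone.comparison_aux c X k k').trans ?_)
    · exact congrArg (fun t => (α_ (P.obj k) (k ⟶[V] k') (X ⟶[V] c.pt)).inv ≫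
        uncurry (P.map k k') ▷ _ ≫ t) h2
    · exact congrArg (fun t => P.obj k ◁ (β_ _ _).hom ≫ (α_ _ _ _).inv ≫ t ▷ (k ⟶[V] k') ≫
        (X ⟶[V] G.obj k) ◁ G.map k k' ≫ eComp V X (G.obj k) (G.obj k')) h1.symm)

/-- A weighted cone with vertex `L` is a limit cone, exhibiting `L` as the weighted limit
`{P, G}`, if the comparisons `D(X, L) ⟶ [K, V](P, D(X, G -))` are isomorphisms. -/
def WeightedCone.IsLimit (c : WeightedCone P G) : Prop :=
  ∀ X : D, IsIso (c.comparison X)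

/-- A `V`-functor `T` preserves the `P`-weighted limits of `G` if it sends limit cones to limit
cones. -/
def PreservesWeightedLimit (P : EnrichedFunctor V K V) (G : EnrichedFunctor V K D)
    (T : EnrichedFunctor V D E) : Prop :=
  ∀ c : WeightedCone P G, c.IsLimit → (c.map T).IsLimit

end WeightedLimits

section Flat

variable [SymmetricCategory V] [MonoidalClosed V] [HasLimits V] [HasColimits V]
variable {A : Type v} [EnrichedCategory V A]

/-- The covariant action of `A` on the values of a `V`-functor `G : A ⟶ V`. -/
def covAct (G : EnrichedFunctor V A V) (a a' : A) : G.obj a ⊗ (a ⟶[V] a') ⟶ G.obj a' :=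
  uncurry (G.map a a')

/-- The contravariant action of `A` on the values of a presheaf `F : Aᵒᵖ ⟶ V`. -/
def contraAct (F : EnrichedFunctor V Aᵒᵖ V) (a a' : A) :
    (a ⟶[V] a') ⊗ F.obj (.op a') ⟶ F.obj (.op a) :=
  (β_ _ _).hom ≫ uncurry (F.map (.op a') (.op a))

theorem covAct_π (G G' : EnrichedFunctor V A V) (a a' : A) :
    covAct G a a' ▷ natObj G G' ≫ uncurry (natπ G G' a') =
      (α_ _ _ _).hom ≫ G.obj a ◁ (β_ _ _).hom ≫ (α_ _ _ _).inv ≫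
        uncurry (natπ G G' a) ▷ (a ⟶[V] a') ≫ covAct G' a a' := by
  have h := natπ_naturality G G' a a'
  rw [← MonoidalCategory.tensorHom_def'_assoc, ← MonoidalCategory.tensorHom_def_assoc] at h
  replace h := congrArg uncurry h
  rw [uncurry_tensor_eComp, uncurry_natural_left, uncurry_tensor_eComp, Iso.inv_comp_eq] at h
  exact h

/-- The colimit `G * F = ∫^a G a ⊗ F a` in `V`, for `G : A ⟶ V` and a presheaf `F : Aᵒᵖ ⟶ V`. -/
def weightedTensor (G : EnrichedFunctor V A V) (F : EnrichedFunctor V Aᵒᵖ V) : V :=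
  coend G.obj (covAct G) (fun a => F.obj (.op a)) (contraAct F)

/-- The coprojections `G a ⊗ F a ⟶ G * F`. -/
def weightedι (G : EnrichedFunctor V A V) (F : EnrichedFunctor V Aᵒᵖ V) (a : A) :
    G.obj a ⊗ F.obj (.op a) ⟶ weightedTensor G F :=
  coendι G.obj (covAct G) (fun a => F.obj (.op a)) (contraAct F) a

theorem weighted_condition (G : EnrichedFunctor V A V) (F : EnrichedFunctor V Aᵒᵖ V) (a a' : A) :
    G.obj a ◁ contraAct F a a' ≫ weightedι G F a =
      (α_ _ _ _).inv ≫ covAct G a a' ▷ _ ≫ weightedι G F a' :=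
  coend_condition _ _ _ _ a a'

/-- The component `(G a ⊗ F a) ⊗ [A, V](G, G') ⟶ G' * F` of the action of `- * F` on homs. -/
def lanComp (F : EnrichedFunctor V Aᵒᵖ V) (G G' : EnrichedFunctor V A V) (a : A) :
    (G.obj a ⊗ F.obj (.op a)) ⊗ natObj G G' ⟶ weightedTensor G' F :=
  (α_ _ _ _).hom ≫ G.obj a ◁ (β_ _ _).hom ≫ (α_ _ _ _).inv ≫
    uncurry (natπ G G' a) ▷ F.obj (.op a) ≫ weightedι G' F a

theorem lanComp_compat (F : EnrichedFunctor V Aᵒᵖ V) (G G' : EnrichedFunctor V A V) (a a' : A) :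
    (G.obj a ◁ contraAct F a a') ▷ natObj G G' ≫ lanComp F G G' a =
      (α_ _ _ _).inv ▷ natObj G G' ≫ covAct G a a' ▷ F.obj (.op a') ▷ natObj G G' ≫
        lanComp F G G' a' := by
  have h := congrArg (· ▷ F.obj (.op a')) (covAct_π G G' a a')
  simp only [MonoidalCategory.comp_whiskerRight] at h
  dsimp only [lanComp]
  rw [associator_naturality_middle_assoc]
  conv_lhs => rw [← MonoidalCategory.whiskerLeft_comp_assoc,
    BraidedCategory.braiding_naturality_left, MonoidalCategory.whiskerLeft_comp_assoc,
    associator_inv_naturality_right_assoc, whisker_exchange_assoc, weighted_condition]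
  rw [associator_naturality_left_assoc, ← whisker_exchange_assoc,
    associator_inv_naturality_left_assoc, associator_inv_naturality_left_assoc, reassoc_of% h,
    BraidedCategory.braiding_tensor_left_hom]
  simp

/-- The action `(G * F) ⊗ [A, V](G, G') ⟶ G' * F` of `- * F` on homs. -/
def lanMap (F : EnrichedFunctor V Aᵒᵖ V) (G G' : EnrichedFunctor V A V) :
    weightedTensor G F ⊗ natObj G G' ⟶ weightedTensor G' F :=
  coendDescR (natObj G G') (lanComp F G G') (lanComp_compat F G G')

@[simp]
theorem weightedι_lanMap (F : EnrichedFunctor V Aᵒᵖ V) (G G' : EnrichedFunctor V A V) (a : A) :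
    weightedι G F a ▷ natObj G G' ≫ lanMap F G G' = lanComp F G G' a :=
  coendι_descR _ _ (lanComp_compat F G G') a

@[simp]
theorem weightedι_lanMap_assoc (F : EnrichedFunctor V Aᵒᵖ V) (G G' : EnrichedFunctor V A V) (a : A) {U : V} (k : _ ⟶ U) :
    weightedι G F a ▷ natObj G G' ≫ lanMap F G G' ≫ k =
      lanComp F G G' a ≫ k :=
  (reassoc_of% (weightedι_lanMap F G G' a)) k

theorem weighted_extR {F : EnrichedFunctor V Aᵒᵖ V} {G : EnrichedFunctor V A V} (X : V) {Z : V}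
    {f g : weightedTensor G F ⊗ X ⟶ Z}
    (h : ∀ a, weightedι G F a ▷ X ≫ f = weightedι G F a ▷ X ≫ g) : f = g :=
  coend_hom_extR X h

theorem lanComp_whisker (F : EnrichedFunctor V Aᵒᵖ V) (G G' : EnrichedFunctor V A V) (a : A)
    {Y : V} (e : Y ⟶ natObj G G') :
    (G.obj a ⊗ F.obj (.op a)) ◁ e ≫ lanComp F G G' a =
      (α_ _ _ _).hom ≫ G.obj a ◁ (β_ _ _).hom ≫ (α_ _ _ _).inv ≫
        (G.obj a ◁ e ≫ uncurry (natπ G G' a)) ▷ F.obj (.op a) ≫ weightedι G' F a := by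
  dsimp only [lanComp]
  rw [associator_naturality_right_assoc, ← MonoidalCategory.whiskerLeft_comp_assoc,
    BraidedCategory.braiding_naturality_right, MonoidalCategory.whiskerLeft_comp_assoc,
    associator_inv_naturality_middle_assoc, MonoidalCategory.comp_whiskerRight_assoc]

theorem lan_id_aux (F : EnrichedFunctor V Aᵒᵖ V) (G : EnrichedFunctor V A V) (a : A) :
    (G.obj a ⊗ F.obj (.op a)) ◁ (show 𝟙_ V ⟶ natObj G G from eId V G) ≫ lanComp F G G a =
      weightedι G F a ▷ 𝟙_ V ≫ (ρ_ _).hom := by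
  have h : G.obj a ◁ (show 𝟙_ V ⟶ natObj G G from eId V G) ≫ uncurry (natπ G G a) =
      (ρ_ _).hom := by
    rw [← uncurry_natural_left]
    exact (congrArg uncurry (natLift_π _ (natId_aux G) a)).trans (uncurry_eId _)
  rw [lanComp_whisker, h]
  simp

theorem lan_comp_aux (F : EnrichedFunctor V Aᵒᵖ V) (G G' G'' : EnrichedFunctor V A V) (a : A) :
    (G.obj a ⊗ F.obj (.op a)) ◁
        (show natObj G G' ⊗ natObj G' G'' ⟶ natObj G G'' from eComp V G G' G'') ≫
          lanComp F G G'' a =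
      (α_ _ _ _).inv ≫ lanComp F G G' a ▷ natObj G' G'' ≫ lanMap F G' G'' := by
  have h : G.obj a ◁ (show natObj G G' ⊗ natObj G' G'' ⟶ natObj G G'' from eComp V G G' G'') ≫
      uncurry (natπ G G'' a) =
      (α_ _ _ _).inv ≫ uncurry (natπ G G' a) ▷ natObj G' G'' ≫ uncurry (natπ G' G'' a) := by
    rw [← uncurry_natural_left]
    exact (congrArg uncurry (natLift_π _ (natComp_aux G G' G'') a)).trans
      (uncurry_tensor_eComp _ _)
  rw [lanComp_whisker, h]
  conv_rhs => rw [lanComp]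
  simp only [MonoidalCategory.comp_whiskerRight, Category.assoc, weightedι_lanMap]
  dsimp only [lanComp]
  rw [associator_naturality_left_assoc, ← whisker_exchange_assoc,
    associator_inv_naturality_left_assoc, BraidedCategory.braiding_tensor_right_hom]
  simp

/-- The left Kan extension `- * F : [A, V] ⟶ V` of a presheaf `F : Aᵒᵖ ⟶ V` along the Yoneda
embedding `Aᵒᵖ ⟶ [A, V]`: its value at `G` is
`∫^a [A, V](A(a, -), G) ⊗ F a = ∫^a G a ⊗ F a`, by the Yoneda lemma. -/
def lanYoneda (F : EnrichedFunctor V Aᵒᵖ V) : EnrichedFunctor V (EnrichedFunctor V A V) V where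
  obj G := weightedTensor G F
  map G G' := curry (lanMap F G G')
  map_id G := by
    apply uncurry_injective
    rw [uncurry_natural_left, uncurry_curry, uncurry_eId]
    apply weighted_extR
    intro a
    rw [← whisker_exchange_assoc]
    exact (congrArg (_ ◁ eId V G ≫ ·) (weightedι_lanMap F G G a)).trans (lan_id_aux F G a)
  map_comp G G' G'' := by
    apply uncurry_injective
    rw [uncurry_tensor_eComp, uncurry_natural_left, uncurry_curry, uncurry_curry, uncurry_curry]
    apply weighted_extR
    intro a
    rw [← whisker_exchange_assoc]
    refine (congrArg (_ ◁ eComp V G G' G'' ≫ ·) (weightedι_lanMap F G G'' a)).trans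
      ((lan_comp_aux F G G' G'' a).trans ?_)
    rw [← weightedι_lanMap, MonoidalCategory.comp_whiskerRight_assoc]
    exact (associator_inv_naturality_left_assoc _ _ _ _).symm

end Flat
section LeftAdjointModules

/-- The one-object type underlying the unit `V`-category `I`. -/
inductive UnitObj : Type v
  | star : UnitObj

/-- The unit `V`-category `I`, with one object and hom-object the unit of `V`. -/
instance unitEnriched : EnrichedCategory V UnitObj.{v} where
  Hom _ _ := 𝟙_ V
  id _ := 𝟙 _
  comp _ _ _ := (λ_ (𝟙_ V)).hom
  id_comp _ _ := by simp
  comp_id _ _ := by simp [unitors_equal]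
  assoc _ _ _ _ := by simp [unitors_equal]

variable [SymmetricCategory V] [MonoidalClosed V]
variable {A : Type v} [EnrichedCategory V A]

theorem id_contraAct (F : EnrichedFunctor V Aᵒᵖ V) (a : A) :
    eId V a ▷ F.obj (.op a) ≫ contraAct F a a = (λ_ _).hom := by
  have h := congrArg uncurry (F.map_id (.op a))
  rw [uncurry_eId] at h
  replace h : F.obj (.op a) ◁ eId V a ≫ uncurry (F.map (.op a) (.op a)) = (ρ_ _).hom :=
    (uncurry_natural_left _ _).symm.trans h
  rw [contraAct, BraidedCategory.braiding_naturality_left_assoc, h]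
  simp

theorem comp_contraAct (F : EnrichedFunctor V Aᵒᵖ V) (a₁ a₂ a₃ : A) :
    eComp V a₁ a₂ a₃ ▷ F.obj (.op a₃) ≫ contraAct F a₁ a₃ =
      (α_ _ _ _).hom ≫ (a₁ ⟶[V] a₂) ◁ contraAct F a₂ a₃ ≫ contraAct F a₁ a₂ := by
  have h := congrArg uncurry (F.map_comp (.op a₃) (.op a₂) (.op a₁))
  rw [uncurry_tensor_eComp] at h
  replace h : F.obj (.op a₃) ◁ ((β_ (a₂ ⟶[V] a₃) (a₁ ⟶[V] a₂)).hom ≫ eComp V a₁ a₂ a₃) ≫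
      uncurry (F.map (.op a₃) (.op a₁)) =
      (α_ (F.obj (.op a₃)) (a₂ ⟶[V] a₃) (a₁ ⟶[V] a₂)).inv ≫
        uncurry (F.map (.op a₃) (.op a₂)) ▷ (a₁ ⟶[V] a₂) ≫ uncurry (F.map (.op a₂) (.op a₁)) :=
    (uncurry_natural_left _ _).symm.trans h
  rw [MonoidalCategory.whiskerLeft_comp_assoc] at h
  have h' : F.obj (.op a₃) ◁ eComp V a₁ a₂ a₃ ≫ uncurry (F.map (.op a₃) (.op a₁)) =
      F.obj (.op a₃) ◁ (β_ (a₁ ⟶[V] a₂) (a₂ ⟶[V] a₃)).hom ≫ (α_ _ _ _).inv ≫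
        uncurry (F.map (.op a₃) (.op a₂)) ▷ (a₁ ⟶[V] a₂) ≫
          uncurry (F.map (.op a₂) (.op a₁)) := by
    rw [← h, ← MonoidalCategory.whiskerLeft_comp_assoc, SymmetricCategory.symmetry,
      MonoidalCategory.whiskerLeft_id, Category.id_comp]
  rw [contraAct, contraAct, contraAct, BraidedCategory.braiding_naturality_left_assoc, h',
    MonoidalCategory.whiskerLeft_comp_assoc, BraidedCategory.braiding_naturality_right_assoc,
    BraidedCategory.braiding_tensor_left_hom, BraidedCategory.braiding_tensor_right_hom]
  simp

/-- A presheaf `F : Aᵒᵖ ⟶ V` as a module `I ⇸ A`. -/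
def presheafModule (F : EnrichedFunctor V Aᵒᵖ V) : VModule V UnitObj.{v} A where
  obj a _ := F.obj (.op a)
  lact a' a _ := contraAct F a' a
  ract a _ _ := (ρ_ (F.obj (.op a))).hom
  id_lact a _ := id_contraAct F a
  comp_lact a₁ a₂ a₃ _ := comp_contraAct F a₁ a₂ a₃
  ract_id _ _ := (congrArg (· ≫ _) (MonoidalCategory.whiskerLeft_id _ _)).trans
    (Category.id_comp _)
  ract_comp a _ _ _ := by
    change F.obj (.op a) ◁ (λ_ (𝟙_ V)).hom ≫ (ρ_ _).hom =
      (α_ _ _ _).inv ≫ (ρ_ _).hom ▷ 𝟙_ V ≫ (ρ_ _).hom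
    simp [unitors_equal]
  lact_ract a' a _ _ := by
    change contraAct F a' a ▷ 𝟙_ V ≫ (ρ_ _).hom = (α_ _ _ _).hom ≫ _ ◁ (ρ_ _).hom ≫ contraAct F a' a
    simp

variable [HasColimits V]

/-- The presheaf `F : Aᵒᵖ ⟶ V`, viewed as a module `I ⇸ A`, is a left adjoint in the bicategory of
`V`-modules. -/
def IsLeftAdjointModule (F : EnrichedFunctor V Aᵒᵖ V) : Prop :=
  Bicategory.IsLeftAdjoint (show ModCat.mk (V := V) UnitObj.{v} ⟶ ModCat.mk A from presheafModule F)

end LeftAdjointModules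

section Flatness

variable (V) in
/-- A class of indexes: a property of `V`-functors `P : K ⟶ V` with `K` a small `V`-category. -/
def IndexClass [MonoidalClosed V] : Type (max u (v + 1)) :=
  ∀ (K : Type v) [EnrichedCategory V K], EnrichedFunctor V K V → Prop

variable (V) in
/-- The whole class of indexes. -/
def allIndexes [MonoidalClosed V] : IndexClass V := fun _ _ _ => True

variable [SymmetricCategory V] [MonoidalClosed V] [HasLimits V] [HasColimits V]
variable {A : Type v} [EnrichedCategory V A]

/-- A presheaf `F : Aᵒᵖ ⟶ V` is flat for a class of indexes if its left Kan extension
`- * F : [A, V] ⟶ V` along Yoneda preserves all limits with indexes in this class. -/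
def IsFlat (Φ : IndexClass V) (F : EnrichedFunctor V Aᵒᵖ V) : Prop :=
  ∀ (K : Type v) [EnrichedCategory V K] (P : EnrichedFunctor V K V), Φ K P →
    ∀ G : EnrichedFunctor V K (EnrichedFunctor V A V), PreservesWeightedLimit P G (lanYoneda F)

end Flatness

section Completions

/-- The objects of the full `V`-subcategory of `D` determined by a property of objects. -/
structure FullSub {D : Type u₁} (p : D → Prop) where
  obj : D
  property : p obj

instance fullSubEnriched {D : Type u₁} [EnrichedCategory V D] (p : D → Prop) :
    EnrichedCategory V (FullSub p) where
  Hom X Y := X.obj ⟶[V] Y.obj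
  id X := eId V X.obj
  comp X Y Z := eComp V X.obj Y.obj Z.obj
  id_comp X Y := e_id_comp V X.obj Y.obj
  comp_id X Y := e_comp_id V X.obj Y.obj
  assoc W X Y Z := e_assoc V W.obj X.obj Y.obj Z.obj

variable (V) in
/-- The inclusion of a full `V`-subcategory. -/
def fullSubInclusion {D : Type u₁} [EnrichedCategory V D] (p : D → Prop) :
    EnrichedFunctor V (FullSub p) D where
  obj X := X.obj
  map _ _ := 𝟙 _
  map_id _ := Category.comp_id _
  map_comp X Y Z := by
    change eComp V X.obj Y.obj Z.obj ≫ 𝟙 _ = (𝟙 _ ⊗ₘ 𝟙 _) ≫ eComp V X.obj Y.obj Z.obj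
    simp

variable [SymmetricCategory V] [MonoidalClosed V] [HasLimits V] [HasColimits V]
variable (A : Type v) [EnrichedCategory V A]

/-- The completion of `A` for a class of indexes: the full subcategory of `[Aᵒᵖ, V]` on the flat
presheaves. -/
abbrev FlatCompletion (Φ : IndexClass V) : Type _ :=
  FullSub fun F : EnrichedFunctor V Aᵒᵖ V => IsFlat Φ F

variable (V) in
/-- The Cauchy-completion of `A`: the full subcategory of `[Aᵒᵖ, V]` on the presheaves that are left
adjoint modules. -/
abbrev CauchyCompletion : Type _ :=
  FullSub fun F : EnrichedFunctor V Aᵒᵖ V => IsLeftAdjointModule F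

end Completions

end EnrichedFlat

end

/-!
Regard a presheaf `F : Aᵒᵖ ⟶ V` as a module `I ⇸ A`. A module `A ⇸ I` is a `V`-functor
`R : A ⟶ V` (`exists_functorModule_eq`), and a counit `F ∘ R ⟶ 1` is an `A`-bilinear family of maps
`F a ⊗ R b ⟶ A(a, b)`, called a `Pairing` below. A unit `1 ⟶ R ∘ F` is a map from the unit object of
`V` to the coend `R * F`. So `F` is a left adjoint if and only if it has a `Duality` with some `R`:
a pairing and a map to `R * F` subject to two equations (`isLeftAdjointModule_iff`).

*Left adjoints are flat.* If `F` has a right adjoint `R`, then `H * F ≅ [A, V](R, H)`, naturally in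
`H` (`Duality.representation`). Hence `- * F` is representable, and representable `V`-functors
preserve every weighted limit (`preservesWeightedLimit_of_representation`).

*Flat presheaves are left adjoints.* For any `F`, put `R c = [Aᵒᵖ, V](F, A(-, c))`. Evaluation is a
pairing of `F` with `R`, and it is universal (`exists_isUniversal`). This `R` is the weighted limit
`{F, Y}` of the Yoneda embedding `Y : Aᵒᵖ ⟶ [A, V]` (`Pairing.IsUniversal.isLimit_cone`). The weight
`F` is small, so if `F` is flat then `- * F` preserves this limit. Since `A(a, -) * F ≅ F a` by the
co-Yoneda lemma, `R * F` is then the end `{F, F} = [Aᵒᵖ, V](F, F)`, and the identity of `F` gives a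
map to `R * F`, the unit of the adjunction. The first triangle identity is the definition of this
map, and the second follows from the first because the pairing is universal (`exists_duality`).

The two completions are therefore full subcategories determined by equivalent properties of
presheaves.
-/

noncomputable section

namespace EnrichedFlat

variable {V : Type u} [Category.{v} V] [MonoidalCategory V] [SymmetricCategory V] [MonoidalClosed V]

/-! ### Actions, ends and weighted limits -/

section WeightedLimits

section Action

variable {D : Type u₁} [EnrichedCategory V D]

/-- The action `T X ⊗ D(X, Y) ⟶ T Y` of a `V`-functor `T : D ⟶ V` on homs, the transpose of
`T.map X Y`. On a small `V`-category this is `covAct`. -/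
def act (T : EnrichedFunctor V D V) (X Y : D) : T.obj X ⊗ (X ⟶[V] Y) ⟶ T.obj Y :=
  uncurry (T.map X Y)

theorem eId_act (T : EnrichedFunctor V D V) (X : D) :
    T.obj X ◁ eId V X ≫ act T X X = (ρ_ _).hom := by
  rw [act, ← uncurry_natural_left]
  exact (congrArg uncurry (T.map_id X)).trans (uncurry_eId _)

theorem eComp_act (T : EnrichedFunctor V D V) (X Y Z : D) :
    T.obj X ◁ eComp V X Y Z ≫ act T X Z =
      (α_ _ _ _).inv ≫ act T X Y ▷ (Y ⟶[V] Z) ≫ act T Y Z := by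
  rw [act, ← uncurry_natural_left]
  exact (congrArg uncurry (T.map_comp X Y Z)).trans (uncurry_tensor_eComp _ _)

theorem act_corepr (X Y Z : D) : act (corepr (V := V) X) Y Z = eComp V X Y Z :=
  uncurry_curry _

theorem act_comp {E : Type u₂} [EnrichedCategory V E] (S : EnrichedFunctor V D E)
    (T : EnrichedFunctor V E V) (X Y : D) :
    act (S.comp V T) X Y = T.obj (S.obj X) ◁ S.map X Y ≫ act T (S.obj X) (S.obj Y) :=
  uncurry_natural_left (A := T.obj (S.obj X)) (S.map X Y) (T.map (S.obj X) (S.obj Y))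

/-- A `V`-functor to `V` from an action on homs. -/
def ofAct (obj : D → V) (a : ∀ X Y : D, obj X ⊗ (X ⟶[V] Y) ⟶ obj Y)
    (h₁ : ∀ X, obj X ◁ eId V X ≫ a X X = (ρ_ _).hom)
    (h₂ : ∀ X Y Z, obj X ◁ eComp V X Y Z ≫ a X Z =
      (α_ _ _ _).inv ≫ a X Y ▷ (Y ⟶[V] Z) ≫ a Y Z) : EnrichedFunctor V D V where
  obj := obj
  map X Y := curry (a X Y)
  map_id X := by
    apply uncurry_injective
    rw [uncurry_natural_left, uncurry_curry, uncurry_eId, h₁]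
  map_comp X Y Z := by
    apply uncurry_injective
    rw [uncurry_tensor_eComp, uncurry_natural_left, uncurry_curry, uncurry_curry, uncurry_curry, h₂]

@[simp]
theorem act_ofAct (obj : D → V) (a : ∀ X Y : D, obj X ⊗ (X ⟶[V] Y) ⟶ obj Y)
    (h₁ : ∀ X, obj X ◁ eId V X ≫ a X X = (ρ_ _).hom)
    (h₂ : ∀ X Y Z, obj X ◁ eComp V X Y Z ≫ a X Z =
      (α_ _ _ _).inv ≫ a X Y ▷ (Y ⟶[V] Z) ≫ a Y Z) (X Y : D) :
    act (ofAct obj a h₁ h₂) X Y = a X Y :=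
  uncurry_curry _

end Action

section Evaluation

variable [HasLimits V] [HasColimits V] {C : Type v} [EnrichedCategory V C]

/-- The evaluation `[C, V](F, G) ⊗ F c ⟶ G c`. With the natural transformation on the left,
`V`-naturality (`evL_act`) involves no braiding. -/
def evL (F G : EnrichedFunctor V C V) (c : C) : natObj F G ⊗ F.obj c ⟶ G.obj c :=
  (β_ _ _).hom ≫ uncurry (natπ F G c)

theorem braiding_evL (F G : EnrichedFunctor V C V) (c : C) :
    (β_ _ _).hom ≫ evL F G c = uncurry (natπ F G c) := by
  rw [evL, SymmetricCategory.symmetry_assoc]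

theorem whiskerRight_evL {F G : EnrichedFunctor V C V} {Z : V} (f : Z ⟶ natObj F G) (c : C) :
    f ▷ F.obj c ≫ evL F G c = (β_ _ _).hom ≫ uncurry (f ≫ natπ F G c) := by
  rw [evL, BraidedCategory.braiding_naturality_left_assoc, uncurry_natural_left]

theorem evL_act (F G : EnrichedFunctor V C V) (c c' : C) :
    natObj F G ◁ act F c c' ≫ evL F G c' =
      (α_ _ _ _).inv ≫ evL F G c ▷ (c ⟶[V] c') ≫ act G c c' := by
  have h : act F c c' ▷ natObj F G ≫ uncurry (natπ F G c') =
      (α_ _ _ _).hom ≫ F.obj c ◁ (β_ _ _).hom ≫ (α_ _ _ _).inv ≫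
        uncurry (natπ F G c) ▷ (c ⟶[V] c') ≫ act G c c' := covAct_π F G c c'
  rw [evL, BraidedCategory.braiding_naturality_right_assoc, h, evL,
    BraidedCategory.braiding_tensor_right_hom]
  simp only [MonoidalCategory.comp_whiskerRight, Category.assoc, Iso.inv_hom_id_assoc,
    ← MonoidalCategory.whiskerLeft_comp_assoc, SymmetricCategory.symmetry,
    MonoidalCategory.whiskerLeft_id, Category.id_comp, Iso.hom_inv_id_assoc]

theorem natMk_aux {F G : EnrichedFunctor V C V} {Z : V} (φ : ∀ c, Z ⊗ F.obj c ⟶ G.obj c)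
    (h : ∀ c c', Z ◁ act F c c' ≫ φ c' = (α_ _ _ _).inv ≫ φ c ▷ (c ⟶[V] c') ≫ act G c c')
    (c c' : C) :
    (c ⟶[V] c') ◁ curry ((β_ _ _).hom ≫ φ c') ≫ F.map c c' ▷ _ ≫
        eComp V (F.obj c) (F.obj c') (G.obj c') =
      (β_ _ _).hom ≫ curry ((β_ _ _).hom ≫ φ c) ▷ _ ≫ _ ◁ G.map c c' ≫
        eComp V (F.obj c) (G.obj c) (G.obj c') := by
  apply uncurry_injective
  rw [← MonoidalCategory.tensorHom_def'_assoc, ← MonoidalCategory.tensorHom_def_assoc,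
    uncurry_tensor_eComp, uncurry_natural_left, uncurry_tensor_eComp, uncurry_curry, uncurry_curry]
  have h' := h c c'
  have e : act F c c' ▷ Z ≫ (β_ _ _).hom ≫ φ c' = (β_ _ _).hom ≫ Z ◁ act F c c' ≫ φ c' := by
    rw [BraidedCategory.braiding_naturality_left_assoc]
  refine (congrArg (_ ≫ ·) e).trans ?_
  rw [h', BraidedCategory.braiding_tensor_left_hom]
  simp [act]

/-- The map into `[C, V](F, G)` given by a `V`-natural family `Z ⊗ F c ⟶ G c`. -/
def natMk {F G : EnrichedFunctor V C V} {Z : V} (φ : ∀ c, Z ⊗ F.obj c ⟶ G.obj c)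
    (h : ∀ c c', Z ◁ act F c c' ≫ φ c' = (α_ _ _ _).inv ≫ φ c ▷ (c ⟶[V] c') ≫ act G c c') :
    Z ⟶ natObj F G :=
  natLift (fun c => curry ((β_ _ _).hom ≫ φ c)) (natMk_aux φ h)

theorem natMk_evL {F G : EnrichedFunctor V C V} {Z : V} (φ : ∀ c, Z ⊗ F.obj c ⟶ G.obj c)
    (h : ∀ c c', Z ◁ act F c c' ≫ φ c' = (α_ _ _ _).inv ≫ φ c ▷ (c ⟶[V] c') ≫ act G c c') (c : C) :
    natMk φ h ▷ F.obj c ≫ evL F G c = φ c := by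
  rw [whiskerRight_evL, natMk, natLift_π _ (natMk_aux φ h), uncurry_curry,
    SymmetricCategory.symmetry_assoc]

theorem nat_ext {F G : EnrichedFunctor V C V} {Z : V} {f g : Z ⟶ natObj F G}
    (h : ∀ c, f ▷ F.obj c ≫ evL F G c = g ▷ F.obj c ≫ evL F G c) : f = g := by
  apply nat_hom_ext
  intro c
  have := h c
  rw [whiskerRight_evL, whiskerRight_evL, cancel_epi] at this
  exact uncurry_injective this

/-- The identity of `F` in the functor `V`-category `[C, V]`, as a map to the end `natObj F F`. -/
def natId (F : EnrichedFunctor V C V) : 𝟙_ V ⟶ natObj F F :=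
  eId V F

theorem natId_evL (F : EnrichedFunctor V C V) (c : C) :
    natId F ▷ F.obj c ≫ evL F F c = (λ_ _).hom := by
  rw [whiskerRight_evL]
  refine (congrArg (fun t => (β_ _ _).hom ≫ uncurry t) (natLift_π _ (natId_aux F) c)).trans ?_
  rw [uncurry_eId]
  simp

/-- The composition of the functor `V`-category `[C, V]`, as a map between the ends `natObj`. -/
def natComp (F G H : EnrichedFunctor V C V) : natObj F G ⊗ natObj G H ⟶ natObj F H :=
  eComp V F G H

theorem natComp_evL (F G H : EnrichedFunctor V C V) (c : C) :
    natComp F G H ▷ F.obj c ≫ evL F H c =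
      (β_ _ _).hom ▷ F.obj c ≫ (α_ _ _ _).hom ≫ natObj G H ◁ evL F G c ≫ evL G H c := by
  rw [whiskerRight_evL]
  refine (congrArg (fun t => (β_ _ _).hom ≫ uncurry t)
    (natLift_π _ (natComp_aux F G H) c)).trans ?_
  rw [uncurry_tensor_eComp, ← braiding_evL, ← braiding_evL,
    MonoidalCategory.comp_whiskerRight_assoc, BraidedCategory.braiding_naturality_left_assoc,
    BraidedCategory.braiding_tensor_left_hom, BraidedCategory.braiding_tensor_left_hom]
  simp only [Category.assoc, Iso.hom_inv_id_assoc]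
  simp only [← MonoidalCategory.comp_whiskerRight_assoc, SymmetricCategory.symmetry,
    MonoidalCategory.id_whiskerRight, Category.id_comp, Iso.inv_hom_id_assoc,
    ← MonoidalCategory.whiskerLeft_comp_assoc, MonoidalCategory.whiskerLeft_id,
    Iso.hom_inv_id_assoc]

/-- A map into `[C, V](F, G)` is invertible if every `V`-natural family `Z ⊗ F c ⟶ G c` factors
uniquely through its transpose, and conversely. -/
theorem isIso_iff_existsUnique {F G : EnrichedFunctor V C V} {N : V} (t : N ⟶ natObj F G)
    (e : ∀ c, N ⊗ F.obj c ⟶ G.obj c) (he : ∀ c, t ▷ F.obj c ≫ evL F G c = e c) :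
    IsIso t ↔ ∀ (Z : V) (φ : ∀ c, Z ⊗ F.obj c ⟶ G.obj c),
      (∀ c c', Z ◁ act F c c' ≫ φ c' = (α_ _ _ _).inv ≫ φ c ▷ (c ⟶[V] c') ≫ act G c c') →
      ∃! m : Z ⟶ N, ∀ c, m ▷ F.obj c ≫ e c = φ c := by
  have key : ∀ (Z : V) (m : Z ⟶ N) (c : C),
      m ▷ F.obj c ≫ e c = (m ≫ t) ▷ F.obj c ≫ evL F G c := fun Z m c => by
    rw [MonoidalCategory.comp_whiskerRight_assoc, he]
  constructor
  · intro _ Z φ hφ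
    refine ⟨natMk φ hφ ≫ inv t, fun c => ?_, fun m hm => ?_⟩
    · rw [key, Category.assoc, IsIso.inv_hom_id, Category.comp_id, natMk_evL]
    · rw [IsIso.eq_comp_inv]
      apply nat_ext
      intro c
      rw [← key, hm, natMk_evL]
  · intro h
    obtain ⟨m, hm, -⟩ := h (natObj F G) (evL F G) (evL_act F G)
    have hm' : m ≫ t = 𝟙 _ := by
      apply nat_ext
      intro c
      rw [← key, hm, MonoidalCategory.id_whiskerRight, Category.id_comp]
    refine ⟨m, ?_, hm'⟩
    refine (h N e fun c c' => ?_).unique (fun c => ?_) (fun c => ?_)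
    · rw [← he, ← he, whisker_exchange_assoc, evL_act]
      simp
    · rw [key, Category.assoc, hm', Category.comp_id, he]
    · rw [MonoidalCategory.id_whiskerRight, Category.id_comp]

end Evaluation

section LimitCones

variable [HasLimits V] [HasColimits V] {K : Type v} [EnrichedCategory V K] {D : Type u₁}
  [EnrichedCategory V D]
variable {P : EnrichedFunctor V K V} {G : EnrichedFunctor V K D}

theorem WeightedCone.comparison_evL (c : WeightedCone P G) (X : D) (k : K) :
    c.comparison X ▷ P.obj k ≫ evL P (G.comp V (corepr X)) k =
      (X ⟶[V] c.pt) ◁ c.app k ≫ eComp V X c.pt (G.obj k) := by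
  rw [whiskerRight_evL]
  refine (congrArg (fun t => (β_ _ _).hom ≫ uncurry t) (natLift_π _ _ k)).trans ?_
  refine (congrArg ((β_ _ _).hom ≫ ·) (uncurry_curry _)).trans ?_
  exact SymmetricCategory.symmetry_assoc _ _ _

/-- The universal property of a limit cone: every `V`-natural family `Z ⊗ P k ⟶ D(X, G k)` is
induced by a unique map `Z ⟶ D(X, L)`. -/
theorem WeightedCone.isLimit_iff (c : WeightedCone P G) :
    c.IsLimit ↔ ∀ (X : D) (Z : V) (φ : ∀ k, Z ⊗ P.obj k ⟶ (X ⟶[V] G.obj k)),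
      (∀ k k', Z ◁ act P k k' ≫ φ k' = (α_ _ _ _).inv ≫ φ k ▷ (k ⟶[V] k') ≫
        _ ◁ G.map k k' ≫ eComp V X (G.obj k) (G.obj k')) →
      ∃! m : Z ⟶ (X ⟶[V] c.pt),
        ∀ k, m ▷ P.obj k ≫ _ ◁ c.app k ≫ eComp V X c.pt (G.obj k) = φ k := by
  refine forall_congr' fun X => ?_
  refine (isIso_iff_existsUnique (c.comparison X) _ (c.comparison_evL X)).trans ?_
  have hact : ∀ k k' : K, act (G.comp V (corepr X)) k k' =
      (X ⟶[V] G.obj k) ◁ G.map k k' ≫ eComp V X (G.obj k) (G.obj k') := fun k k' =>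
    (act_comp G (corepr X) k k').trans (congrArg (_ ≫ ·) (act_corepr _ _ _))
  refine forall_congr' fun Z => forall_congr' fun φ => imp_congr_left ?_
  refine forall_congr' fun k => forall_congr' fun k' => ?_
  rw [hact]
  rfl

/-- For cones with values in `V` itself, it suffices to test the universal property of a limit cone
on `V`-natural families `W ⊗ P k ⟶ Q k`, that is, against the unit of `V`. -/
theorem WeightedCone.isLimit_iff_self {Q : EnrichedFunctor V K V} (c : WeightedCone P Q) :
    c.IsLimit ↔ ∀ (W : V) (ψ : ∀ k, W ⊗ P.obj k ⟶ Q.obj k),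
      (∀ k k', W ◁ act P k k' ≫ ψ k' = (α_ _ _ _).inv ≫ ψ k ▷ (k ⟶[V] k') ≫ act Q k k') →
      ∃! n : W ⟶ c.pt, ∀ k, n ▷ P.obj k ≫ uncurry (c.app k) = ψ k := by
  have hc : ∀ (X : V) (k : K) (Z : V) (m : Z ⟶ EnrichedCategory.Hom X c.pt),
      uncurry (m ▷ P.obj k ≫ _ ◁ c.app k ≫ eComp V X c.pt (Q.obj k)) =
        (α_ _ _ _).inv ≫ uncurry m ▷ P.obj k ≫ uncurry (c.app k) := fun X k Z m => by
    rw [← MonoidalCategory.tensorHom_def_assoc, uncurry_tensor_eComp]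
  have hQ : ∀ (X : V) (k k' : K) (Z : V) (m : Z ⟶ EnrichedCategory.Hom X (Q.obj k)),
      uncurry (m ▷ (k ⟶[V] k') ≫ _ ◁ Q.map k k' ≫ eComp V X (Q.obj k) (Q.obj k')) =
        (α_ _ _ _).inv ≫ uncurry m ▷ _ ≫ act Q k k' := fun X k k' Z m => by
    rw [← MonoidalCategory.tensorHom_def_assoc, uncurry_tensor_eComp, act]
  have hmc : ∀ (X : V) (k : K) (Z : V) (n : X ⊗ Z ⟶ c.pt),
      (curry n ▷ P.obj k ≫ (EnrichedCategory.Hom X c.pt) ◁ c.app k ≫ eComp V X c.pt (Q.obj k)) =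
        curry ((α_ _ _ _).inv ≫ n ▷ P.obj k ≫ uncurry (c.app k)) := fun X k Z n => by
    apply uncurry_injective
    rw [hc, uncurry_curry, uncurry_curry]
  have hnat : ∀ (X Z : V) (φ : ∀ k, Z ⊗ P.obj k ⟶ EnrichedCategory.Hom X (Q.obj k)),
      (∀ k k', Z ◁ act P k k' ≫ φ k' = (α_ _ _ _).inv ≫ φ k ▷ (k ⟶[V] k') ≫
        _ ◁ Q.map k k' ≫ eComp V X (Q.obj k) (Q.obj k')) ↔
      ∀ k k', (X ⊗ Z) ◁ act P k k' ≫ (α_ _ _ _).hom ≫ uncurry (φ k') =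
        (α_ _ _ _).inv ≫ ((α_ _ _ _).hom ≫ uncurry (φ k)) ▷ (k ⟶[V] k') ≫ act Q k k' := by
    intro X Z φ
    refine forall_congr' fun k => forall_congr' fun k' => ?_
    rw [← uncurry_injective.eq_iff, uncurry_natural_left, uncurry_natural_left, hQ,
      associator_naturality_right_assoc, ← cancel_epi (α_ _ _ _).hom]
    simp
  rw [WeightedCone.isLimit_iff]
  constructor
  · intro h W ψ hψ
    let φ : ∀ k, W ⊗ P.obj k ⟶ EnrichedCategory.Hom (𝟙_ V) (Q.obj k) := fun k =>
      curry ((λ_ _).hom ≫ ψ k)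
    have hφ : ∀ k, uncurry (φ k) = (λ_ _).hom ≫ ψ k := fun k => uncurry_curry _
    have key : ∀ (n : W ⟶ c.pt) (k : K),
        (curry ((λ_ W).hom ≫ n) ▷ P.obj k ≫ (EnrichedCategory.Hom (𝟙_ V) c.pt) ◁ c.app k ≫
          eComp V (𝟙_ V) c.pt (Q.obj k)) = φ k ↔ n ▷ P.obj k ≫ uncurry (c.app k) = ψ k := by
      intro n k
      rw [hmc, MonoidalCategory.comp_whiskerRight, Category.assoc, ← leftUnitor_tensor_hom_assoc,
        ← uncurry_injective.eq_iff, uncurry_curry, hφ, cancel_epi]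
    obtain ⟨m, hm, hm'⟩ := h (𝟙_ V) W φ ((hnat _ _ _).2 fun k k' => by
      rw [hφ, hφ, leftUnitor_tensor_hom]
      have := hψ k k'
      simp [this])
    have hm_eq : m = curry ((λ_ W).hom ≫ (λ_ W).inv ≫ uncurry m) := by
      rw [Iso.hom_inv_id_assoc, curry_uncurry]
    refine ⟨(λ_ W).inv ≫ uncurry m, fun k => ?_, fun n hn => ?_⟩
    · rw [← key, ← hm_eq]
      exact hm k
    · rw [← hm' _ fun k => (key n k).2 (hn k), uncurry_curry, Iso.inv_hom_id_assoc]
  · intro h X Z φ hφ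
    obtain ⟨n, hn, hn'⟩ := h (X ⊗ Z) (fun k => (α_ _ _ _).hom ≫ uncurry (φ k))
      ((hnat X Z φ).1 hφ)
    refine ⟨curry n, fun k => ?_, fun m hm => ?_⟩
    · refine (hmc X k Z n).trans ?_
      rw [hn, Iso.inv_hom_id_assoc, curry_uncurry]
    · rw [eq_curry_iff]
      refine hn' _ fun k => ?_
      rw [← hm k]
      refine ((Iso.inv_comp_eq _).1 (hc X k Z m).symm)

/-- The universal property of the image of a weighted cone under a `V`-functor `T : D ⟶ V`. -/
theorem WeightedCone.isLimit_map_iff (c : WeightedCone P G) (T : EnrichedFunctor V D V) :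
    (c.map T).IsLimit ↔ ∀ (W : V) (ψ : ∀ k, W ⊗ P.obj k ⟶ T.obj (G.obj k)),
      (∀ k k', W ◁ act P k k' ≫ ψ k' = (α_ _ _ _).inv ≫ ψ k ▷ (k ⟶[V] k') ≫
        _ ◁ G.map k k' ≫ act T (G.obj k) (G.obj k')) →
      ∃! n : W ⟶ T.obj c.pt, ∀ k, n ▷ P.obj k ≫ _ ◁ c.app k ≫ act T c.pt (G.obj k) = ψ k := by
  refine (c.map T).isLimit_iff_self.trans ?_
  have hleg : ∀ k, uncurry ((c.map T).app k) = T.obj c.pt ◁ c.app k ≫ act T c.pt (G.obj k) :=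
    fun k => uncurry_natural_left (A := T.obj c.pt) _ _
  simp only [hleg, act_comp]
  rfl

end LimitCones

end WeightedLimits

/-! ### Pairings and dualities; a presheaf with a right adjoint is flat -/

section Duals

variable [HasLimits V] [HasColimits V]

section Representable

variable {D : Type u₁} [EnrichedCategory V D] {K : Type v} [EnrichedCategory V K]

/-- A `V`-functor `T : D ⟶ V` that is isomorphic to a representable `D(R, -)` preserves all
weighted limits. -/
theorem preservesWeightedLimit_of_representation (T : EnrichedFunctor V D V) (R : D)
    (y : ∀ X : D, (R ⟶[V] X) ≅ T.obj X)
    (hy : ∀ X Y : D, (y X).hom ▷ (X ⟶[V] Y) ≫ act T X Y = eComp V R X Y ≫ (y Y).hom)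
    (P : EnrichedFunctor V K V) (G : EnrichedFunctor V K D) : PreservesWeightedLimit P G T := by
  intro c hc
  rw [WeightedCone.isLimit_iff] at hc
  rw [WeightedCone.isLimit_map_iff]
  intro W ψ hψ
  have hy' : ∀ X Y : D, (y X).inv ▷ (X ⟶[V] Y) ≫ eComp V R X Y = act T X Y ≫ (y Y).inv :=
    fun X Y => by
      rw [Iso.eq_comp_inv, Category.assoc, ← hy, ← MonoidalCategory.comp_whiskerRight_assoc,
        Iso.inv_hom_id, MonoidalCategory.id_whiskerRight, Category.id_comp]
  have hleg : ∀ (n : W ⟶ (R ⟶[V] c.pt)) (k : K),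
      (n ≫ (y c.pt).hom) ▷ P.obj k ≫ T.obj c.pt ◁ c.app k ≫ act T c.pt (G.obj k) =
        (n ▷ P.obj k ≫ _ ◁ c.app k ≫ eComp V R c.pt (G.obj k)) ≫ (y (G.obj k)).hom := fun n k => by
    rw [Category.assoc, Category.assoc, ← hy, whisker_exchange_assoc,
      MonoidalCategory.comp_whiskerRight_assoc]
  obtain ⟨m, hm, hm'⟩ := hc R W (fun k => ψ k ≫ (y (G.obj k)).inv) (fun k k' => by
    rw [MonoidalCategory.comp_whiskerRight_assoc, ← whisker_exchange_assoc, hy',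
      ← Category.assoc, hψ]
    simp only [Category.assoc])
  refine ⟨m ≫ (y c.pt).hom, fun k => ?_, fun n hn => ?_⟩
  · rw [hleg, hm, Category.assoc, Iso.inv_hom_id, Category.comp_id]
  · rw [← Iso.comp_inv_eq]
    refine hm' _ fun k => ?_
    rw [Iso.eq_comp_inv, ← hleg, Category.assoc, Iso.inv_hom_id, Category.comp_id, hn]

end Representable

section Tensor

variable {A : Type v} [EnrichedCategory V A] {F : EnrichedFunctor V Aᵒᵖ V}
  {G : EnrichedFunctor V A V}

theorem contraAct_weightedι (G : EnrichedFunctor V A V) (F : EnrichedFunctor V Aᵒᵖ V) (a b : A) :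
    G.obj a ◁ contraAct F a b ≫ weightedι G F a =
      (α_ _ _ _).inv ≫ act G a b ▷ _ ≫ weightedι G F b :=
  weighted_condition G F a b

theorem weighted_ext {Z : V} {f g : weightedTensor G F ⟶ Z}
    (h : ∀ a, weightedι G F a ≫ f = weightedι G F a ≫ g) : f = g :=
  coend_hom_ext h

theorem weighted_extL (X : V) {Z : V} {f g : X ⊗ weightedTensor G F ⟶ Z}
    (h : ∀ a, X ◁ weightedι G F a ≫ f = X ◁ weightedι G F a ≫ g) : f = g :=
  coend_hom_extL X h

theorem weighted_extLR (X Y : V) {Z : V} {f g : (X ⊗ weightedTensor G F) ⊗ Y ⟶ Z}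
    (h : ∀ a, (X ◁ weightedι G F a) ▷ Y ≫ f = (X ◁ weightedι G F a) ▷ Y ≫ g) : f = g :=
  coend_hom_extLR' X Y h

/-- The map out of `X ⊗ (G * F)` induced by a compatible family. -/
def weightedDescL (X : V) {Z : V} (f : ∀ a, X ⊗ (G.obj a ⊗ F.obj (.op a)) ⟶ Z)
    (h : ∀ a b, X ◁ G.obj a ◁ contraAct F a b ≫ f a =
      X ◁ (α_ _ _ _).inv ≫ X ◁ act G a b ▷ F.obj (.op b) ≫ f b) :
    X ⊗ weightedTensor G F ⟶ Z :=
  coendDescL X f h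

theorem weightedι_descL (X : V) {Z : V} (f : ∀ a, X ⊗ (G.obj a ⊗ F.obj (.op a)) ⟶ Z)
    (h : ∀ a b, X ◁ G.obj a ◁ contraAct F a b ≫ f a =
      X ◁ (α_ _ _ _).inv ≫ X ◁ act G a b ▷ F.obj (.op b) ≫ f b) (a : A) :
    X ◁ weightedι G F a ≫ weightedDescL X f h = f a :=
  coendι_descL X f h a

/-- The map out of `(G * F) ⊗ X` induced by a compatible family. -/
def weightedDescR (X : V) {Z : V} (f : ∀ a, (G.obj a ⊗ F.obj (.op a)) ⊗ X ⟶ Z)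
    (h : ∀ a b, (G.obj a ◁ contraAct F a b) ▷ X ≫ f a =
      (α_ _ _ _).inv ▷ X ≫ act G a b ▷ F.obj (.op b) ▷ X ≫ f b) :
    weightedTensor G F ⊗ X ⟶ Z :=
  coendDescR X f h

theorem weightedι_descR (X : V) {Z : V} (f : ∀ a, (G.obj a ⊗ F.obj (.op a)) ⊗ X ⟶ Z)
    (h : ∀ a b, (G.obj a ◁ contraAct F a b) ▷ X ≫ f a =
      (α_ _ _ _).inv ▷ X ≫ act G a b ▷ F.obj (.op b) ▷ X ≫ f b) (a : A) :
    weightedι G F a ▷ X ≫ weightedDescR X f h = f a :=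
  coendι_descR X f h a

theorem act_lanYoneda (F : EnrichedFunctor V Aᵒᵖ V) (G G' : EnrichedFunctor V A V) :
    act (lanYoneda F) G G' = lanMap F G G' :=
  uncurry_curry _

/-- The action `[A, V](G, G') ⊗ (G * F) ⟶ G' * F` of `- * F` on homs, with the natural
transformation on the left. -/
def lanMapL (F : EnrichedFunctor V Aᵒᵖ V) (G G' : EnrichedFunctor V A V) :
    natObj G G' ⊗ weightedTensor G F ⟶ weightedTensor G' F :=
  (β_ _ _).hom ≫ lanMap F G G'

theorem weightedι_lanMapL (F : EnrichedFunctor V Aᵒᵖ V) (G G' : EnrichedFunctor V A V) (a : A) :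
    natObj G G' ◁ weightedι G F a ≫ lanMapL F G G' =
      (α_ _ _ _).inv ≫ evL G G' a ▷ F.obj (.op a) ≫ weightedι G' F a := by
  rw [lanMapL, BraidedCategory.braiding_naturality_right_assoc, weightedι_lanMap, lanComp,
    evL, BraidedCategory.braiding_tensor_right_hom]
  simp only [MonoidalCategory.comp_whiskerRight, Category.assoc, Iso.inv_hom_id_assoc,
    ← MonoidalCategory.whiskerLeft_comp_assoc, SymmetricCategory.symmetry,
    MonoidalCategory.whiskerLeft_id, Category.id_comp, Iso.hom_inv_id_assoc]

/-- `V`-functoriality of `- * F`, in terms of `lanMapL`. -/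
theorem natComp_lanMapL (F : EnrichedFunctor V Aᵒᵖ V) (G G' G'' : EnrichedFunctor V A V) :
    natComp G G' G'' ▷ weightedTensor G F ≫
        lanMapL F G G'' =
      (β_ _ _).hom ▷ _ ≫ (α_ _ _ _).hom ≫ natObj G' G'' ◁ lanMapL F G G' ≫ lanMapL F G' G'' := by
  apply weighted_extL
  intro a
  have h := congrArg (natObj G' G'' ◁ ·) (weightedι_lanMapL F G G' a)
  simp only [MonoidalCategory.whiskerLeft_comp] at h
  have h' := congrArg (· ▷ F.obj (.op a)) (natComp_evL G G' G'' a)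
  simp only [MonoidalCategory.comp_whiskerRight] at h'
  rw [whisker_exchange_assoc, whisker_exchange_assoc, associator_naturality_right_assoc,
    reassoc_of% h, weightedι_lanMapL, weightedι_lanMapL, associator_inv_naturality_left_assoc,
    associator_inv_naturality_middle_assoc, reassoc_of% h']
  simp

end Tensor

section Pairing

variable {A : Type v} [EnrichedCategory V A]

/-- A pairing of a presheaf `F` with a `V`-functor `R : A ⟶ V`: an `A`-bilinear family
`F a ⊗ R b ⟶ A(a, b)`, that is, a morphism of modules `F ∘ R ⟶ 1` if `F` is seen as a module
`I ⇸ A` and `R` as a module `A ⇸ I`. -/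
structure Pairing (F : EnrichedFunctor V Aᵒᵖ V) (R : EnrichedFunctor V A V) where
  ev : ∀ a b : A, F.obj (.op a) ⊗ R.obj b ⟶ (a ⟶[V] b)
  contraAct_ev : ∀ a a' b : A, contraAct F a a' ▷ R.obj b ≫ ev a b =
    (α_ _ _ _).hom ≫ (a ⟶[V] a') ◁ ev a' b ≫ eComp V a a' b
  act_ev : ∀ a b b' : A, F.obj (.op a) ◁ act R b b' ≫ ev a b' =
    (α_ _ _ _).inv ≫ ev a b ▷ (b ⟶[V] b') ≫ eComp V a b b'

namespace Pairing

variable {F : EnrichedFunctor V Aᵒᵖ V} {R : EnrichedFunctor V A V} (p : Pairing F R)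

/-- The family inducing `Pairing.contract`. -/
def contractι (a b : A) : F.obj (.op a) ⊗ (R.obj b ⊗ F.obj (.op b)) ⟶ F.obj (.op a) :=
  (α_ _ _ _).inv ≫ p.ev a b ▷ F.obj (.op b) ≫ contraAct F a b

theorem contract_aux (a b b' : A) :
    F.obj (.op a) ◁ R.obj b ◁ contraAct F b b' ≫ p.contractι a b =
      F.obj (.op a) ◁ (α_ _ _ _).inv ≫ F.obj (.op a) ◁ act R b b' ▷ F.obj (.op b') ≫
        p.contractι a b' := by
  have h := congrArg (· ▷ F.obj (.op b')) (p.act_ev a b b')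
  simp only [MonoidalCategory.comp_whiskerRight] at h
  rw [contractι, contractι, associator_inv_naturality_right_assoc, whisker_exchange_assoc,
    associator_inv_naturality_middle_assoc, reassoc_of% h, comp_contraAct]
  simp

/-- The map `F a ⊗ (R * F) ⟶ F a` that pairs `F a` with `R` and lets the result act on `F`. -/
def contract (a : A) : F.obj (.op a) ⊗ weightedTensor R F ⟶ F.obj (.op a) :=
  weightedDescL _ (p.contractι a) (p.contract_aux a)

theorem weightedι_contract (a b : A) :
    F.obj (.op a) ◁ weightedι R F b ≫ p.contract a =
      (α_ _ _ _).inv ≫ p.ev a b ▷ F.obj (.op b) ≫ contraAct F a b :=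
  weightedι_descL _ (p.contractι a) (p.contract_aux a) b

/-- The family inducing `Pairing.evalAt`. -/
def evalAtι (H : EnrichedFunctor V A V) (a b : A) :
    (H.obj b ⊗ F.obj (.op b)) ⊗ R.obj a ⟶ H.obj a :=
  (α_ _ _ _).hom ≫ H.obj b ◁ p.ev b a ≫ act H b a

theorem evalAt_aux (H : EnrichedFunctor V A V) (a b b' : A) :
    (H.obj b ◁ contraAct F b b') ▷ R.obj a ≫ p.evalAtι H a b =
      (α_ _ _ _).inv ▷ R.obj a ≫ act H b b' ▷ F.obj (.op b') ▷ R.obj a ≫ p.evalAtι H a b' := by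
  have h := congrArg (H.obj b ◁ ·) (p.contraAct_ev b b' a)
  simp only [MonoidalCategory.whiskerLeft_comp] at h
  rw [evalAtι, evalAtι, associator_naturality_middle_assoc, reassoc_of% h, eComp_act,
    associator_naturality_left_assoc, ← whisker_exchange_assoc,
    associator_inv_naturality_right_assoc]
  simp

/-- The map `(H * F) ⊗ R a ⟶ H a` that pairs `F` with `R a` and lets the result act on `H`. -/
def evalAt (H : EnrichedFunctor V A V) (a : A) : weightedTensor H F ⊗ R.obj a ⟶ H.obj a :=
  weightedDescR _ (p.evalAtι H a) (p.evalAt_aux H a)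

theorem weightedι_evalAt (H : EnrichedFunctor V A V) (a b : A) :
    weightedι H F b ▷ R.obj a ≫ p.evalAt H a =
      (α_ _ _ _).hom ≫ H.obj b ◁ p.ev b a ≫ act H b a :=
  weightedι_descR _ (p.evalAtι H a) (p.evalAt_aux H a) b

theorem evalAt_act (H : EnrichedFunctor V A V) (a a' : A) :
    weightedTensor H F ◁ act R a a' ≫ p.evalAt H a' =
      (α_ _ _ _).inv ≫ p.evalAt H a ▷ (a ⟶[V] a') ≫ act H a a' := by
  apply weighted_extR
  intro b
  have h := congrArg (H.obj b ◁ ·) (p.act_ev b a a')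
  simp only [MonoidalCategory.whiskerLeft_comp] at h
  have h' := congrArg (· ▷ (a ⟶[V] a')) (p.weightedι_evalAt H a b)
  simp only [MonoidalCategory.comp_whiskerRight] at h'
  rw [← whisker_exchange_assoc, weightedι_evalAt, associator_naturality_right_assoc,
    reassoc_of% h, eComp_act, associator_inv_naturality_left_assoc, reassoc_of% h']
  simp

/-- The map `H * F ⟶ [A, V](R, H)` induced by a pairing. -/
def toNat (H : EnrichedFunctor V A V) : weightedTensor H F ⟶ natObj R H :=
  natMk (p.evalAt H) (p.evalAt_act H)

theorem toNat_evL (H : EnrichedFunctor V A V) (a : A) :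
    p.toNat H ▷ R.obj a ≫ evL R H a = p.evalAt H a :=
  natMk_evL (p.evalAt H) (p.evalAt_act H) a

/-- `V`-naturality of `Pairing.evalAt` in the functor. -/
theorem lanMapL_evalAt (G H : EnrichedFunctor V A V) (a : A) :
    lanMapL F G H ▷ R.obj a ≫ p.evalAt H a =
      (α_ _ _ _).hom ≫ natObj G H ◁ p.evalAt G a ≫ evL G H a := by
  apply weighted_extLR
  intro b
  have h := congrArg (natObj G H ◁ ·) (p.weightedι_evalAt G a b)
  simp only [MonoidalCategory.whiskerLeft_comp] at h
  have h' := congrArg (· ▷ R.obj a) (weightedι_lanMapL F G H b)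
  simp only [MonoidalCategory.comp_whiskerRight] at h'
  rw [reassoc_of% h', weightedι_evalAt, associator_naturality_middle_assoc, reassoc_of% h,
    evL_act, associator_naturality_left_assoc, ← whisker_exchange_assoc,
    associator_inv_naturality_right_assoc]
  simp

/-- This reduces one half of `Duality.representation` to the first triangle identity. -/
theorem toNat_lanMapL (H : EnrichedFunctor V A V) (a : A) :
    weightedι H F a ▷ weightedTensor R F ≫ p.toNat H ▷ weightedTensor R F ≫ lanMapL F R H =
      (α_ _ _ _).hom ≫ H.obj a ◁ p.contract a ≫ weightedι H F a := by
  apply weighted_extL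
  intro b
  have h := congrArg (· ▷ F.obj (.op b)) (p.toNat_evL H b)
  simp only [MonoidalCategory.comp_whiskerRight] at h
  have h1 := congrArg (· ▷ F.obj (.op b)) (p.weightedι_evalAt H b a)
  simp only [MonoidalCategory.comp_whiskerRight] at h1
  have h2 := congrArg (H.obj a ◁ ·) (p.weightedι_contract a b)
  simp only [MonoidalCategory.whiskerLeft_comp] at h2
  rw [whisker_exchange_assoc, whisker_exchange_assoc, weightedι_lanMapL,
    associator_inv_naturality_left_assoc, associator_inv_naturality_left_assoc,
    reassoc_of% h, reassoc_of% h1, associator_naturality_right_assoc, reassoc_of% h2,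
    contraAct_weightedι, associator_inv_naturality_middle_assoc]
  simp

end Pairing

/-- The data exhibiting `R : A ⟶ V` as right adjoint to the presheaf `F`, seen as a module
`I ⇸ A`, with the coends in the composite modules eliminated from the counit. -/
structure Duality (F : EnrichedFunctor V Aᵒᵖ V) (R : EnrichedFunctor V A V)
    extends Pairing F R where
  unit : 𝟙_ V ⟶ weightedTensor R F
  unit_contract : ∀ a : A, F.obj (.op a) ◁ unit ≫ toPairing.contract a = (ρ_ _).hom
  unit_evalAt : ∀ a : A, unit ▷ R.obj a ≫ toPairing.evalAt R a = (λ_ _).hom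

namespace Duality

variable {F : EnrichedFunctor V Aᵒᵖ V} {R : EnrichedFunctor V A V}

/-- The isomorphism `[A, V](R, H) ≅ H * F`: the `V`-functor `- * F` is represented by the
right adjoint `R` of `F`. -/
def representation (d : Duality F R) (H : EnrichedFunctor V A V) :
    natObj R H ≅ weightedTensor H F where
  hom := (ρ_ _).inv ≫ natObj R H ◁ d.unit ≫ lanMapL F R H
  inv := d.toNat H
  hom_inv_id := by
    apply nat_ext
    intro a
    have h := congrArg (natObj R H ◁ ·) (d.unit_evalAt a)
    simp only [MonoidalCategory.whiskerLeft_comp] at h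
    rw [MonoidalCategory.comp_whiskerRight_assoc, d.toNat_evL,
      MonoidalCategory.comp_whiskerRight_assoc, MonoidalCategory.comp_whiskerRight_assoc,
      d.lanMapL_evalAt, associator_naturality_middle_assoc, reassoc_of% h]
    simp
  inv_hom_id := by
    apply weighted_ext
    intro a
    have h := congrArg (H.obj a ◁ ·) (d.unit_contract a)
    simp only [MonoidalCategory.whiskerLeft_comp] at h
    rw [rightUnitor_inv_naturality_assoc, rightUnitor_inv_naturality_assoc,
      ← whisker_exchange_assoc, ← whisker_exchange_assoc, d.toNat_lanMapL,
      associator_naturality_right_assoc, reassoc_of% h]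
    simp

theorem representation_natural (d : Duality F R) (H H' : EnrichedFunctor V A V) :
    (d.representation H).hom ▷ natObj H H' ≫ lanMap F H H' =
      natComp R H H' ≫ (d.representation H').hom := by
  have h : lanMap F H H' = (β_ _ _).hom ≫ lanMapL F H H' := by
    rw [lanMapL, SymmetricCategory.symmetry_assoc]
  dsimp only [representation]
  rw [h, BraidedCategory.braiding_naturality_left_assoc,
    rightUnitor_inv_naturality_assoc, ← whisker_exchange_assoc, natComp_lanMapL,
    whisker_exchange_assoc, associator_naturality_right_assoc]
  simp

/-- A presheaf with a right adjoint is flat for every class of indexes. -/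
theorem isFlat (d : Duality F R) (Φ : IndexClass V) : IsFlat Φ F := fun _ _ P _ G =>
  preservesWeightedLimit_of_representation (lanYoneda F) R d.representation
    (fun H H' => (congrArg (_ ≫ ·) (act_lanYoneda F H H')).trans (d.representation_natural H H'))
    P G

end Duality

end Pairing

end Duals

/-! ### The universal pairing and the Yoneda embedding -/

section UniversalPairing

variable [HasLimits V] [HasColimits V]

/-- Both sides are the permutation of `X ⊗ Y ⊗ Z` that swaps `Y` and `Z`. -/
theorem braiding_swap_swap (X Y Z : V) :
    (β_ X Y).hom ▷ Z ≫ (β_ (Y ⊗ X) Z).hom ≫ (α_ _ _ _).inv ≫ (β_ (Z ⊗ Y) X).hom =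
      (α_ _ _ _).hom ≫ X ◁ (β_ Y Z).hom := by
  rw [BraidedCategory.braiding_naturality_left_assoc, BraidedCategory.braiding_tensor_left_hom,
    BraidedCategory.braiding_tensor_left_hom]
  simp only [Category.assoc, Iso.inv_hom_id_assoc]
  simp only [← MonoidalCategory.whiskerLeft_comp_assoc, SymmetricCategory.symmetry,
    MonoidalCategory.whiskerLeft_id, Category.id_comp, Iso.hom_inv_id_assoc]
  simp only [← MonoidalCategory.comp_whiskerRight_assoc, SymmetricCategory.symmetry,
    MonoidalCategory.id_whiskerRight, Category.id_comp, Iso.inv_hom_id, Category.comp_id]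

/-- Compatibility of a map `Z ⊗ P ⟶ Q` with right actions of `H`, in terms of the left actions that
correspond to them under the symmetry. -/
theorem leftAct_natural_iff {H P P' Q Q' Z : V} (p : P' ⊗ H ⟶ P) (q : Q' ⊗ H ⟶ Q)
    (f : Z ⊗ P ⟶ Q) (f' : Z ⊗ P' ⟶ Q') :
    ((β_ H P').hom ≫ p) ▷ Z ≫ (β_ _ _).hom ≫ f =
      (α_ _ _ _).hom ≫ H ◁ ((β_ _ _).hom ≫ f') ≫ (β_ H Q').hom ≫ q ↔
    Z ◁ p ≫ f = (α_ _ _ _).inv ≫ f' ▷ H ≫ q := by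
  have h := braiding_swap_swap H P' Z
  rw [← cancel_epi ((β_ H P').hom ▷ Z ≫ (β_ (P' ⊗ H) Z).hom),
    MonoidalCategory.whiskerLeft_comp_assoc,
    BraidedCategory.braiding_naturality_right_assoc, ← reassoc_of% h,
    SymmetricCategory.symmetry_assoc, MonoidalCategory.comp_whiskerRight_assoc,
    BraidedCategory.braiding_naturality_left_assoc]
  simp only [Category.assoc]

section Hom

variable {A : Type v} [EnrichedCategory V A]

/-- `V`-naturality of a family `P a ⊗ Z ⟶ Q a` of maps of presheaves, in terms of the left actions
of `A` on the presheaves. -/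
theorem contraAct_natural_iff (P Q : EnrichedFunctor V Aᵒᵖ V) {Z : V}
    (φ : ∀ a : Aᵒᵖ, Z ⊗ P.obj a ⟶ Q.obj a) (a a' : A) :
    (contraAct P a a' ▷ Z ≫ (β_ _ _).hom ≫ φ (.op a) =
      (α_ _ _ _).hom ≫ (a ⟶[V] a') ◁ ((β_ _ _).hom ≫ φ (.op a')) ≫ contraAct Q a a') ↔
    Z ◁ act P (.op a') (.op a) ≫ φ (.op a) =
      (α_ _ _ _).inv ≫ φ (.op a') ▷ (a ⟶[V] a') ≫ act Q (.op a') (.op a) := by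
  exact leftAct_natural_iff (act P (.op a') (.op a)) (act Q (.op a') (.op a)) _ _

theorem braiding_contraAct (F : EnrichedFunctor V Aᵒᵖ V) (a b : A) :
    (β_ (F.obj (.op a)) (b ⟶[V] a)).hom ≫ contraAct F b a = act F (.op a) (.op b) :=
  SymmetricCategory.symmetry_assoc _ _ _

theorem contraAct_corepr (a a' c : A) :
    contraAct (corepr (V := V) (Opposite.op c)) a a' = eComp V a a' c := by
  have h : contraAct (corepr (V := V) (Opposite.op c)) a a' =
      (β_ _ _).hom ≫ act (corepr (V := V) (Opposite.op c)) (.op a') (.op a) := rfl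
  rw [h, act_corepr]
  exact SymmetricCategory.symmetry_assoc _ _ _

/-- A pairing is universal if it exhibits each `R c` as the end `[Aᵒᵖ, V](F, A(-, c))`. -/
def Pairing.IsUniversal {F : EnrichedFunctor V Aᵒᵖ V} {R : EnrichedFunctor V A V}
    (p : Pairing F R) : Prop :=
  ∀ (c : A) (Z : V) (φ : ∀ a : A, F.obj (.op a) ⊗ Z ⟶ (a ⟶[V] c)),
    (∀ a a', contraAct F a a' ▷ Z ≫ φ a = (α_ _ _ _).hom ≫ (a ⟶[V] a') ◁ φ a' ≫ eComp V a a' c) →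
    ∃! m : Z ⟶ R.obj c, ∀ a, F.obj (.op a) ◁ m ≫ p.ev a c = φ a

theorem Pairing.IsUniversal.hom_ext {F : EnrichedFunctor V Aᵒᵖ V} {R : EnrichedFunctor V A V}
    {p : Pairing F R} (hp : p.IsUniversal) {c : A} {Z : V} {f g : Z ⟶ R.obj c}
    (h : ∀ a, F.obj (.op a) ◁ f ≫ p.ev a c = F.obj (.op a) ◁ g ≫ p.ev a c) : f = g :=
  (hp c Z (fun a => F.obj (.op a) ◁ g ≫ p.ev a c) fun a a' => by
    rw [← whisker_exchange_assoc, p.contraAct_ev]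
    simp).unique h fun _ => rfl

/-- The evaluation `F a ⊗ [Aᵒᵖ, V](F, A(-, c)) ⟶ A(a, c)`. -/
def dualEv (F : EnrichedFunctor V Aᵒᵖ V) (a c : A) :
    F.obj (.op a) ⊗ natObj F (corepr (.op c)) ⟶ (a ⟶[V] c) :=
  (β_ _ _).hom ≫ evL F (corepr (.op c)) (.op a)

theorem contraAct_dualEv (F : EnrichedFunctor V Aᵒᵖ V) (a a' c : A) :
    contraAct F a a' ▷ _ ≫ dualEv F a c =
      (α_ _ _ _).hom ≫ (a ⟶[V] a') ◁ dualEv F a' c ≫ eComp V a a' c := by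
  refine ((contraAct_natural_iff F (corepr (.op c)) (evL F (corepr (.op c))) a a').2
    (evL_act _ _ _ _)).trans ?_
  rw [contraAct_corepr]
  rfl

theorem existsUnique_dualEv (F : EnrichedFunctor V Aᵒᵖ V) (c : A) (Z : V)
    (φ : ∀ a : A, F.obj (.op a) ⊗ Z ⟶ (a ⟶[V] c))
    (hφ : ∀ a a', contraAct F a a' ▷ Z ≫ φ a =
      (α_ _ _ _).hom ≫ (a ⟶[V] a') ◁ φ a' ≫ eComp V a a' c) :
    ∃! m : Z ⟶ natObj F (corepr (.op c)), ∀ a, F.obj (.op a) ◁ m ≫ dualEv F a c = φ a := by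
  have key : ∀ (m : Z ⟶ natObj F (corepr (.op c))) (a : A), F.obj (.op a) ◁ m ≫ dualEv F a c =
      (β_ _ _).hom ≫ m ▷ F.obj (.op a) ≫ evL F (corepr (.op c)) (.op a) := fun m a =>
    BraidedCategory.braiding_naturality_right_assoc _ _ _
  let ψ : ∀ a : Aᵒᵖ, Z ⊗ F.obj a ⟶ (corepr (V := V) (Opposite.op c)).obj a := fun a =>
    (β_ _ _).hom ≫ φ a.unop
  have hψ' : ∀ a : A, (β_ _ _).hom ≫ ψ (.op a) = φ a := fun a =>
    SymmetricCategory.symmetry_assoc _ _ _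
  have hψ : ∀ a a' : Aᵒᵖ, Z ◁ act F a a' ≫ ψ a' =
      (α_ _ _ _).inv ≫ ψ a ▷ (a ⟶[V] a') ≫ act (corepr (V := V) (Opposite.op c)) a a' :=
    fun a a' => (contraAct_natural_iff F (corepr (.op c)) ψ a'.unop a.unop).1 (by
      rw [hψ', hψ', contraAct_corepr]
      exact hφ _ _)
  refine ⟨natMk ψ hψ, fun a => ?_, fun m hm => ?_⟩
  · refine (key _ a).trans ?_
    rw [natMk_evL]
    exact hψ' a
  · apply nat_ext
    intro a
    rw [natMk_evL, ← cancel_epi (β_ _ _).hom]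
    exact ((key m a.unop).symm.trans (hm a.unop)).trans (hψ' a.unop).symm

/-- Every presheaf `F` has a universal pairing, with `R c = [Aᵒᵖ, V](F, A(-, c))`. -/
theorem exists_isUniversal (F : EnrichedFunctor V Aᵒᵖ V) :
    ∃ (R : EnrichedFunctor V A V) (p : Pairing F R), p.IsUniversal := by
  have ext : ∀ {c : A} {Z : V} {f g : Z ⟶ natObj F (corepr (.op c))},
      (∀ a, F.obj (.op a) ◁ f ≫ dualEv F a c = F.obj (.op a) ◁ g ≫ dualEv F a c) → f = g :=
    fun {c Z f g} h => (existsUnique_dualEv F c Z (fun a => F.obj (.op a) ◁ g ≫ dualEv F a c)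
      fun a a' => by
        rw [← whisker_exchange_assoc, contraAct_dualEv]
        simp).unique h fun _ => rfl
  have hact : ∀ c c' : A, ∃ r : natObj F (corepr (.op c)) ⊗ (c ⟶[V] c') ⟶
      natObj F (corepr (.op c')), ∀ a, F.obj (.op a) ◁ r ≫ dualEv F a c' =
        (α_ _ _ _).inv ≫ dualEv F a c ▷ (c ⟶[V] c') ≫ eComp V a c c' := fun c c' =>
    (existsUnique_dualEv F c' _ _ fun a a' => by
      have h := congrArg (· ▷ (c ⟶[V] c')) (contraAct_dualEv F a a' c)
      simp only [MonoidalCategory.comp_whiskerRight] at h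
      rw [associator_inv_naturality_left_assoc, reassoc_of% h, ← e_assoc']
      simp).exists
  choose r hr using hact
  refine ⟨ofAct (fun c => natObj F (corepr (.op c))) r (fun c => ext fun a => ?_)
    (fun c c' c'' => ext fun a => ?_),
    ⟨dualEv F, contraAct_dualEv F, fun a b b' => ?_⟩, existsUnique_dualEv F⟩
  · rw [MonoidalCategory.whiskerLeft_comp_assoc, hr, associator_inv_naturality_right_assoc,
      whisker_exchange_assoc, (Iso.inv_comp_eq _).1 (e_comp_id V a c)]
    simp
  · have h := congrArg (· ▷ (c' ⟶[V] c'')) (hr c c' a)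
    simp only [MonoidalCategory.comp_whiskerRight] at h
    rw [MonoidalCategory.whiskerLeft_comp_assoc, hr, MonoidalCategory.whiskerLeft_comp_assoc,
      MonoidalCategory.whiskerLeft_comp_assoc, hr, associator_inv_naturality_right_assoc,
      associator_inv_naturality_middle_assoc, reassoc_of% h, whisker_exchange_assoc, ← e_assoc']
    simp
  · rw [act_ofAct]
    exact hr b b' a

/-- The evaluation `[A, V](H, A(a, -)) ⊗ H b ⟶ A(a, b)`. -/
def homEv (H : EnrichedFunctor V A V) (a b : A) :
    natObj H (corepr a) ⊗ H.obj b ⟶ (a ⟶[V] b) :=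
  evL H (corepr a) b

theorem homEv_ext {H : EnrichedFunctor V A V} {a : A} {Z : V} {f g : Z ⟶ natObj H (corepr a)}
    (h : ∀ b, f ▷ H.obj b ≫ homEv H a b = g ▷ H.obj b ≫ homEv H a b) : f = g :=
  nat_ext h

theorem homEv_act (H : EnrichedFunctor V A V) (a b b' : A) :
    natObj H (corepr a) ◁ act H b b' ≫ homEv H a b' =
      (α_ _ _ _).inv ≫ homEv H a b ▷ (b ⟶[V] b') ≫ eComp V a b b' :=
  (evL_act H (corepr a) b b').trans
    (congrArg (fun t => (α_ _ _ _).inv ≫ homEv H a b ▷ (b ⟶[V] b') ≫ t) (act_corepr a b b'))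

/-- The map into `[A, V](H, A(a, -))` given by a `V`-natural family `Z ⊗ H b ⟶ A(a, b)`. -/
def homMk {H : EnrichedFunctor V A V} {a : A} {Z : V} (φ : ∀ b, Z ⊗ H.obj b ⟶ (a ⟶[V] b))
    (h : ∀ b b', Z ◁ act H b b' ≫ φ b' =
      (α_ _ _ _).inv ≫ φ b ▷ (b ⟶[V] b') ≫ eComp V a b b') : Z ⟶ natObj H (corepr a) :=
  natMk (G := corepr a) φ fun b b' => (h b b').trans
    (congrArg (fun t => (α_ _ _ _).inv ≫ φ b ▷ (b ⟶[V] b') ≫ t) (act_corepr a b b').symm)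

theorem homMk_homEv {H : EnrichedFunctor V A V} {a : A} {Z : V}
    (φ : ∀ b, Z ⊗ H.obj b ⟶ (a ⟶[V] b))
    (h : ∀ b b', Z ◁ act H b b' ≫ φ b' =
      (α_ _ _ _).inv ≫ φ b ▷ (b ⟶[V] b') ≫ eComp V a b b') (b : A) :
    homMk φ h ▷ H.obj b ≫ homEv H a b = φ b :=
  natMk_evL (G := corepr a) φ _ b

/-- The evaluation `[A, V](A(a, -), A(b, -)) ⊗ A(a, c) ⟶ A(b, c)`. -/
def coreprEv (a b c : A) :
    natObj (corepr (V := V) a) (corepr b) ⊗ (a ⟶[V] c) ⟶ (b ⟶[V] c) :=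
  evL (corepr a) (corepr b) c

theorem coreprEv_ext {a b : A} {Z : V} {f g : Z ⟶ natObj (corepr (V := V) a) (corepr b)}
    (h : ∀ c, f ▷ (a ⟶[V] c) ≫ coreprEv a b c = g ▷ (a ⟶[V] c) ≫ coreprEv a b c) : f = g :=
  nat_ext h

theorem natComp_homEv (H : EnrichedFunctor V A V) (a b c : A) :
    natComp H (corepr a) (corepr b) ▷ H.obj c ≫ homEv H b c =
      (β_ _ _).hom ▷ H.obj c ≫ (α_ _ _ _).hom ≫ _ ◁ homEv H a c ≫ coreprEv a b c :=
  natComp_evL H (corepr a) (corepr b) c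

theorem natComp_coreprEv (a b c d : A) :
    natComp (corepr (V := V) a) (corepr b) (corepr c) ▷ (a ⟶[V] d) ≫ coreprEv a c d =
      (β_ _ _).hom ▷ (a ⟶[V] d) ≫ (α_ _ _ _).hom ≫ _ ◁ coreprEv a b d ≫ coreprEv b c d :=
  natComp_evL (corepr a) (corepr b) (corepr c) d

/-- The map `A(b, a) ⟶ [A, V](A(a, -), A(b, -))` given by precomposition. -/
def precompHom (a b : A) : (b ⟶[V] a) ⟶ natObj (corepr (V := V) a) (corepr b) :=
  homMk (H := corepr a) (fun c => eComp V b a c) fun c c' => by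
    rw [act_corepr]
    exact (e_assoc V b a c c').symm

theorem precompHom_coreprEv (a b c : A) :
    precompHom a b ▷ (a ⟶[V] c) ≫ coreprEv a b c = eComp V b a c :=
  homMk_homEv (H := corepr a) (fun c => eComp V b a c) _ c

variable (V A) in
/-- The Yoneda embedding `Aᵒᵖ ⟶ [A, V]`, sending `a` to `A(a, -)`. -/
def coyonedaEmbedding : EnrichedFunctor V Aᵒᵖ (EnrichedFunctor V A V) where
  obj a := corepr a.unop
  map a b := precompHom a.unop b.unop
  map_id a := by
    apply coreprEv_ext
    intro c
    have h : (eId V a.unop ≫ precompHom a.unop a.unop) ▷ (a.unop ⟶[V] c) ≫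
        coreprEv a.unop a.unop c = natId (corepr (V := V) a.unop) ▷ (a.unop ⟶[V] c) ≫
          coreprEv a.unop a.unop c := by
      have hN : natId (corepr (V := V) a.unop) ▷ (a.unop ⟶[V] c) ≫ coreprEv a.unop a.unop c =
          (λ_ _).hom := natId_evL (corepr (V := V) a.unop) c
      rw [MonoidalCategory.comp_whiskerRight_assoc, precompHom_coreprEv, hN,
        ← Iso.inv_comp_eq_id, e_id_comp]
    exact h
  map_comp a b c := by
    apply coreprEv_ext
    intro d
    have h : (((β_ (b.unop ⟶[V] a.unop) (c.unop ⟶[V] b.unop)).hom ≫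
          eComp V c.unop b.unop a.unop) ≫ precompHom a.unop c.unop) ▷
        (a.unop ⟶[V] d) ≫ coreprEv a.unop c.unop d =
      ((precompHom a.unop b.unop ⊗ₘ precompHom b.unop c.unop) ≫
        natComp (corepr (V := V) a.unop) (corepr b.unop) (corepr c.unop)) ▷
        (a.unop ⟶[V] d) ≫ coreprEv a.unop c.unop d := by
      have h := congrArg (· ▷ (a.unop ⟶[V] d)) (BraidedCategory.braiding_naturality
        (precompHom (V := V) a.unop b.unop) (precompHom (V := V) b.unop c.unop))
      simp only [MonoidalCategory.comp_whiskerRight] at h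
      rw [MonoidalCategory.comp_whiskerRight_assoc, MonoidalCategory.comp_whiskerRight_assoc,
        precompHom_coreprEv, MonoidalCategory.comp_whiskerRight_assoc, natComp_coreprEv,
        reassoc_of% h, MonoidalCategory.tensorHom_def, MonoidalCategory.comp_whiskerRight_assoc,
        associator_naturality_middle_assoc, ← MonoidalCategory.whiskerLeft_comp_assoc,
        precompHom_coreprEv, associator_naturality_left_assoc, ← whisker_exchange_assoc,
        precompHom_coreprEv, e_assoc']
    exact h

end Hom

end UniversalPairing

/-! ### A flat presheaf has a right adjoint -/

section FlatDual

variable [HasLimits V] [HasColimits V] {A : Type v} [EnrichedCategory V A]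

section Cone

variable {F : EnrichedFunctor V Aᵒᵖ V} {R : EnrichedFunctor V A V}

theorem whisker_precompHom_homEv (H : EnrichedFunctor V A V) (a b c : A) :
    (natObj H (corepr a) ◁ precompHom a b ≫ natComp H (corepr a) (corepr b)) ▷ H.obj c ≫
        homEv H b c =
      (β_ _ _).hom ▷ H.obj c ≫ (α_ _ _ _).hom ≫ (b ⟶[V] a) ◁ homEv H a c ≫ eComp V b a c := by
  have h := congrArg (· ▷ H.obj c)
    (BraidedCategory.braiding_naturality_right (natObj H (corepr a)) (precompHom (V := V) a b))
  simp only [MonoidalCategory.comp_whiskerRight] at h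
  rw [MonoidalCategory.comp_whiskerRight_assoc, natComp_homEv, reassoc_of% h,
    associator_naturality_left_assoc, ← whisker_exchange_assoc, precompHom_coreprEv]

/-- The leg `F a ⟶ [A, V](R, A(a, -))` of the cone of a pairing. -/
def Pairing.leg (p : Pairing F R) (a : A) : F.obj (.op a) ⟶ natObj R (corepr a) :=
  homMk (p.ev a) (p.act_ev a)

theorem Pairing.leg_homEv (p : Pairing F R) (a b : A) :
    p.leg a ▷ R.obj b ≫ homEv R a b = p.ev a b :=
  homMk_homEv (p.ev a) (p.act_ev a) b

theorem Pairing.contraAct_leg (p : Pairing F R) (a b : A) :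
    ((β_ _ _).hom ≫ contraAct F b a) ≫ p.leg b =
      (p.leg a ⊗ₘ precompHom a b) ≫ natComp R (corepr a) (corepr b) := by
  apply homEv_ext
  intro c
  have h := congrArg (· ▷ R.obj c) (BraidedCategory.braiding_naturality_left (p.leg a) (b ⟶[V] a))
  simp only [MonoidalCategory.comp_whiskerRight] at h
  rw [MonoidalCategory.tensorHom_def, Category.assoc (p.leg a ▷ _),
    MonoidalCategory.comp_whiskerRight_assoc (p.leg a ▷ _), whisker_precompHom_homEv,
    reassoc_of% h, associator_naturality_middle_assoc, ← MonoidalCategory.whiskerLeft_comp_assoc,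
    p.leg_homEv, MonoidalCategory.comp_whiskerRight_assoc _ (p.leg b), p.leg_homEv,
    ← p.contraAct_ev,
    MonoidalCategory.comp_whiskerRight_assoc]

/-- The cone over the Yoneda embedding `Aᵒᵖ ⟶ [A, V]`, weighted by `F` and with vertex `R`, that
corresponds to a pairing of `F` with `R`. -/
def Pairing.cone (p : Pairing F R) : WeightedCone F (coyonedaEmbedding V A) where
  pt := R
  app a := p.leg a.unop
  naturality a b := (congrArg (· ≫ p.leg b.unop)
    (braiding_contraAct F a.unop b.unop).symm).trans (p.contraAct_leg a.unop b.unop)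

theorem natComp_leg_homEv (p : Pairing F R) (H : EnrichedFunctor V A V) {Z : V}
    (m : Z ⟶ natObj H R) (a b : A) :
    (m ▷ F.obj (.op a) ≫ _ ◁ p.leg a ≫ natComp H R (corepr a)) ▷ H.obj b ≫ homEv H a b =
      (β_ _ _).hom ▷ H.obj b ≫ (α_ _ _ _).hom ≫
        F.obj (.op a) ◁ (m ▷ H.obj b ≫ evL H R b) ≫ p.ev a b := by
  have h : natComp H R (corepr a) ▷ H.obj b ≫ homEv H a b =
      (β_ _ _).hom ▷ H.obj b ≫ (α_ _ _ _).hom ≫ _ ◁ evL H R b ≫ homEv R a b :=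
    natComp_evL H R (corepr a) b
  have h' := congrArg (· ▷ H.obj b) (BraidedCategory.braiding_naturality m (p.leg a))
  simp only [MonoidalCategory.comp_whiskerRight] at h'
  rw [← MonoidalCategory.tensorHom_def_assoc, MonoidalCategory.comp_whiskerRight_assoc, h,
    reassoc_of% h', MonoidalCategory.tensorHom_def', MonoidalCategory.comp_whiskerRight_assoc,
    associator_naturality_left_assoc, ← whisker_exchange_assoc, p.leg_homEv,
    associator_naturality_middle_assoc, MonoidalCategory.whiskerLeft_comp_assoc]

/-- The universal pairing exhibits `R` as the weighted limit `{F, Y}`, where `Y : Aᵒᵖ ⟶ [A, V]` is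
the Yoneda embedding. -/
theorem Pairing.IsUniversal.isLimit_cone {p : Pairing F R} (hp : p.IsUniversal) :
    p.cone.IsLimit := by
  rw [WeightedCone.isLimit_iff]
  intro H Z φ' hφ'
  let φ : ∀ a : A, Z ⊗ F.obj (.op a) ⟶ natObj H (corepr a) := fun a => φ' (.op a)
  have hφ : ∀ a b : A, Z ◁ ((β_ _ _).hom ≫ contraAct F b a) ≫ φ b =
      (α_ _ _ _).inv ≫ φ a ▷ (b ⟶[V] a) ≫ natObj H (corepr a) ◁ precompHom a b ≫
        natComp H (corepr a) (corepr b) := fun a b =>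
    (congrArg (fun t => Z ◁ t ≫ φ b) (braiding_contraAct F a b)).trans (hφ' (.op a) (.op b))
  suffices ∃! m : Z ⟶ natObj H R, ∀ a : A,
      m ▷ F.obj (.op a) ≫ _ ◁ p.leg a ≫ natComp H R (corepr a) = φ a by
    obtain ⟨m, hm, hm'⟩ := this
    exact ⟨m, fun a => hm a.unop, fun n hn => hm' n fun a => hn (.op a)⟩
  -- The family `φ`, transposed at `b` to a family `F a ⊗ (Z ⊗ H b) ⟶ A(a, b)`.
  let χ : ∀ a b : A, F.obj (.op a) ⊗ (Z ⊗ H.obj b) ⟶ (a ⟶[V] b) := fun a b =>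
    (α_ _ _ _).inv ≫ (β_ _ _).hom ▷ H.obj b ≫ φ a ▷ H.obj b ≫ homEv H a b
  have hχ : ∀ (m : Z ⟶ natObj H R) (a : A),
      m ▷ F.obj (.op a) ≫ _ ◁ p.leg a ≫ natComp H R (corepr a) = φ a ↔
        ∀ b, F.obj (.op a) ◁ (m ▷ H.obj b ≫ evL H R b) ≫ p.ev a b = χ a b := by
    intro m a
    have e : ∀ b, (m ▷ F.obj (.op a) ≫ _ ◁ p.leg a ≫ natComp H R (corepr a)) ▷ H.obj b ≫
        homEv H a b = φ a ▷ H.obj b ≫ homEv H a b ↔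
        F.obj (.op a) ◁ (m ▷ H.obj b ≫ evL H R b) ≫ p.ev a b = χ a b := by
      intro b
      rw [natComp_leg_homEv, ← cancel_epi ((α_ _ _ _).inv ≫ (β_ _ _).hom ▷ H.obj b)]
      simp only [Category.assoc, χ]
      simp only [← MonoidalCategory.comp_whiskerRight_assoc, SymmetricCategory.symmetry,
        MonoidalCategory.id_whiskerRight, Category.id_comp, Iso.inv_hom_id_assoc]
    exact ⟨fun h b => (e b).1 (by rw [h]), fun h => homEv_ext fun b => (e b).2 (h b)⟩
  have hχa : ∀ a a' b, contraAct F a a' ▷ (Z ⊗ H.obj b) ≫ χ a b =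
      (α_ _ _ _).hom ≫ (a ⟶[V] a') ◁ χ a' b ≫ eComp V a a' b := by
    intro a a' b
    have h := congrArg (fun t => t ▷ H.obj b ≫ homEv H a b) (hφ a' a)
    simp only [MonoidalCategory.comp_whiskerRight, MonoidalCategory.whiskerLeft_comp,
      Category.assoc] at h
    rw [← MonoidalCategory.comp_whiskerRight_assoc (natObj H (corepr a') ◁ _),
      whisker_precompHom_homEv] at h
    have e := congrArg (· ▷ H.obj b) (braiding_swap_swap (a ⟶[V] a') (F.obj (.op a')) Z)
    have e' := congrArg (· ▷ H.obj b)
      (BraidedCategory.braiding_naturality_left (φ a') (a ⟶[V] a'))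
    have e'' := congrArg (· ▷ H.obj b)
      (BraidedCategory.braiding_naturality_left (contraAct F a a') Z)
    rw [BraidedCategory.braiding_naturality_left_assoc] at e
    simp only [MonoidalCategory.comp_whiskerRight] at e e' e''
    simp only [χ]
    rw [associator_inv_naturality_left_assoc, reassoc_of% e'']
    have hs : (Z ◁ contraAct F a a') ▷ H.obj b ≫ φ a ▷ H.obj b ≫ homEv H a b =
        (Z ◁ (β_ _ _).hom) ▷ H.obj b ≫ (Z ◁ (β_ _ _).hom) ▷ H.obj b ≫
          (Z ◁ contraAct F a a') ▷ H.obj b ≫ φ a ▷ H.obj b ≫ homEv H a b := by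
      simp only [← MonoidalCategory.comp_whiskerRight_assoc,
        ← MonoidalCategory.whiskerLeft_comp_assoc, SymmetricCategory.symmetry_assoc]
    rw [hs, h, reassoc_of% e', reassoc_of% e]
    simp
  have hχb : ∀ a b b', F.obj (.op a) ◁ Z ◁ act H b b' ≫ χ a b' =
      F.obj (.op a) ◁ (α_ _ _ _).inv ≫ (α_ _ _ _).inv ≫ χ a b ▷ (b ⟶[V] b') ≫ eComp V a b b' := by
    intro a b b'
    simp only [χ]
    rw [associator_inv_naturality_right_assoc, whisker_exchange_assoc, whisker_exchange_assoc,
      homEv_act]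
    simp
  choose r hr hr' using fun b => hp b (Z ⊗ H.obj b) (fun a => χ a b) fun a a' => hχa a a' b
  have hract : ∀ b b', Z ◁ act H b b' ≫ r b' =
      (α_ _ _ _).inv ≫ r b ▷ (b ⟶[V] b') ≫ act R b b' := fun b b' => hp.hom_ext fun a => by
    rw [MonoidalCategory.whiskerLeft_comp_assoc, hr, hχb, MonoidalCategory.whiskerLeft_comp_assoc,
      MonoidalCategory.whiskerLeft_comp_assoc, p.act_ev, associator_inv_naturality_middle_assoc,
      ← MonoidalCategory.comp_whiskerRight_assoc, hr]
  refine ⟨natMk r hract, fun a => (hχ _ a).2 fun b => ?_, fun m hm => nat_ext fun b => ?_⟩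
  · rw [natMk_evL, hr]
  · rw [natMk_evL]
    exact hr' b _ fun a => (hχ m a).1 (hm a) b

end Cone

section CoreprTensor

variable (F : EnrichedFunctor V Aᵒᵖ V)

/-- The coprojection `A(a, b) ⊗ F b ⟶ A(a, -) * F`. -/
def coreprι (a b : A) : (a ⟶[V] b) ⊗ F.obj (.op b) ⟶ weightedTensor (corepr a) F :=
  weightedι (corepr a) F b

theorem contraAct_coreprι (a b c : A) :
    (a ⟶[V] b) ◁ contraAct F b c ≫ coreprι F a b =
      (α_ _ _ _).inv ≫ eComp V a b c ▷ F.obj (.op c) ≫ coreprι F a c :=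
  (contraAct_weightedι (corepr a) F b c).trans
    (congrArg (fun t => (α_ _ _ _).inv ≫ t ▷ F.obj (.op c) ≫ coreprι F a c) (act_corepr a b c))

/-- The map `A(a, -) * F ⟶ F a` of the co-Yoneda lemma. -/
def coreprDesc (a : A) : weightedTensor (corepr a) F ⟶ F.obj (.op a) :=
  coendDesc (fun b => contraAct F a b) fun b c => by
    have h : (a ⟶[V] b) ◁ contraAct F b c ≫ contraAct F a b =
        (α_ _ _ _).inv ≫ eComp V a b c ▷ F.obj (.op c) ≫ contraAct F a c := by
      rw [comp_contraAct, Iso.inv_hom_id_assoc]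
    exact h.trans (congrArg (fun t => (α_ _ _ _).inv ≫ t ▷ F.obj (.op c) ≫ contraAct F a c)
      (act_corepr a b c).symm)

theorem coreprι_desc (a b : A) : coreprι F a b ≫ coreprDesc F a = contraAct F a b :=
  coendι_desc (fun b => contraAct F a b) _ b

/-- The map `F a ⟶ A(a, -) * F` given by the identity of `a`. -/
def coreprUnit (a : A) : F.obj (.op a) ⟶ weightedTensor (corepr a) F :=
  (λ_ _).inv ≫ eId V a ▷ F.obj (.op a) ≫ coreprι F a a

theorem coreprUnit_desc (a : A) : coreprUnit F a ≫ coreprDesc F a = 𝟙 _ := by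
  rw [coreprUnit, Category.assoc, Category.assoc, coreprι_desc, id_contraAct, Iso.inv_hom_id]

theorem contraAct_coreprUnit (a b : A) : contraAct F a b ≫ coreprUnit F a = coreprι F a b := by
  rw [coreprUnit, leftUnitor_inv_naturality_assoc, whisker_exchange_assoc, contraAct_coreprι,
    associator_inv_naturality_left_assoc, ← MonoidalCategory.comp_whiskerRight_assoc,
    (Iso.inv_comp_eq _).1 (e_id_comp V a b)]
  simp

theorem precompHom_lanMapL (a b c : A) :
    (b ⟶[V] a) ◁ coreprι F a c ≫ precompHom a b ▷ weightedTensor (corepr a) F ≫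
        lanMapL F (corepr a) (corepr b) =
      (α_ _ _ _).inv ≫ eComp V b a c ▷ F.obj (.op c) ≫ coreprι F b c := by
  have h : natObj (corepr (V := V) a) (corepr b) ◁ coreprι F a c ≫
      lanMapL F (corepr a) (corepr b) =
      (α_ _ _ _).inv ≫ coreprEv a b c ▷ F.obj (.op c) ≫ coreprι F b c :=
    weightedι_lanMapL F (corepr a) (corepr b) c
  rw [whisker_exchange_assoc, h, associator_inv_naturality_left_assoc,
    ← MonoidalCategory.comp_whiskerRight_assoc, precompHom_coreprEv]

theorem coreprUnit_natural (a b : A) :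
    (β_ _ _).hom ≫ contraAct F b a ≫ coreprUnit F b = coreprUnit F a ▷ (b ⟶[V] a) ≫
      _ ◁ precompHom a b ≫ lanMap F (corepr a) (corepr b) := by
  have h : lanMap F (corepr (V := V) a) (corepr b) = (β_ _ _).hom ≫ lanMapL F _ _ := by
    rw [lanMapL, SymmetricCategory.symmetry_assoc]
  rw [contraAct_coreprUnit, h, BraidedCategory.braiding_naturality_right_assoc,
    BraidedCategory.braiding_naturality_left_assoc, coreprUnit,
    MonoidalCategory.whiskerLeft_comp_assoc, MonoidalCategory.whiskerLeft_comp_assoc,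
    precompHom_lanMapL, associator_inv_naturality_middle_assoc,
    ← MonoidalCategory.comp_whiskerRight_assoc, (Iso.inv_comp_eq _).1 (e_comp_id V b a)]
  simp

end CoreprTensor

section Flat

variable {F : EnrichedFunctor V Aᵒᵖ V} {R : EnrichedFunctor V A V}

/-- The image under `- * F` of the leg of a pairing at `a`, followed by the co-Yoneda isomorphism
`A(a, -) * F ≅ F a`, is the contraction. -/
theorem Pairing.leg_lanMap (p : Pairing F R) (a : A) :
    weightedTensor R F ◁ p.leg a ≫ lanMap F R (corepr a) ≫ coreprDesc F a =
      (β_ _ _).hom ≫ p.contract a := by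
  have h' : lanMap F R (corepr a) = (β_ _ _).hom ≫ lanMapL F _ _ := by
    rw [lanMapL, SymmetricCategory.symmetry_assoc]
  rw [h', Category.assoc, BraidedCategory.braiding_naturality_right_assoc]
  congr 1
  apply weighted_extL
  intro b
  have h : natObj R (corepr a) ◁ weightedι R F b ≫ lanMapL F R (corepr a) =
      (α_ _ _ _).inv ≫ homEv R a b ▷ F.obj (.op b) ≫ coreprι F a b :=
    weightedι_lanMapL F R (corepr a) b
  rw [whisker_exchange_assoc, reassoc_of% h, coreprι_desc, weightedι_contract,
    associator_inv_naturality_left_assoc, ← MonoidalCategory.comp_whiskerRight_assoc, p.leg_homEv]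

/-- The two ways of pairing in `F a ⊗ (R * F) ⊗ R b` agree: bilinearity lets the counit slide past
the coend. This is what makes one triangle identity imply the other. -/
theorem Pairing.contract_ev (p : Pairing F R) (a b : A) :
    F.obj (.op a) ◁ p.evalAt R b ≫ p.ev a b =
      (α_ _ _ _).inv ≫ p.contract a ▷ R.obj b ≫ p.ev a b := by
  rw [← cancel_epi (α_ _ _ _).hom, Iso.hom_inv_id_assoc]
  apply weighted_extLR
  intro c
  have h := congrArg (F.obj (.op a) ◁ ·) (p.weightedι_evalAt R b c)
  simp only [MonoidalCategory.whiskerLeft_comp] at h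
  have h' := congrArg (· ▷ R.obj b) (p.weightedι_contract a c)
  simp only [MonoidalCategory.comp_whiskerRight] at h'
  rw [associator_naturality_middle_assoc, reassoc_of% h, p.act_ev, reassoc_of% h', p.contraAct_ev,
    associator_inv_naturality_right_assoc, whisker_exchange_assoc,
    associator_naturality_left_assoc]
  simp

/-- A presheaf that is flat for all indexes has a right adjoint, namely `{F, Y}`. -/
theorem exists_duality (hF : IsFlat (allIndexes V) F) :
    ∃ R : EnrichedFunctor V A V, Nonempty (Duality F R) := by
  obtain ⟨R, p, hp⟩ := exists_isUniversal F
  have hlim := hF Aᵒᵖ F trivial (coyonedaEmbedding V A) p.cone hp.isLimit_cone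
  rw [WeightedCone.isLimit_map_iff] at hlim
  have hψ : ∀ a b : A, 𝟙_ V ◁ ((β_ _ _).hom ≫ contraAct F b a) ≫ (λ_ _).hom ≫ coreprUnit F b =
      (α_ _ _ _).inv ≫ ((λ_ _).hom ≫ coreprUnit F a) ▷ (b ⟶[V] a) ≫
        _ ◁ precompHom a b ≫ lanMap F (corepr a) (corepr b) := fun a b => by
    rw [leftUnitor_naturality_assoc, Category.assoc, coreprUnit_natural]
    simp
  -- The identity of `F`, as a cone `F a ≅ A(a, -) * F` over the image of the Yoneda embedding,
  -- factors through the limit `R * F`.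
  obtain ⟨η, hη⟩ : ∃ η : 𝟙_ V ⟶ weightedTensor R F, ∀ a : A, η ▷ F.obj (.op a) ≫
      weightedTensor R F ◁ p.leg a ≫ lanMap F R (corepr a) = (λ_ _).hom ≫ coreprUnit F a := by
    obtain ⟨η, hη, -⟩ := hlim (𝟙_ V) (fun a => (λ_ _).hom ≫ coreprUnit F a.unop) fun a b => by
      refine (congrArg (fun t => 𝟙_ V ◁ t ≫ (λ_ _).hom ≫ coreprUnit F b.unop)
        (braiding_contraAct F a.unop b.unop).symm).trans ((hψ a.unop b.unop).trans ?_)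
      rw [← act_lanYoneda]
      rfl
    refine ⟨η, fun a => ?_⟩
    rw [← act_lanYoneda]
    exact hη (.op a)
  have h1 : ∀ a : A, F.obj (.op a) ◁ η ≫ p.contract a = (ρ_ _).hom := fun a => by
    have h := hη a =≫ coreprDesc F a
    rw [Category.assoc, Category.assoc, Category.assoc, p.leg_lanMap, coreprUnit_desc,
      BraidedCategory.braiding_naturality_left_assoc, Category.comp_id] at h
    rw [← cancel_epi (β_ _ _).hom, h]
    simp
  refine ⟨R, ⟨{ p with unit := η, unit_contract := h1, unit_evalAt := fun b => ?_ }⟩⟩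
  -- By universality it suffices to test the second triangle identity after pairing with `F a`.
  rw [← cancel_epi (λ_ _).inv, Iso.inv_hom_id]
  refine hp.hom_ext fun a => ?_
  rw [MonoidalCategory.whiskerLeft_comp_assoc, MonoidalCategory.whiskerLeft_comp_assoc,
    p.contract_ev, associator_inv_naturality_middle_assoc,
    ← MonoidalCategory.comp_whiskerRight_assoc, h1]
  simp

end Flat

end FlatDual

/-! ### Left adjoint modules and duals -/

section AdjointModules

section Zigzag

open Bicategory in
theorem leftZigzag_eq {B : Type u₁} [Bicategory.{u₂, v} B] {a b : B} {f : a ⟶ b} {g : b ⟶ a}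
    (unit : 𝟙 a ⟶ f ≫ g) (counit : g ≫ f ⟶ 𝟙 b) :
    leftZigzag unit counit = unit ▷ f ≫ (Bicategory.associator f g f).hom ≫ f ◁ counit := by
  simp [bicategoricalComp]

open Bicategory in
theorem rightZigzag_eq {B : Type u₁} [Bicategory.{u₂, v} B] {a b : B} {f : a ⟶ b} {g : b ⟶ a}
    (unit : 𝟙 a ⟶ f ≫ g) (counit : g ≫ f ⟶ 𝟙 b) :
    rightZigzag unit counit = g ◁ unit ≫ (Bicategory.associator g f g).inv ≫ counit ▷ g := by
  simp [bicategoricalComp]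

open Bicategory in
theorem isLeftAdjoint_of_triangles {B : Type u₁} [Bicategory.{u₂, v} B] {a b : B} (f : a ⟶ b)
    (g : b ⟶ a) (unit : 𝟙 a ⟶ f ≫ g) (counit : g ≫ f ⟶ 𝟙 b)
    (hl : unit ▷ f ≫ (Bicategory.associator f g f).hom ≫ f ◁ counit =
      (Bicategory.leftUnitor f).hom ≫ (Bicategory.rightUnitor f).inv)
    (hr : g ◁ unit ≫ (Bicategory.associator g f g).inv ≫ counit ▷ g =
      (Bicategory.rightUnitor g).hom ≫ (Bicategory.leftUnitor g).inv) :
    Bicategory.IsLeftAdjoint f :=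
  ⟨⟨g, { unit := unit
         counit := counit
         left_triangle := (leftZigzag_eq unit counit).trans hl
         right_triangle := (rightZigzag_eq unit counit).trans hr }⟩⟩

end Zigzag

section UnitModules

variable {A : Type v} [EnrichedCategory V A]

/-- A `V`-functor `R : A ⟶ V` as a module `A ⇸ I`. -/
def functorModule (R : EnrichedFunctor V A V) : VModule V A UnitObj.{v} where
  obj _ a := R.obj a
  lact _ _ a := (λ_ (R.obj a)).hom
  ract _ a a' := act R a a'
  id_lact _ a := (congrArg (· ≫ _) (MonoidalCategory.id_whiskerRight _ _)).trans
    (Category.id_comp _)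
  comp_lact _ _ _ a := by
    change (λ_ (𝟙_ V)).hom ▷ R.obj a ≫ (λ_ _).hom =
      (α_ _ _ _).hom ≫ 𝟙_ V ◁ (λ_ _).hom ≫ (λ_ _).hom
    simp
  ract_id _ a := eId_act R a
  ract_comp _ a₁ a₂ a₃ := eComp_act R a₁ a₂ a₃
  lact_ract _ _ a a' := by
    change (λ_ (R.obj a)).hom ▷ (a ⟶[V] a') ≫ act R a a' =
      (α_ _ _ _).hom ≫ 𝟙_ V ◁ act R a a' ≫ (λ_ _).hom
    simp

theorem VModule.lact_unitObj (M : VModule V A UnitObj.{v}) (a : A) :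
    M.lact .star .star a = (λ_ _).hom :=
  ((congrArg (· ≫ M.lact .star .star a) (MonoidalCategory.id_whiskerRight _ _)).trans
    (Category.id_comp _)).symm.trans (M.id_lact .star a)

theorem VModule.ract_unitObj (M : VModule V UnitObj.{v} A) (a : A) :
    M.ract a .star .star = (ρ_ _).hom :=
  ((congrArg (· ≫ M.ract a .star .star) (MonoidalCategory.whiskerLeft_id _ _)).trans
    (Category.id_comp _)).symm.trans (M.ract_id a .star)

/-- Every module `A ⇸ I` is given by a `V`-functor `A ⟶ V`. -/
theorem exists_functorModule_eq (M : VModule V A UnitObj.{v}) :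
    ∃ R : EnrichedFunctor V A V, M = functorModule R := by
  have hl := M.lact_unitObj
  obtain ⟨obj, lact, ract, h1, h2, h3, h4, h5⟩ := M
  obtain ⟨o, rfl⟩ : ∃ o : A → V, obj = fun _ a => o a := ⟨obj .star, by funext ⟨⟩; rfl⟩
  obtain rfl : lact = fun _ _ a => (λ_ (o a)).hom := by
    funext ⟨⟩ ⟨⟩ a
    exact hl a
  obtain ⟨r, rfl⟩ : ∃ r : ∀ a a' : A, o a ⊗ (a ⟶[V] a') ⟶ o a', ract = fun _ => r :=
    ⟨ract .star, by funext ⟨⟩; rfl⟩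
  refine ⟨ofAct o r (h3 .star) (h4 .star), ?_⟩
  have hr : r = act (ofAct o r (h3 .star) (h4 .star)) := by
    funext a a'
    exact (act_ofAct o r _ _ a a').symm
  unfold functorModule
  congr
  funext _
  exact hr

end UnitModules

variable [HasLimits V] [HasColimits V] {A : Type v} [EnrichedCategory V A]

section Counit

variable {B : Type v} [EnrichedCategory V B] {M : VModule V A B} {N : VModule V B A}
  (ε : VModule.compMod M N ⟶ VModule.idMod A)

/-- The restriction of a morphism `N ∘ M ⟶ 1` to the coprojections of the coend `N ∘ M`. -/
def counitι (a : A) (b : B) (a' : A) : N.obj a b ⊗ M.obj b a' ⟶ (a ⟶[V] a') :=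
  VModule.compι M N a b a' ≫ ε.app a a'

theorem lact_counitι (a a' : A) (b : B) (a'' : A) :
    N.lact a a' b ▷ M.obj b a'' ≫ counitι ε a b a'' =
      (α_ _ _ _).hom ≫ (a ⟶[V] a') ◁ counitι ε a' b a'' ≫ eComp V a a' a'' := by
  have h := VModule.compι_lact M N a a' b a'' =≫ ε.app a a''
  rw [Category.assoc, ε.lact_app, Category.assoc, Category.assoc, Iso.eq_inv_comp] at h
  rw [counitι, counitι, ← h, MonoidalCategory.whiskerLeft_comp_assoc]

theorem ract_counitι (a : A) (b : B) (a' a'' : A) :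
    N.obj a b ◁ M.ract b a' a'' ≫ counitι ε a b a'' =
      (α_ _ _ _).inv ≫ counitι ε a b a' ▷ (a' ⟶[V] a'') ≫ eComp V a a' a'' := by
  have h := VModule.compι_ract M N a b a' a'' =≫ ε.app a a''
  rw [Category.assoc, ε.ract_app, Category.assoc, Category.assoc, ← Iso.inv_comp_eq] at h
  rw [counitι, counitι, ← h, MonoidalCategory.comp_whiskerRight_assoc]

/-- The morphism `N ∘ M ⟶ 1` induced by a family that is compatible with all the actions. -/
def homOfCounitι (f : ∀ (a : A) (b : B) (a' : A), N.obj a b ⊗ M.obj b a' ⟶ (a ⟶[V] a'))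
    (hf : ∀ a b b' a', N.obj a b ◁ M.lact b b' a' ≫ f a b a' =
      (α_ _ _ _).inv ≫ N.ract a b b' ▷ M.obj b' a' ≫ f a b' a')
    (hl : ∀ a a' b a'', N.lact a a' b ▷ M.obj b a'' ≫ f a b a'' =
      (α_ _ _ _).hom ≫ (a ⟶[V] a') ◁ f a' b a'' ≫ eComp V a a' a'')
    (hr : ∀ a b a' a'', N.obj a b ◁ M.ract b a' a'' ≫ f a b a'' =
      (α_ _ _ _).inv ≫ f a b a' ▷ (a' ⟶[V] a'') ≫ eComp V a a' a'') :
    VModule.compMod M N ⟶ VModule.idMod A where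
  app a a' := VModule.compDesc (fun b => f a b a') (fun b b' => hf a b b' a')
  lact_app a a' a'' := by
    apply VModule.comp_extL
    intro b
    rw [VModule.compι_lact_assoc, VModule.compι_desc, ← MonoidalCategory.whiskerLeft_comp_assoc,
      VModule.compι_desc, hl, Iso.inv_hom_id_assoc]
  ract_app a a' a'' := by
    apply VModule.comp_extR
    intro b
    rw [VModule.compι_ract_assoc, VModule.compι_desc, ← MonoidalCategory.comp_whiskerRight_assoc,
      VModule.compι_desc, hr, Iso.hom_inv_id_assoc]

theorem counitι_homOfCounitι
    (f : ∀ (a : A) (b : B) (a' : A), N.obj a b ⊗ M.obj b a' ⟶ (a ⟶[V] a')) (hf) (hl) (hr)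
    (a : A) (b : B) (a' : A) : counitι (homOfCounitι f hf hl hr) a b a' = f a b a' :=
  VModule.compι_desc (fun b => f a b a') (fun b b' => hf a b b' a') b

theorem compι_leftZigzag (a a' : A) (b b'' : B) :
    N.obj a b ◁ VModule.compι N M b a' b'' ≫ VModule.compι (VModule.compMod N M) N a b b'' ≫
      (VModule.assoc N M N).hom.app a b'' ≫ (VModule.wl N ε).app a b'' ≫
        (VModule.ru N).hom.app a b'' =
      (α_ _ _ _).inv ≫ counitι ε a b a' ▷ N.obj a' b'' ≫ N.lact a a' b'' := by
  rw [VModule.compι_assoc_hom_assoc, VModule.compι_wl_assoc, VModule.compι_ru, counitι,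
    MonoidalCategory.comp_whiskerRight_assoc]

theorem compι_rightZigzag (a a' : A) (b b' : B) :
    VModule.compι N M b a b' ▷ M.obj b' a' ≫ VModule.compι M (VModule.compMod N M) b b' a' ≫
      (VModule.assoc M N M).inv.app b a' ≫ (VModule.wr ε M).app b a' ≫
        (VModule.lu M).hom.app b a' =
      (α_ _ _ _).hom ≫ M.obj b a ◁ counitι ε a b' a' ≫ M.ract b a a' := by
  rw [VModule.compι_assoc_inv_assoc, VModule.compι_wr_assoc, VModule.compι_lu, counitι,
    MonoidalCategory.whiskerLeft_comp_assoc]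

end Counit

section Adjunction

variable {F : EnrichedFunctor V Aᵒᵖ V} {R : EnrichedFunctor V A V}

/-- The pairing underlying a morphism of modules `F ∘ R ⟶ 1`. -/
def pairingOfHom (ε : VModule.compMod (functorModule R) (presheafModule F) ⟶ VModule.idMod A) :
    Pairing F R where
  ev a b := counitι ε a .star b
  contraAct_ev a a' b := lact_counitι ε a a' .star b
  act_ev a b b' := ract_counitι ε a .star b b'

variable (ε : VModule.compMod (functorModule R) (presheafModule F) ⟶ VModule.idMod A)

theorem compι_leftZigzag_eq_contract (a : A) :
    VModule.compι (VModule.compMod (presheafModule F) (functorModule R)) (presheafModule F)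
        a .star .star ≫
      (VModule.assoc (presheafModule F) (functorModule R) (presheafModule F)).hom.app a .star ≫
        (VModule.wl (presheafModule F) ε).app a .star ≫
          (VModule.ru (presheafModule F)).hom.app a .star = (pairingOfHom ε).contract a := by
  apply weighted_extL
  intro b
  exact (compι_leftZigzag ε a b .star .star).trans
    ((pairingOfHom ε).weightedι_contract a b).symm

theorem compι_rightZigzag_eq_evalAt (a : A) :
    VModule.compι (functorModule R) (VModule.compMod (presheafModule F) (functorModule R))
        .star .star a ≫
      (VModule.assoc (functorModule R) (presheafModule F) (functorModule R)).inv.app .star a ≫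
        (VModule.wr ε (functorModule R)).app .star a ≫
          (VModule.lu (functorModule R)).hom.app .star a = (pairingOfHom ε).evalAt R a := by
  apply weighted_extR
  intro b
  exact (compι_rightZigzag ε b a .star .star).trans
    ((pairingOfHom ε).weightedι_evalAt R a b).symm

/-- The value of a morphism of modules `1 ⟶ R ∘ F` over `I`, as a map in `V`. -/
def unitValue (η : VModule.idMod UnitObj.{v} ⟶
    VModule.compMod (presheafModule F) (functorModule R)) : 𝟙_ V ⟶ weightedTensor R F :=
  η.app .star .star

variable (η : VModule.idMod UnitObj.{v} ⟶
    VModule.compMod (presheafModule F) (functorModule R))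

/-- The first triangle identity for modules, in terms of the underlying pairing. -/
theorem leftZigzag_iff :
    VModule.wr η (presheafModule F) ≫
        (VModule.assoc (presheafModule F) (functorModule R) (presheafModule F)).hom ≫
          VModule.wl (presheafModule F) ε =
      (VModule.lu (presheafModule F)).hom ≫ (VModule.ru (presheafModule F)).inv ↔
    ∀ a : A, F.obj (.op a) ◁ unitValue η ≫ (pairingOfHom ε).contract a = (ρ_ _).hom := by
  rw [← Category.assoc, Iso.eq_comp_inv, Category.assoc, Category.assoc]
  have key : ∀ a : A, VModule.compι (VModule.idMod UnitObj.{v}) (presheafModule F) a .star .star ≫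
      (VModule.wr η (presheafModule F) ≫
        (VModule.assoc (presheafModule F) (functorModule R) (presheafModule F)).hom ≫
          VModule.wl (presheafModule F) ε ≫ (VModule.ru (presheafModule F)).hom).app a .star =
      F.obj (.op a) ◁ unitValue η ≫ (pairingOfHom ε).contract a := fun a => by
    rw [← compι_leftZigzag_eq_contract]
    exact VModule.compι_wr_assoc η (presheafModule F) a .star .star _
  have key' : ∀ a : A, VModule.compι (VModule.idMod UnitObj.{v}) (presheafModule F)
      a .star .star ≫ (VModule.lu (presheafModule F)).hom.app a .star =
      (ρ_ (F.obj (.op a))).hom := fun a =>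
    VModule.compι_lu (presheafModule F) a .star .star
  constructor
  · intro h a
    rw [← key, ← key', h]
  · intro h
    ext a ⟨⟩
    apply VModule.comp_ext
    rintro ⟨⟩
    exact (key a).trans ((h a).trans (key' a).symm)

/-- The second triangle identity for modules, in terms of the underlying pairing. -/
theorem rightZigzag_iff :
    VModule.wl (functorModule R) η ≫
        (VModule.assoc (functorModule R) (presheafModule F) (functorModule R)).inv ≫
          VModule.wr ε (functorModule R) =
      (VModule.ru (functorModule R)).hom ≫ (VModule.lu (functorModule R)).inv ↔
    ∀ a : A, unitValue η ▷ R.obj a ≫ (pairingOfHom ε).evalAt R a = (λ_ _).hom := by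
  rw [← Category.assoc, Iso.eq_comp_inv, Category.assoc, Category.assoc]
  have key : ∀ a : A, VModule.compι (functorModule R) (VModule.idMod UnitObj.{v}) .star .star a ≫
      (VModule.wl (functorModule R) η ≫
        (VModule.assoc (functorModule R) (presheafModule F) (functorModule R)).inv ≫
          VModule.wr ε (functorModule R) ≫ (VModule.lu (functorModule R)).hom).app .star a =
      unitValue η ▷ R.obj a ≫ (pairingOfHom ε).evalAt R a := fun a => by
    rw [← compι_rightZigzag_eq_evalAt]
    exact VModule.compι_wl_assoc (functorModule R) η .star .star a _
  have key' : ∀ a : A, VModule.compι (functorModule R) (VModule.idMod UnitObj.{v})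
      .star .star a ≫ (VModule.ru (functorModule R)).hom.app .star a = (λ_ (R.obj a)).hom :=
    fun a => VModule.compι_ru (functorModule R) .star .star a
  constructor
  · intro h a
    rw [← key, ← key', h]
  · intro h
    ext ⟨⟩ a
    apply VModule.comp_ext
    rintro ⟨⟩
    exact (key a).trans ((h a).trans (key' a).symm)

/-- The morphism of modules `1 ⟶ R ∘ F` over `I` with a given value. -/
def homOfUnitValue (e : 𝟙_ V ⟶ weightedTensor R F) :
    VModule.idMod UnitObj.{v} ⟶ VModule.compMod (presheafModule F) (functorModule R) where
  app _ _ := e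
  lact_app := by
    rintro ⟨⟩ ⟨⟩ ⟨⟩
    rw [VModule.lact_unitObj, VModule.lact_unitObj]
    exact (leftUnitor_naturality e).symm
  ract_app := by
    rintro ⟨⟩ ⟨⟩ ⟨⟩
    rw [VModule.ract_unitObj, VModule.ract_unitObj]
    exact (rightUnitor_naturality e).symm

/-- The morphism of modules `F ∘ R ⟶ 1` given by a pairing. -/
def Pairing.toHom (p : Pairing F R) :
    VModule.compMod (functorModule R) (presheafModule F) ⟶ VModule.idMod A :=
  homOfCounitι (fun a _ b => p.ev a b)
    (fun a _ _ b => by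
      have h : F.obj (.op a) ◁ (λ_ (R.obj b)).hom ≫ p.ev a b =
          (α_ _ _ _).inv ≫ (ρ_ _).hom ▷ R.obj b ≫ p.ev a b := by simp
      exact h)
    (fun a a' _ b => p.contraAct_ev a a' b) (fun a _ b b' => p.act_ev a b b')

theorem Pairing.pairingOfHom_toHom (p : Pairing F R) : pairingOfHom p.toHom = p := by
  have h : (pairingOfHom p.toHom).ev = p.ev := by
    funext a b
    exact counitι_homOfCounitι (M := functorModule R) (N := presheafModule F) _ _ _ _ a .star b
  cases p
  unfold pairingOfHom at h ⊢
  congr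

theorem isLeftAdjointModule_iff :
    IsLeftAdjointModule F ↔ ∃ R : EnrichedFunctor V A V, Nonempty (Duality F R) := by
  constructor
  · rintro ⟨⟨M, adj⟩⟩
    obtain ⟨R, rfl⟩ := exists_functorModule_eq (A := A) M
    have hl := (leftZigzag_eq adj.unit adj.counit).symm.trans adj.left_triangle
    have hr := (rightZigzag_eq adj.unit adj.counit).symm.trans adj.right_triangle
    exact ⟨R, ⟨{ pairingOfHom adj.counit with
      unit := unitValue adj.unit
      unit_contract := (leftZigzag_iff adj.counit adj.unit).1 hl
      unit_evalAt := (rightZigzag_iff adj.counit adj.unit).1 hr }⟩⟩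
  · rintro ⟨R, ⟨d⟩⟩
    have hl := (leftZigzag_iff d.toHom (homOfUnitValue d.unit)).2 (by
      rw [Pairing.pairingOfHom_toHom]
      exact d.unit_contract)
    have hr := (rightZigzag_iff d.toHom (homOfUnitValue d.unit)).2 (by
      rw [Pairing.pairingOfHom_toHom]
      exact d.unit_evalAt)
    exact isLeftAdjoint_of_triangles (B := ModCat V) (a := ModCat.mk UnitObj.{v})
      (b := ModCat.mk A) (presheafModule F) (functorModule R) (homOfUnitValue d.unit) d.toHom hl hr

end Adjunction

/-- A presheaf is flat for all indexes exactly when it is a left adjoint module. -/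
theorem isFlat_allIndexes_iff (F : EnrichedFunctor V Aᵒᵖ V) :
    IsFlat (allIndexes V) F ↔ IsLeftAdjointModule F :=
  ⟨fun hF => isLeftAdjointModule_iff.2 (exists_duality hF), fun hF => by
    obtain ⟨_, ⟨d⟩⟩ := isLeftAdjointModule_iff.1 hF
    exact d.isFlat _⟩

/-- Full subcategories determined by equivalent properties are isomorphic over the ambient
`V`-category. -/
theorem exists_fullSub_iso {D : Type u₁} [EnrichedCategory V D] {p q : D → Prop}
    (h : ∀ X, p X ↔ q X) :
    ∃ (S : EnrichedFunctor V (FullSub p) (FullSub q))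
      (T : EnrichedFunctor V (FullSub q) (FullSub p)),
      S.comp V T = EnrichedFunctor.id V _ ∧ T.comp V S = EnrichedFunctor.id V _ ∧
      S.comp V (fullSubInclusion V q) = fullSubInclusion V p := by
  obtain rfl : p = q := funext fun X => propext (h X)
  have key : ∀ {E : Type u₁} [EnrichedCategory V E] (T : EnrichedFunctor V (FullSub p) E),
      (EnrichedFunctor.id V (FullSub p)).comp V T = T := fun T => by
    obtain ⟨obj, map, h₁, h₂⟩ := T
    unfold EnrichedFunctor.comp
    congr
    funext X Y
    exact Category.id_comp _
  exact ⟨EnrichedFunctor.id V _, EnrichedFunctor.id V _, key _, key _, key _⟩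

end AdjointModules

end EnrichedFlat

end

theorem theorem2p6 (V : Type u) [Category.{v} V] [MonoidalCategory V] [SymmetricCategory V]
    [MonoidalClosed V] [HasLimits V] [HasColimits V] (A : Type v) [EnrichedCategory V A] :
    (∀ F : EnrichedFunctor V Aᵒᵖ V,
      EnrichedFlat.IsFlat (EnrichedFlat.allIndexes V) F ↔ EnrichedFlat.IsLeftAdjointModule F) ∧
    ∃ (S : EnrichedFunctor V (EnrichedFlat.FlatCompletion A (EnrichedFlat.allIndexes V))
        (EnrichedFlat.CauchyCompletion V A))
      (T : EnrichedFunctor V (EnrichedFlat.CauchyCompletion V A)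
        (EnrichedFlat.FlatCompletion A (EnrichedFlat.allIndexes V))),
      S.comp V T = EnrichedFunctor.id V _ ∧ T.comp V S = EnrichedFunctor.id V _ ∧
      S.comp V (EnrichedFlat.fullSubInclusion V _) = EnrichedFlat.fullSubInclusion V _ :=
  ⟨EnrichedFlat.isFlat_allIndexes_iff,
    EnrichedFlat.exists_fullSub_iso EnrichedFlat.isFlat_allIndexes_iff⟩
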